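/- Let $d\ge 1$ and let $p\ge 2$ be an even integer with $p\ge 8/d$. Consider the defocusing Gabitov--Turitsyn equation on $\mathbb R^d$, $$ i u_t-\Delta u+\int_0^1 e^{-i\sigma\Delta}\Big[\big|e^{i\sigma\Delta}u\big|^p\, e^{i\sigma\Delta}u\Big]\,d\sigma=0,\qquad u(0)=u_0, $$ and write $$ K(f)=\|f\|_{\dot H^1}^2=\int|\nabla f|^2dx,\qquad U(f)=\int_0^1\!\!\int_{\mathbb R^d}|e^{i\sigma\Delta}f|^{p+2}\,dx\,d\sigma, $$ $$ E(f)=\tfrac12K(f)+\tfrac1{p+2}U(f),\qquad V(f)=\int_{\mathbb R^d}|x|^2|f|^2dx. $$ For all $0<\kappa_1\le\kappa_2$ there are constants $c,C>0$, depending only on $d,p,\kappa_1,\kappa_2$, such that the following holds. Let $s\ge 2$ with $s>d/2$, let $-\tfrac12\le T<0$, and let $u\in C([T,0];H^s(\mathbb R^d))$ be a strong solution of the equation on $[T,0]$ (the equation holds in $L^2$ at every $t\in[T,0]$) whose initial datum $u_0=u(0)$ is real-valued with $|x|u_0\in L^2$. Suppose that $$ \kappa_1\,\frac{V(u_0)}{E(u_0)}\le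 T^2\le\kappa_2\,\frac{V(u_0)}{E(u_0)} . $$ Then $$ K(u(T))\ \ge\ c\,U(u(T)). $$ If moreover $K(u_0)\le U(u_0)$, then the kinetic and potential energy become comparable by time $T$: $$ c\,U(u_0)\le K(u(T))\le C\,U(u_0), $$ and there is a time $t\in[T,0]$ with $$ c\,U(u(t))\le K(u(t))\le C\,U(u(t)). $$ -/

import Mathlib

open MeasureTheory Filter Topology Set
open scoped FourierTransform ENNReal

noncomputable section

namespace GabitovTuritsyn

/-- The complex Hilbert space `L²(ℝᵈ; ℂ)`. -/
abbrev L2 (d : ℕ) : Type :=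
  Lp ℂ 2 (volume : Measure (EuclideanSpace ℝ (Fin d)))

/-- The Fourier multiplier operator `f ↦ 𝓕⁻¹ (m · 𝓕 f)` on `L²`, where `f` is in its domain if
`m · 𝓕 f ∈ L²` (and the value is `0` outside of the domain). Mathlib's Fourier transform uses the
kernel `exp (-2πi ⟨x, ξ⟩)`, so that the usual frequency variable is `2πξ`. -/
def fourierMultiplier {d : ℕ} (m : EuclideanSpace ℝ (Fin d) → ℂ) (f : L2 d) : L2 d :=
  open Classical in
  if h : MemLp (fun ξ => m ξ * (𝓕 f : L2 d) ξ) 2 volume then 𝓕⁻ (h.toLp : L2 d) else 0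

/-- The symbol of the free Schrödinger propagator `e^{iσΔ}`. -/
def schrodingerSymbol {d : ℕ} (σ : ℝ) (ξ : EuclideanSpace ℝ (Fin d)) : ℂ :=
  Complex.exp (-(Complex.I * ((σ * (2 * Real.pi * ‖ξ‖) ^ 2 : ℝ) : ℂ)))

/-- The free Schrödinger propagator `e^{iσΔ}` on `L²`. -/
def freeProp {d : ℕ} (σ : ℝ) (f : L2 d) : L2 d :=
  fourierMultiplier (schrodingerSymbol σ) f

/-- Every `f ∈ L²` is in the domain of the free propagator. -/
theorem memLp_schrodingerSymbol_mul {d : ℕ} (σ : ℝ) (f : L2 d) :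
    MemLp (fun ξ => schrodingerSymbol σ ξ * (𝓕 f : L2 d) ξ) 2 volume := by
  refine (Lp.memLp (𝓕 f : L2 d)).of_le ?_ (Eventually.of_forall fun ξ => ?_)
  · refine Continuous.aestronglyMeasurable ?_ |>.mul (Lp.memLp (𝓕 f : L2 d)).1
    unfold schrodingerSymbol
    fun_prop
  · have h : ‖schrodingerSymbol σ ξ‖ = 1 := by
      rw [schrodingerSymbol, Complex.norm_exp]
      simp [-Complex.ofReal_mul, -Complex.ofReal_pow]
    rw [norm_mul, h, one_mul]

/-- The Laplacian as an (unbounded) operator on `L²`, with domain `H²`. -/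
def laplacian {d : ℕ} (f : L2 d) : L2 d :=
  fourierMultiplier (fun ξ => ((-(2 * Real.pi * ‖ξ‖) ^ 2 : ℝ) : ℂ)) f

/-- The Sobolev norm `‖f‖_{Hˢ}`, with value `∞` if `f ∉ Hˢ`. -/
def sobolevNorm {d : ℕ} (s : ℝ) (f : L2 d) : ℝ≥0∞ :=
  eLpNorm (fun ξ => (((1 + (2 * Real.pi * ‖ξ‖) ^ 2) ^ (s / 2) : ℝ) : ℂ) * (𝓕 f : L2 d) ξ) 2 volume

/-- The power nonlinearity `f ↦ |f|ᵖ f`, for those `f` with `|f|ᵖ f ∈ L²`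
(and `0` for the others). -/
def powerNL {d : ℕ} (p : ℕ) (f : L2 d) : L2 d :=
  open Classical in
  if h : MemLp (fun x => ((‖f x‖ ^ p : ℝ) : ℂ) * f x) 2 volume then h.toLp else 0

/-- The averaged nonlinearity `∫₀¹ e^{-iσΔ} [|e^{iσΔ} f|ᵖ e^{iσΔ} f] dσ`. -/
def nonlinearity {d : ℕ} (p : ℕ) (f : L2 d) : L2 d :=
  ∫ σ in (0 : ℝ)..1, freeProp (-σ) (powerNL p (freeProp σ f))

/-- `u` is a strong `Hˢ` solution, on the time interval `J`, of the Gabitov–Turitsyn equation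
`i u_t + γ Δ u + ∫₀¹ e^{-iσΔ} [|e^{iσΔ} u|ᵖ e^{iσΔ} u] dσ = 0`:
it belongs to `C(J; Hˢ)`, and the equation holds in `L²` at every time in `J`
(with one-sided derivatives at the endpoints that belong to `J`).
This is to be used with `s ≥ 2` and `s > d / 2`, when all terms make sense in `L²`. -/
structure IsSolution {d : ℕ} (γ : ℝ) (p : ℕ) (s : ℝ) (J : Set ℝ) (u : ℝ → L2 d) : Prop where
  mem_sobolev : ∀ t ∈ J, sobolevNorm s (u t) < ∞
  continuous_sobolev :
    ∀ t₀ ∈ J, Tendsto (fun t => sobolevNorm s (u t - u t₀)) (𝓝[J] t₀) (𝓝 0)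
  equation : ∀ t ∈ J, ∃ u' : L2 d, HasDerivWithinAt u u' J t ∧
    Complex.I • u' + (γ : ℂ) • laplacian (u t) + nonlinearity p (u t) = 0

/-- `‖f‖²` in the homogeneous Sobolev space `Ḣ¹`, that is `∫ |∇f|² dx`. -/
def kinetic {d : ℕ} (f : L2 d) : ℝ :=
  ∫ ξ, (2 * Real.pi * ‖ξ‖) ^ 2 * ‖(𝓕 f : L2 d) ξ‖ ^ 2

/-- The time-averaged potential term `∫₀¹ ∫ |e^{iσΔ} f|^{p+2} dx dσ`. -/
def potential {d : ℕ} (p : ℕ) (f : L2 d) : ℝ :=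
  ∫ σ in (0 : ℝ)..1, ∫ x, ‖freeProp σ f x‖ ^ (p + 2)

/-- The energy `-(γ/2) ∫ |∇f|² + (1/(p+2)) ∫₀¹ ∫ |e^{iσΔ} f|^{p+2} dx dσ`. -/
def energy {d : ℕ} (γ : ℝ) (p : ℕ) (f : L2 d) : ℝ :=
  -(γ / 2) * kinetic f + 1 / ((p : ℝ) + 2) * potential p f

/-- The variance `∫ |x|² |f(x)|² dx`. -/
def variance {d : ℕ} (f : L2 d) : ℝ :=
  ∫ x, ‖x‖ ^ 2 * ‖f x‖ ^ 2

end GabitovTuritsyn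

end

/-! Write P = -i∇, p = 2k, n = dk - 3, F(σ) = ∫|e^{iσΔ}u|^{p+2} and A(t) = Re⟨Pu, xu⟩. Going
backwards in time, A is forced to grow at least linearly, while the variance V grows at most
quadratically. Cauchy–Schwarz, A² ≤ V K, then forces K(u(T)) to carry a fixed fraction of the
conserved energy E.

Quantitatively: A(0) = 0 because the data are real, and A(T) ≥ A(0) + 4E|T|
(`IsSolution.le_sum_re_inner`), while V(T) ≤ 2V(0) + 32 E T² (`IsSolution.sum_norm_sq_le`). Hence 16
E² T² ≤ (2V(0) + 32 E T²) K(u(T)), and κ₁ V(0) ≤ E T² gives K(u(T)) ≥ 16/(2/κ₁ + 32) · E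
(`IsSolution.energy_le_kinetic`). Energy conservation turns E into U at any time, and the
intermediate value theorem applied to K - cU supplies the time at which K and U are comparable.

Both virial estimates come from one family of identities, for ‖x e^{iaΔ}u‖² = ‖(x + 2aP)u‖². The
operator e^{iaΔ} commutes with the linear flow and moves the averaging window from [0,1] to [-a,
1-a], so a single computation over a general window covers every a. The values a = ±1 polarise to
8A, and the difference of the two densities is 16K + (32F(1) + 16(n+1)U)/(p+2), which is at least
32E when n ≥ 1, that is p ≥ 8/d. For a = 0 the nonlinear terms have the favourable sign.

The nonlinear contribution (`sum_im_inner_windowNL`) is found by differentiating the potential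
energy of e^{ib|x|²}f at b = 0 in two ways: by its first-order Taylor expansion, and by the lens
transformation, which turns a chirp into a rescaling of the propagation time.

Since x is unbounded and u is differentiable in time only with values in L², x_j is replaced by
(e^{iεx_j} - 1)/(iε). These operators are bounded, and by Galilean covariance they interact well
with the Laplacian and with the nonlinearity. Gronwall and Fatou give finite variance; dominated
convergence gives the integrated identities. -/

noncomputable section

namespace GabitovTuritsyn

open scoped SchwartzMap

/-- The physical (or frequency) space. -/
abbrev Sp (d : ℕ) : Type := EuclideanSpace ℝ (Fin d)

variable {d : ℕ}

/-! ### The Fourier transform on `L¹ ∩ L²` -/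

theorem ae_eq_of_integral_schwartz_smul_eq {f g : Sp d → ℂ} (hf : LocallyIntegrable f)
    (hg : LocallyIntegrable g)
    (h : ∀ φ : 𝓢(Sp d, ℂ), ∫ x, φ x • f x = ∫ x, φ x • g x) : f =ᵐ[volume] g := by
  refine ae_eq_of_integral_contDiff_smul_eq hf hg fun φ hφ hφc => ?_
  have hcs : HasCompactSupport (Complex.ofRealCLM ∘ φ) := hφc.comp_left rfl
  have := h (hcs.toSchwartzMap (Complex.ofRealCLM.contDiff.comp hφ))
  simpa using this

/-- The abstract L² transform and the integral are tested against Schwartz functions: the first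
agrees with the transform of tempered distributions, the second satisfies the multiplication formula
by Fubini. All explicit kernel computations enter through this identification and its forward
counterpart. -/
theorem fourierInv_toLp_of_integrable {f : Sp d → ℂ} (h1 : Integrable f) (h2 : MemLp f 2 volume) :
    ((𝓕⁻ (h2.toLp : L2 d) : L2 d) : Sp d → ℂ) =ᵐ[volume] 𝓕⁻ f := by
  have hcont : Continuous (𝓕⁻ f) := by
    have : 𝓕⁻ f = fun x => 𝓕 f (-x) := funext fun x => Real.fourierInv_eq_fourier_neg f x
    rw [this]
    exact (VectorFourier.fourierIntegral_continuous Real.continuous_fourierChar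
      (innerSL ℝ).continuous₂ h1).comp continuous_neg
  refine ae_eq_of_integral_schwartz_smul_eq
    ((Lp.memLp _).locallyIntegrable (by norm_num)) hcont.locallyIntegrable fun φ => ?_
  have e1 := Lp.fourierInv_toTemperedDistribution_eq (h2.toLp : L2 d)
  have e2 := congrArg (fun D => D φ) e1
  simp only [TemperedDistribution.fourierInv_apply, Lp.toTemperedDistribution_apply] at e2
  rw [← e2]
  have e3 : ∫ x, (𝓕⁻ φ) x • (h2.toLp : L2 d) x = ∫ x, (𝓕⁻ (φ : Sp d → ℂ)) x • f x := by
    refine integral_congr_ae ?_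
    filter_upwards [h2.coeFn_toLp] with x hx
    rw [hx, SchwartzMap.fourierInv_coe]
  rw [e3]
  have e4 := VectorFourier.integral_fourierIntegral_smul_eq_flip (L := -(innerₗ (Sp d)))
    (μ := volume) (ν := volume) (f := φ) (g := f) Real.continuous_fourierChar
    (continuous_inner (𝕜 := ℝ) (E := Sp d)).neg φ.integrable h1
  have hfl : (-(innerₗ (Sp d))).flip = -(innerₗ (Sp d)) := by
    ext x y; simp [real_inner_comm]
  rw [hfl] at e4
  exact e4

theorem fourier_toLp_of_integrable {f : Sp d → ℂ} (h1 : Integrable f) (h2 : MemLp f 2 volume) :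
    ((𝓕 (h2.toLp : L2 d) : L2 d) : Sp d → ℂ) =ᵐ[volume] 𝓕 f := by
  have hcont : Continuous (𝓕 f) := VectorFourier.fourierIntegral_continuous
    Real.continuous_fourierChar (innerSL ℝ).continuous₂ h1
  refine ae_eq_of_integral_schwartz_smul_eq
    ((Lp.memLp _).locallyIntegrable (by norm_num)) hcont.locallyIntegrable fun φ => ?_
  have e1 := Lp.fourier_toTemperedDistribution_eq (h2.toLp : L2 d)
  have e2 := congrArg (fun D => D φ) e1
  simp only [TemperedDistribution.fourier_apply, Lp.toTemperedDistribution_apply] at e2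
  rw [← e2]
  have e3 : ∫ x, (𝓕 φ) x • (h2.toLp : L2 d) x = ∫ x, (𝓕 (φ : Sp d → ℂ)) x • f x := by
    refine integral_congr_ae ?_
    filter_upwards [h2.coeFn_toLp] with x hx
    rw [hx, SchwartzMap.fourier_coe]
  rw [e3]
  have e4 := VectorFourier.integral_fourierIntegral_smul_eq_flip (L := innerₗ (Sp d))
    (μ := volume) (ν := volume) (f := φ) (g := f) Real.continuous_fourierChar
    (by simpa using continuous_inner (𝕜 := ℝ) (E := Sp d)) φ.integrable h1
  rwa [flip_innerₗ] at e4

/-! ### Multiplication by phases, and translations -/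

theorem memLp_phase_mul (m : C(Sp d, ℝ)) (f : L2 d) :
    MemLp (fun x => Complex.exp (m x * Complex.I) * f x) 2 volume := by
  refine (Lp.memLp f).of_le ?_ (Eventually.of_forall fun x => by simp [Complex.norm_exp_ofReal_mul_I])
  exact (Continuous.aestronglyMeasurable (by fun_prop)).mul (Lp.memLp f).1

theorem norm_eq_of_ae_norm_eq {f g : L2 d} (h : ∀ᵐ x, ‖f x‖ = ‖g x‖) : ‖f‖ = ‖g‖ := by
  rw [Lp.norm_def, Lp.norm_def, eLpNorm_congr_norm_ae h]

/-- Multiplication by the unimodular function `exp (i m)`, where `m` is a real phase. -/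
def phaseMul (m : C(Sp d, ℝ)) : L2 d →ₗᵢ[ℂ] L2 d where
  toFun f := (memLp_phase_mul m f).toLp
  map_add' f g := by
    refine Lp.ext ?_
    filter_upwards [(memLp_phase_mul m (f + g)).coeFn_toLp, (memLp_phase_mul m f).coeFn_toLp,
      (memLp_phase_mul m g).coeFn_toLp, Lp.coeFn_add f g, Lp.coeFn_add
      (memLp_phase_mul m f).toLp (memLp_phase_mul m g).toLp] with x h1 h2 h3 h4 h5
    rw [h1, h5, Pi.add_apply, h2, h3, h4, Pi.add_apply, mul_add]
  map_smul' c f := by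
    refine Lp.ext ?_
    filter_upwards [(memLp_phase_mul m (c • f)).coeFn_toLp, (memLp_phase_mul m f).coeFn_toLp,
      Lp.coeFn_smul c f, Lp.coeFn_smul c (memLp_phase_mul m f).toLp] with x h1 h2 h4 h5
    simp only [RingHom.id_apply]
    rw [h1, h5, Pi.smul_apply, h2, h4, Pi.smul_apply, smul_eq_mul, smul_eq_mul]
    ring
  norm_map' f := by
    refine norm_eq_of_ae_norm_eq ?_
    filter_upwards [(memLp_phase_mul m f).coeFn_toLp] with x h1
    simp only [LinearMap.coe_mk, AddHom.coe_mk]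
    rw [h1, norm_mul, Complex.norm_exp_ofReal_mul_I, one_mul]

theorem coeFn_phaseMul (m : C(Sp d, ℝ)) (f : L2 d) :
    phaseMul m f =ᵐ[volume] fun x => Complex.exp (m x * Complex.I) * f x :=
  (memLp_phase_mul m f).coeFn_toLp

theorem phaseMul_phaseMul (m n : C(Sp d, ℝ)) (f : L2 d) :
    phaseMul m (phaseMul n f) = phaseMul (m + n) f := by
  refine Lp.ext ?_
  filter_upwards [coeFn_phaseMul m (phaseMul n f), coeFn_phaseMul n f, coeFn_phaseMul (m + n) f]
    with x h1 h2 h3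
  rw [h1, h2, h3]
  simp [← mul_assoc, ← Complex.exp_add, add_mul]

theorem phaseMul_zero (f : L2 d) : phaseMul 0 f = f := by
  refine Lp.ext ?_
  filter_upwards [coeFn_phaseMul 0 f] with x h1
  rw [h1]
  simp

/-- Translation by `h`, `f ↦ f (· - h)`. -/
def trans (h : Sp d) : L2 d →ₗᵢ[ℂ] L2 d :=
  Lp.compMeasurePreservingₗᵢ ℂ (fun x => x - h) (measurePreserving_sub_right volume h)

theorem coeFn_trans (h : Sp d) (f : L2 d) : trans h f =ᵐ[volume] fun x => f (x - h) :=
  Lp.coeFn_compMeasurePreserving f (measurePreserving_sub_right volume h)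

theorem ae_comp_sub {P : Sp d → Prop} (h : Sp d) (hP : ∀ᵐ x, P x) : ∀ᵐ x, P (x - h) :=
  (measurePreserving_sub_right volume h).quasiMeasurePreserving.ae hP

/-- The phase `x ↦ ⟨h, x⟩` of a plane wave. -/
def planeWave (h : Sp d) : C(Sp d, ℝ) where
  toFun x := inner ℝ h x

theorem L2_ext_of_schwartz {A B : L2 d → L2 d} (hA : Continuous A) (hB : Continuous B)
    (h : ∀ φ : 𝓢(Sp d, ℂ), A (φ.toLp 2) = B (φ.toLp 2)) : A = B := by
  refine DenseRange.equalizer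
    (SchwartzMap.denseRange_toLpCLM (F := ℂ) (E := Sp d) (p := 2) (μ := volume)
      ENNReal.ofNat_ne_top) hA hB ?_
  ext1 φ
  exact h φ

/-- Both sides are continuous in `f`, so it suffices to compare the Fourier integrals of Schwartz
functions. The factor (2π)⁻¹ comes from the normalisation exp(-2πi⟨x, ξ⟩). -/
theorem fourier_phaseMul_planeWave (h : Sp d) (f : L2 d) :
    𝓕 (phaseMul (planeWave h) f) = trans ((2 * Real.pi)⁻¹ • h) (𝓕 f : L2 d) := by
  revert f
  refine congrFun (L2_ext_of_schwartz ?_ ?_ fun φ => ?_)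
  · exact (Lp.fourierTransformₗᵢ (Sp d) ℂ).continuous.comp (phaseMul _).continuous
  · exact (trans _).continuous.comp (Lp.fourierTransformₗᵢ (Sp d) ℂ).continuous
  have hae : (fun x => Complex.exp (planeWave h x * Complex.I) * (φ.toLp 2 : L2 d) x) =ᵐ[volume]
      fun x => Complex.exp (planeWave h x * Complex.I) * φ x := by
    filter_upwards [φ.coeFn_toLp 2] with x hx
    rw [hx]
  have h2 : MemLp (fun x => Complex.exp (planeWave h x * Complex.I) * φ x) 2 volume :=
    (memLp_congr_ae hae).1 (memLp_phase_mul _ _)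
  have h1 : Integrable (fun x => Complex.exp (planeWave h x * Complex.I) * φ x) volume :=
    φ.integrable.bdd_mul (c := 1) (Continuous.aestronglyMeasurable (by fun_prop))
      (Eventually.of_forall fun x => by simp [Complex.norm_exp_ofReal_mul_I])
  have e0 : phaseMul (planeWave h) (φ.toLp 2) = h2.toLp := MemLp.toLp_congr (memLp_phase_mul _ _) h2 hae
  rw [e0]
  refine Lp.ext ?_
  filter_upwards [fourier_toLp_of_integrable h1 h2, coeFn_trans ((2 * Real.pi)⁻¹ • h)
    (𝓕 (φ.toLp 2 : L2 d) : L2 d), ae_comp_sub ((2 * Real.pi)⁻¹ • h)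
    ((𝓕 φ).coeFn_toLp 2 (μ := volume))] with ξ a1 a2 a3
  rw [a1, a2, SchwartzMap.toLp_fourier_eq, a3, SchwartzMap.fourier_coe, Real.fourier_eq',
    Real.fourier_eq']
  congr 1
  ext x
  simp only [planeWave, ContinuousMap.coe_mk, smul_eq_mul, ← mul_assoc,
    ← Complex.exp_add]
  congr 2
  rw [inner_sub_right, inner_smul_right, real_inner_comm x h]
  push_cast
  have : (Real.pi : ℂ) ≠ 0 := by exact_mod_cast Real.pi_ne_zero
  field_simp
  ring

theorem fourier_trans (h : Sp d) (f : L2 d) :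
    𝓕 (trans h f) = phaseMul (planeWave (-(2 * Real.pi) • h)) (𝓕 f : L2 d) := by
  revert f
  refine congrFun (L2_ext_of_schwartz ?_ ?_ fun φ => ?_)
  · exact (Lp.fourierTransformₗᵢ (Sp d) ℂ).continuous.comp (trans _).continuous
  · exact (phaseMul _).continuous.comp (Lp.fourierTransformₗᵢ (Sp d) ℂ).continuous
  have hmp := measurePreserving_sub_right (volume : Measure (Sp d)) h
  have h2 : MemLp (fun x => φ (x - h)) 2 volume :=
    (φ.memLp 2).comp_measurePreserving hmp
  have h1 : Integrable (fun x => φ (x - h)) volume := φ.integrable.comp_sub_right h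
  have e0 : trans h (φ.toLp 2) = h2.toLp := rfl
  rw [e0]
  refine Lp.ext ?_
  filter_upwards [fourier_toLp_of_integrable h1 h2, coeFn_phaseMul (planeWave (-(2 * Real.pi) • h))
    (𝓕 (φ.toLp 2 : L2 d) : L2 d), (𝓕 φ).coeFn_toLp 2 (μ := volume)] with ξ a1 a2 a3
  rw [a1, a2, SchwartzMap.toLp_fourier_eq, a3, SchwartzMap.fourier_coe, Real.fourier_eq',
    Real.fourier_eq', ← integral_const_mul]
  rw [← integral_sub_right_eq_self _ (-h)]
  congr 1
  ext x
  simp only [planeWave, ContinuousMap.coe_mk, smul_eq_mul, ← mul_assoc,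
    ← Complex.exp_add, sub_neg_eq_add, add_sub_cancel_right]
  congr 2
  rw [inner_add_left, inner_smul_left]
  simp
  ring

/-! ### Convergence in `L²` -/

theorem norm_sq_eq_integral (f : L2 d) : ‖f‖ ^ 2 = ∫ x, ‖f x‖ ^ 2 := by
  have h : inner ℂ f f = ((‖f‖ ^ 2 : ℝ) : ℂ) := by
    rw [inner_self_eq_norm_sq_to_K]
    simp
  rw [L2.inner_def] at h
  have h2 : ∫ a, inner ℂ (f a) (f a) = ((∫ x, ‖f x‖ ^ 2 : ℝ) : ℂ) := by
    rw [← integral_complex_ofReal]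
    congr 1
    ext x
    rw [inner_self_eq_norm_sq_to_K]
    simp
  rw [h2] at h
  exact_mod_cast h.symm

theorem integrable_norm_sq (f : L2 d) : Integrable (fun x => ‖f x‖ ^ 2) :=
  (memLp_two_iff_integrable_sq_norm (Lp.memLp f).1).1 (Lp.memLp f)

theorem tendsto_L2_of_dominated {ι : Type*} {l : Filter ι} [l.IsCountablyGenerated]
    {F : ι → L2 d} {f : L2 d} {F' : ι → Sp d → ℂ} {f' : Sp d → ℂ}
    (hF : ∀ n, F n =ᵐ[volume] F' n) (hf : f =ᵐ[volume] f')
    {G : Sp d → ℝ} (hG : MemLp G 2 volume)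
    (hb : ∀ᶠ n in l, ∀ᵐ x, ‖F' n x - f' x‖ ≤ G x)
    (hlim : ∀ᵐ x, Tendsto (fun n => F' n x) l (𝓝 (f' x))) : Tendsto F l (𝓝 f) := by
  rw [tendsto_iff_norm_sub_tendsto_zero]
  have h2 : Tendsto (fun n => ‖F n - f‖ ^ 2) l (𝓝 0) := by
    have e : ∀ n, ‖F n - f‖ ^ 2 = ∫ x, ‖F' n x - f' x‖ ^ 2 := fun n => by
      rw [norm_sq_eq_integral]
      refine integral_congr_ae ?_
      filter_upwards [Lp.coeFn_sub (F n) f, hF n, hf] with x h1 h2 h3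
      rw [h1, Pi.sub_apply, h2, h3]
    simp_rw [e]
    rw [show (0 : ℝ) = ∫ _x : Sp d, (0 : ℝ) by simp]
    refine tendsto_integral_filter_of_dominated_convergence (fun x => G x ^ 2) ?_ ?_
      hG.integrable_sq ?_
    · refine Eventually.of_forall fun n => ?_
      exact (((Lp.memLp (F n)).1.congr (hF n)).sub ((Lp.memLp f).1.congr hf)).norm.pow 2
    · filter_upwards [hb] with n hn
      filter_upwards [hn] with x hx
      rw [Real.norm_of_nonneg (by positivity)]
      gcongr
    · filter_upwards [hlim] with x hx
      have := (tendsto_iff_norm_sub_tendsto_zero.1 hx).pow 2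
      simpa using this
  have := h2.sqrt
  simpa using this

/-! ### The free propagator -/

/-- The phase of the symbol of the free propagator. -/
def schrodingerPhase (σ : ℝ) : C(Sp d, ℝ) where
  toFun ξ := -(σ * (2 * Real.pi * ‖ξ‖) ^ 2)

theorem schrodingerSymbol_eq (σ : ℝ) (ξ : Sp d) :
    schrodingerSymbol σ ξ = Complex.exp (schrodingerPhase σ ξ * Complex.I) := by
  rw [schrodingerSymbol, schrodingerPhase]
  congr 1
  simp [-Complex.ofReal_mul, -Complex.ofReal_pow, mul_comm]

/-- The free propagator as a linear isometry. -/
def freePropIsom (σ : ℝ) : L2 d →ₗᵢ[ℂ] L2 d :=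
  (Lp.fourierTransformₗᵢ (Sp d) ℂ).symm.toLinearIsometry.comp
    ((phaseMul (schrodingerPhase σ)).comp (Lp.fourierTransformₗᵢ (Sp d) ℂ).toLinearIsometry)

theorem freeProp_eq_fourierInv (σ : ℝ) (f : L2 d) :
    freeProp σ f = 𝓕⁻ (phaseMul (schrodingerPhase σ) (𝓕 f : L2 d)) := by
  rw [freeProp, fourierMultiplier, dif_pos (memLp_schrodingerSymbol_mul σ f)]
  congr 1
  refine MemLp.toLp_congr _ (memLp_phase_mul _ _) (Eventually.of_forall fun ξ => ?_)
  simp only [schrodingerSymbol_eq]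

theorem freePropIsom_apply (σ : ℝ) (f : L2 d) : freePropIsom σ f = freeProp σ f := by
  rw [freeProp_eq_fourierInv]
  rfl

theorem fourier_freeProp (σ : ℝ) (f : L2 d) :
    (𝓕 (freeProp σ f) : L2 d) = phaseMul (schrodingerPhase σ) (𝓕 f : L2 d) := by
  rw [freeProp_eq_fourierInv, FourierTransform.fourier_fourierInv_eq]

theorem L2_ext_fourier {f g : L2 d} (h : (𝓕 f : L2 d) = 𝓕 g) : f = g :=
  (Lp.fourierTransformₗᵢ (Sp d) ℂ).injective h

theorem freeProp_freeProp (σ τ : ℝ) (f : L2 d) :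
    freeProp σ (freeProp τ f) = freeProp (σ + τ) f := by
  refine L2_ext_fourier ?_
  rw [fourier_freeProp, fourier_freeProp, fourier_freeProp, phaseMul_phaseMul]
  congr 2
  ext ξ
  simp [schrodingerPhase]
  ring

theorem freeProp_zero (f : L2 d) : freeProp 0 f = f := by
  refine L2_ext_fourier ?_
  rw [fourier_freeProp]
  convert phaseMul_zero (𝓕 f : L2 d)
  ext ξ
  simp [schrodingerPhase]

theorem freeProp_add (σ : ℝ) (f g : L2 d) : freeProp σ (f + g) = freeProp σ f + freeProp σ g := by
  simp only [← freePropIsom_apply, map_add]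

theorem freeProp_sub (σ : ℝ) (f g : L2 d) : freeProp σ (f - g) = freeProp σ f - freeProp σ g := by
  simp only [← freePropIsom_apply, map_sub]

theorem freeProp_smul (σ : ℝ) (c : ℂ) (f : L2 d) : freeProp σ (c • f) = c • freeProp σ f := by
  simp only [← freePropIsom_apply, map_smul]

theorem norm_freeProp (σ : ℝ) (f : L2 d) : ‖freeProp σ f‖ = ‖f‖ := by
  simp only [← freePropIsom_apply, LinearIsometry.norm_map]

theorem inner_freeProp (σ : ℝ) (f g : L2 d) : inner ℂ (freeProp σ f) (freeProp σ g) = inner ℂ f g := by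
  simp only [← freePropIsom_apply, LinearIsometry.inner_map_map]

theorem inner_freeProp_neg_left (σ : ℝ) (f g : L2 d) :
    inner ℂ (freeProp (-σ) f) g = inner ℂ f (freeProp σ g) := by
  rw [← inner_freeProp σ, freeProp_freeProp, add_neg_cancel, freeProp_zero]

theorem continuous_freeProp_left (f : L2 d) : Continuous fun σ => freeProp σ f := by
  have h : Continuous fun σ : ℝ => phaseMul (schrodingerPhase σ) (𝓕 f : L2 d) := by
    rw [continuous_iff_continuousAt]
    intro σ₀
    refine tendsto_L2_of_dominated (fun σ => coeFn_phaseMul _ _) (coeFn_phaseMul _ _)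
      (G := fun ξ => 2 * ‖(𝓕 f : L2 d) ξ‖) ((Lp.memLp _).norm.const_mul 2)
      (Eventually.of_forall fun σ => Eventually.of_forall fun ξ => ?_)
      (Eventually.of_forall fun ξ => ?_)
    · refine (norm_sub_le _ _).trans ?_
      simp only [norm_mul, Complex.norm_exp_ofReal_mul_I, one_mul, two_mul, le_refl]
    · refine Continuous.tendsto (?_ : Continuous fun σ : ℝ =>
        Complex.exp (schrodingerPhase σ ξ * Complex.I) * (𝓕 f : L2 d) ξ) σ₀
      simp only [schrodingerPhase, ContinuousMap.coe_mk]
      fun_prop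
  simp_rw [freeProp_eq_fourierInv]
  exact (Lp.fourierTransformₗᵢ (Sp d) ℂ).symm.continuous.comp h

theorem continuous_freeProp : Continuous fun q : ℝ × L2 d => freeProp q.1 q.2 := by
  rw [continuous_iff_continuousAt]
  rintro ⟨σ₀, f₀⟩
  rw [ContinuousAt, tendsto_iff_norm_sub_tendsto_zero]
  have h1 : Tendsto (fun q : ℝ × L2 d => ‖q.2 - f₀‖ + ‖freeProp q.1 f₀ - freeProp σ₀ f₀‖)
      (𝓝 (σ₀, f₀)) (𝓝 0) := by
    have c : Continuous fun q : ℝ × L2 d => ‖q.2 - f₀‖ + ‖freeProp q.1 f₀ - freeProp σ₀ f₀‖ := by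
      have := (continuous_freeProp_left f₀).comp (continuous_fst (X := ℝ) (Y := L2 d))
      exact (continuous_snd.sub continuous_const).norm.add (this.sub continuous_const).norm
    simpa using c.tendsto (σ₀, f₀)
  refine squeeze_zero (fun _ => norm_nonneg _) (fun q => ?_) h1
  have : freeProp q.1 q.2 - freeProp σ₀ f₀ =
      freeProp q.1 (q.2 - f₀) + (freeProp q.1 f₀ - freeProp σ₀ f₀) := by
    rw [freeProp_sub]; abel
  rw [this]
  refine (norm_add_le _ _).trans ?_
  rw [norm_freeProp]

/-- Galilean covariance of the free propagator. -/
theorem freeProp_phaseMul_planeWave (σ : ℝ) (h : Sp d) (f : L2 d) :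
    freeProp σ (phaseMul (planeWave h) f) =
      Complex.exp ((-(σ * ‖h‖ ^ 2) : ℝ) * Complex.I) •
        phaseMul (planeWave h) (trans ((2 * σ) • h) (freeProp σ f)) := by
  refine L2_ext_fourier ?_
  rw [fourier_freeProp, fourier_phaseMul_planeWave, FourierTransform.fourier_smul,
    fourier_phaseMul_planeWave, fourier_trans, fourier_freeProp, phaseMul_phaseMul]
  set g : L2 d := 𝓕 f
  refine Lp.ext ?_
  filter_upwards [coeFn_phaseMul (schrodingerPhase σ) (trans ((2 * Real.pi)⁻¹ • h) g),
    coeFn_trans ((2 * Real.pi)⁻¹ • h) g,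
    Lp.coeFn_smul (Complex.exp ((-(σ * ‖h‖ ^ 2) : ℝ) * Complex.I)) (trans ((2 * Real.pi)⁻¹ • h)
      (phaseMul (planeWave (-(2 * Real.pi) • (2 * σ) • h) + schrodingerPhase σ) g)),
    coeFn_trans ((2 * Real.pi)⁻¹ • h)
      (phaseMul (planeWave (-(2 * Real.pi) • (2 * σ) • h) + schrodingerPhase σ) g),
    ae_comp_sub ((2 * Real.pi)⁻¹ • h)
      (coeFn_phaseMul (planeWave (-(2 * Real.pi) • (2 * σ) • h) + schrodingerPhase σ) g)]
    with ξ a1 a2 a3 a4 a5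
  rw [a1, a2, a3, Pi.smul_apply, a4, a5, smul_eq_mul, ← mul_assoc, ← Complex.exp_add, ← add_mul,
    ← Complex.ofReal_add]
  congr 4
  have hpi := Real.pi_ne_zero
  simp only [schrodingerPhase, planeWave, ContinuousMap.coe_mk, ContinuousMap.add_apply,
    inner_sub_right, inner_smul_left, inner_smul_right, mul_pow, norm_sub_sq_real, norm_smul,
    real_inner_self_eq_norm_sq, real_inner_comm h ξ, map_neg, map_mul, map_ofNat, conj_trivial,
    Real.norm_eq_abs, sq_abs]
  field_simp
  ring

/-! ### The Sobolev embedding `Hˢ ⊂ L^∞` for the propagated functions -/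

/-- `f` and its free evolution are bounded by `M` at the times in `I`. -/
def UnifBdd (I : Set ℝ) (M : ℝ) (f : L2 d) : Prop :=
  ∀ σ ∈ I, ∀ᵐ x, ‖freeProp σ f x‖ ≤ M

theorem UnifBdd.mono {I J : Set ℝ} {M N : ℝ} {f : L2 d} (h : UnifBdd I M f) (hJ : J ⊆ I)
    (hM : M ≤ N) : UnifBdd J N f := fun σ hσ => by
  filter_upwards [h σ (hJ hσ)] with x hx using hx.trans hM

/-- The weight of the Sobolev norm. -/
def sobolevWeight (s : ℝ) (ξ : Sp d) : ℝ := (1 + (2 * Real.pi * ‖ξ‖) ^ 2) ^ (s / 2)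

theorem sobolevWeight_pos (s : ℝ) (ξ : Sp d) : 0 < sobolevWeight s ξ := by
  unfold sobolevWeight; positivity

theorem continuous_sobolevWeight (s : ℝ) : Continuous (sobolevWeight s : Sp d → ℝ) := by
  unfold sobolevWeight
  refine Continuous.rpow_const (by fun_prop) fun ξ => Or.inl ?_
  positivity

theorem memLp_inv_sobolevWeight {s : ℝ} (hs : (d : ℝ) / 2 < s) :
    MemLp (fun ξ : Sp d => (sobolevWeight s ξ)⁻¹) 2 volume := by
  have hc : Continuous fun ξ : Sp d => (sobolevWeight s ξ)⁻¹ :=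
    (continuous_sobolevWeight s).inv₀ fun ξ => (sobolevWeight_pos s ξ).ne'
  rw [memLp_two_iff_integrable_sq hc.aestronglyMeasurable]
  have h0 : Integrable fun ξ : Sp d => (1 + ‖ξ‖ ^ 2) ^ (-(2 * s) / 2) :=
    integrable_rpow_neg_one_add_norm_sq (by simp; linarith)
  refine h0.mono' (hc.pow 2).aestronglyMeasurable (Eventually.of_forall fun ξ => ?_)
  have hs0 : 0 ≤ s := le_trans (by positivity) hs.le
  rw [Real.norm_of_nonneg (by positivity), sobolevWeight, ← Real.rpow_neg (by positivity),
    ← Real.rpow_natCast, ← Real.rpow_mul (by positivity)]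
  rw [show -(s / 2) * ((2 : ℕ) : ℝ) = -(2 * s) / 2 by push_cast; ring]
  refine Real.rpow_le_rpow_of_nonpos (by positivity) ?_ (by linarith)
  have hpi : 1 ≤ 2 * Real.pi := by linarith [Real.pi_gt_three]
  have : ‖ξ‖ ≤ 2 * Real.pi * ‖ξ‖ := le_mul_of_one_le_left (norm_nonneg _) hpi
  gcongr

/-- For s > d/2 the inverse weight is in L², so Cauchy–Schwarz puts the Fourier transform in L¹. The
symbol of the propagator is unimodular, hence the resulting sup bound does not depend on σ. -/
theorem exists_unifBdd_of_sobolevNorm_le {s : ℝ} (hs : (d : ℝ) / 2 < s) {R : ℝ≥0∞} (hR : R ≠ ∞) :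
    ∃ M : ℝ, 0 ≤ M ∧ ∀ f : L2 d, sobolevNorm s f ≤ R → UnifBdd univ M f := by
  set A := eLpNorm (fun ξ : Sp d => (sobolevWeight s ξ)⁻¹) 2 volume
  have hA : A ≠ ∞ := (memLp_inv_sobolevWeight hs).2.ne
  refine ⟨(A * R).toReal, ENNReal.toReal_nonneg, fun f hf σ _ => ?_⟩
  set g : L2 d := 𝓕 f
  have hgm : AEStronglyMeasurable g volume := (Lp.memLp g).1
  have hw : AEStronglyMeasurable (fun ξ : Sp d => ((sobolevWeight s ξ : ℝ) : ℂ) * g ξ) volume :=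
    (Complex.continuous_ofReal.comp (continuous_sobolevWeight s)).aestronglyMeasurable.mul hgm
  have hL1 : eLpNorm g 1 volume ≤ A * R := by
    have e : (g : Sp d → ℂ) = fun ξ => (sobolevWeight s ξ)⁻¹ •
        (((sobolevWeight s ξ : ℝ) : ℂ) * g ξ) := by
      ext ξ
      have := (sobolevWeight_pos s ξ).ne'
      rw [Complex.real_smul, ← mul_assoc, ← Complex.ofReal_mul, inv_mul_cancel₀ this]
      simp
    rw [e]
    refine (eLpNorm_smul_le_mul_eLpNorm (p := 2) (q := 2) (r := 1) hw
      (memLp_inv_sobolevWeight hs).1).trans ?_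
    gcongr
    exact hf
  set m := schrodingerPhase (d := d) σ
  have h2 := memLp_phase_mul m g
  have hn : eLpNorm (fun ξ => Complex.exp (m ξ * Complex.I) * g ξ) 1 volume = eLpNorm g 1 volume :=
    eLpNorm_congr_norm_ae (Eventually.of_forall fun ξ => by
      rw [norm_mul, Complex.norm_exp_ofReal_mul_I, one_mul])
  have hAR : A * R ≠ ∞ := ENNReal.mul_ne_top hA hR
  have h1 : Integrable (fun ξ => Complex.exp (m ξ * Complex.I) * g ξ) volume :=
    memLp_one_iff_integrable.1 ⟨h2.1, by rw [hn]; exact lt_of_le_of_lt hL1 hAR.lt_top⟩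
  have e := fourierInv_toLp_of_integrable h1 h2
  rw [freeProp_eq_fourierInv]
  filter_upwards [e] with x hx
  have hx' : (𝓕⁻ (phaseMul m g) : L2 d) x =
    𝓕⁻ (fun ξ => Complex.exp (m ξ * Complex.I) * g ξ) x := hx
  rw [hx', Real.fourierInv_eq]
  refine (norm_integral_le_integral_norm _).trans ?_
  simp_rw [Circle.norm_smul]
  rw [integral_norm_eq_lintegral_enorm h2.1, ← eLpNorm_one_eq_lintegral_enorm, hn]
  exact ENNReal.toReal_mono hAR hL1

/-! ### Pointwise estimates for the power nonlinearity -/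

theorem norm_pow_mul_sub_le (p : ℕ) {M : ℝ} {a b : ℂ} (ha : ‖a‖ ≤ M) (hb : ‖b‖ ≤ M) :
    ‖((‖a‖ ^ p : ℝ) : ℂ) * a - ((‖b‖ ^ p : ℝ) : ℂ) * b‖ ≤ (p + 1) * M ^ p * ‖a - b‖ := by
  have hM : 0 ≤ M := (norm_nonneg a).trans ha
  induction p with
  | zero => simp
  | succ p ih =>
    have e : ((‖a‖ ^ (p + 1) : ℝ) : ℂ) * a - ((‖b‖ ^ (p + 1) : ℝ) : ℂ) * b =
        (‖a‖ : ℂ) * (((‖a‖ ^ p : ℝ) : ℂ) * a - ((‖b‖ ^ p : ℝ) : ℂ) * b) +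
          ((‖a‖ - ‖b‖ : ℝ) : ℂ) * (((‖b‖ ^ p : ℝ) : ℂ) * b) := by
      push_cast; ring
    rw [e]
    have h1 : ‖(‖a‖ : ℂ) * (((‖a‖ ^ p : ℝ) : ℂ) * a - ((‖b‖ ^ p : ℝ) : ℂ) * b)‖ ≤
        M * ((p + 1) * M ^ p * ‖a - b‖) := by
      rw [norm_mul, Complex.norm_real, norm_norm]
      gcongr
    have h2 : ‖((‖a‖ - ‖b‖ : ℝ) : ℂ) * (((‖b‖ ^ p : ℝ) : ℂ) * b)‖ ≤ ‖a - b‖ * (M ^ p * M) := by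
      rw [norm_mul, norm_mul, Complex.norm_real, Complex.norm_real, Real.norm_eq_abs,
        Real.norm_of_nonneg (by positivity)]
      gcongr
      exact abs_norm_sub_norm_le a b
    refine (norm_add_le _ _).trans ((add_le_add h1 h2).trans (le_of_eq ?_))
    push_cast
    ring

theorem exists_pow_taylor_bound (n : ℕ) (R : ℝ) : ∃ C : ℝ, 0 ≤ C ∧ ∀ r s : ℝ, |r| ≤ R → |s| ≤ R →
    |r ^ (n + 1) - s ^ (n + 1) - (n + 1) * s ^ n * (r - s)| ≤ C * (r - s) ^ 2 := by
  induction n with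
  | zero => exact ⟨0, le_rfl, fun r s _ _ => by simp⟩
  | succ n ih =>
    obtain ⟨C, hC, h⟩ := ih
    refine ⟨|R| * C + (n + 1) * |R| ^ n, by positivity, fun r s hr hs => ?_⟩
    have e : r ^ (n + 1 + 1) - s ^ (n + 1 + 1) - ((n + 1 : ℕ) + 1) * s ^ (n + 1) * (r - s) =
        r * (r ^ (n + 1) - s ^ (n + 1) - (n + 1) * s ^ n * (r - s)) +
          (n + 1) * s ^ n * (r - s) ^ 2 := by
      push_cast; ring
    rw [e]
    refine (abs_add_le _ _).trans ?_
    rw [abs_mul, abs_mul, abs_mul, abs_pow, abs_of_nonneg (by positivity : (0 : ℝ) ≤ n + 1),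
      abs_of_nonneg (sq_nonneg (r - s)), add_mul (|R| * C), mul_assoc |R|]
    have hr' := hr.trans (le_abs_self R)
    have hs' := hs.trans (le_abs_self R)
    gcongr
    exact h r s hr hs

/-- The exponent is even, so |a|^{2k+2} is a polynomial in |a|². The one-variable expansion is
applied to |a|² and |b|², and |a|² - |b|² = 2 Re⟨b, a-b⟩ + |a-b|². -/
theorem exists_norm_pow_taylor_bound (k : ℕ) (M : ℝ) : ∃ C : ℝ, 0 ≤ C ∧ ∀ a b : ℂ,
    ‖a‖ ≤ M → ‖b‖ ≤ M →
    |‖a‖ ^ (2 * k + 2) - ‖b‖ ^ (2 * k + 2) -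
      (2 * k + 2) * (inner ℂ (((‖b‖ ^ (2 * k) : ℝ) : ℂ) * b) (a - b)).re| ≤ C * ‖a - b‖ ^ 2 := by
  obtain ⟨C, hC, h⟩ := exists_pow_taylor_bound k (M ^ 2)
  refine ⟨C * (2 * M) ^ 2 + (k + 1) * (M ^ 2) ^ k, by positivity, fun a b ha hb => ?_⟩
  have hM : 0 ≤ M := (norm_nonneg a).trans ha
  have key := h (‖a‖ ^ 2) (‖b‖ ^ 2) (by rw [abs_of_nonneg (by positivity)]; gcongr)
    (by rw [abs_of_nonneg (by positivity)]; gcongr)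
  have e1 : ‖a‖ ^ 2 - ‖b‖ ^ 2 = 2 * (inner ℂ b (a - b)).re + ‖a - b‖ ^ 2 := by
    rw [← Complex.normSq_eq_norm_sq, ← Complex.normSq_eq_norm_sq, ← Complex.normSq_eq_norm_sq]
    simp [Complex.normSq_apply, Complex.mul_re]
    ring
  have e2 : (inner ℂ (((‖b‖ ^ (2 * k) : ℝ) : ℂ) * b) (a - b)).re =
      (‖b‖ ^ 2) ^ k * (inner ℂ b (a - b)).re := by
    rw [← pow_mul, ← smul_eq_mul, inner_smul_left, Complex.conj_ofReal, Complex.re_ofReal_mul]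
  have e3 : ‖a‖ ^ (2 * k + 2) - ‖b‖ ^ (2 * k + 2) -
      (2 * k + 2) * (inner ℂ (((‖b‖ ^ (2 * k) : ℝ) : ℂ) * b) (a - b)).re =
      ((‖a‖ ^ 2) ^ (k + 1) - (‖b‖ ^ 2) ^ (k + 1) - (k + 1) * (‖b‖ ^ 2) ^ k * (‖a‖ ^ 2 - ‖b‖ ^ 2)) +
        (k + 1) * (‖b‖ ^ 2) ^ k * ‖a - b‖ ^ 2 := by
    rw [e2, e1, ← pow_mul, ← pow_mul, ← pow_mul]
    ring_nf
  rw [e3, add_mul (C * (2 * M) ^ 2)]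
  refine (abs_add_le _ _).trans (add_le_add (key.trans ?_) ?_)
  · rw [mul_assoc, ← mul_pow]
    gcongr 1
    rw [sq_le_sq, abs_of_nonneg (by positivity : 0 ≤ 2 * M * ‖a - b‖)]
    have : ‖a‖ ^ 2 - ‖b‖ ^ 2 = (‖a‖ + ‖b‖) * (‖a‖ - ‖b‖) := by ring
    rw [this, abs_mul, abs_of_nonneg (by positivity)]
    have := abs_norm_sub_norm_le a b
    gcongr
    linarith
  · rw [abs_of_nonneg (by positivity)]
    gcongr

/-! ### The power nonlinearity on bounded functions -/

theorem memLp_power {p : ℕ} {M : ℝ} {f : L2 d} (hf : ∀ᵐ x, ‖f x‖ ≤ M) :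
    MemLp (fun x => ((‖f x‖ ^ p : ℝ) : ℂ) * f x) 2 volume := by
  have hm := (Lp.memLp f).1
  refine (Lp.memLp f).of_le_mul (c := M ^ p)
    ((Complex.continuous_ofReal.comp_aestronglyMeasurable (hm.norm.pow p)).mul hm) ?_
  filter_upwards [hf] with x hx
  rw [norm_mul, Complex.norm_real, Real.norm_of_nonneg (by positivity)]
  gcongr

theorem coeFn_powerNL {p : ℕ} {M : ℝ} {f : L2 d} (hf : ∀ᵐ x, ‖f x‖ ≤ M) :
    powerNL p f =ᵐ[volume] fun x => ((‖f x‖ ^ p : ℝ) : ℂ) * f x := by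
  rw [powerNL, dif_pos (memLp_power hf)]
  exact MemLp.coeFn_toLp _

theorem norm_powerNL_sub_le {p : ℕ} {M : ℝ} {f g : L2 d} (hf : ∀ᵐ x, ‖f x‖ ≤ M)
    (hg : ∀ᵐ x, ‖g x‖ ≤ M) : ‖powerNL p f - powerNL p g‖ ≤ (p + 1) * M ^ p * ‖f - g‖ := by
  refine Lp.norm_le_mul_norm_of_ae_le_mul ?_
  filter_upwards [Lp.coeFn_sub (powerNL p f) (powerNL p g), coeFn_powerNL (p := p) hf,
    coeFn_powerNL (p := p) hg, Lp.coeFn_sub f g, hf, hg] with x h1 h2 h3 h4 h5 h6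
  rw [h1, Pi.sub_apply, h2, h3, h4]
  exact norm_pow_mul_sub_le p h5 h6

/-- The integral `∫ |f|^{p+2}`. -/
def lpMass (p : ℕ) (f : L2 d) : ℝ := ∫ x, ‖f x‖ ^ (p + 2)

theorem integrable_norm_pow {p : ℕ} {M : ℝ} {f : L2 d} (hf : ∀ᵐ x, ‖f x‖ ≤ M) :
    Integrable fun x => ‖f x‖ ^ (p + 2) := by
  refine ((integrable_norm_sq f).const_mul (M ^ p)).mono' ((Lp.memLp f).1.norm.pow _) ?_
  filter_upwards [hf] with x hx
  rw [Real.norm_of_nonneg (by positivity), pow_add]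
  gcongr

theorem lpMass_nonneg (p : ℕ) (f : L2 d) : 0 ≤ lpMass p f :=
  integral_nonneg fun _ => by positivity

/-- Plays the role of differentiability: on functions with a common sup bound the remainder is
quadratic in the L² norm, although the functional is not defined on all of L². Integrates the
pointwise expansion. -/
theorem exists_lpMass_taylor_bound (k : ℕ) (M : ℝ) : ∃ C : ℝ, 0 ≤ C ∧ ∀ f g : L2 d,
    (∀ᵐ x, ‖f x‖ ≤ M) → (∀ᵐ x, ‖g x‖ ≤ M) →
    |lpMass (2 * k) g - lpMass (2 * k) f -
      (2 * k + 2) * (inner ℂ (powerNL (2 * k) f) (g - f)).re| ≤ C * ‖g - f‖ ^ 2 := by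
  obtain ⟨C, hC, h⟩ := exists_norm_pow_taylor_bound k M
  refine ⟨C, hC, fun f g hf hg => ?_⟩
  have hre : (inner ℂ (powerNL (2 * k) f) (g - f)).re =
      ∫ x, (inner ℂ (powerNL (2 * k) f x) ((g - f : L2 d) x)).re := by
    rw [L2.inner_def]
    exact (integral_re (𝕜 := ℂ) (L2.integrable_inner _ _)).symm
  have hi : Integrable fun x => (inner ℂ (powerNL (2 * k) f x) ((g - f : L2 d) x)).re :=
    (L2.integrable_inner (𝕜 := ℂ) (powerNL (2 * k) f) (g - f)).re
  have hgf : Integrable fun x => ‖g x‖ ^ (2 * k + 2) - ‖f x‖ ^ (2 * k + 2) :=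
    (integrable_norm_pow hg).sub (integrable_norm_pow hf)
  rw [hre, norm_sq_eq_integral, lpMass, lpMass, ← integral_sub (integrable_norm_pow hg)
    (integrable_norm_pow hf), ← integral_const_mul, ← integral_const_mul,
    ← integral_sub hgf (hi.const_mul _)]
  refine abs_integral_le_integral_abs.trans (integral_mono_ae ?_ ?_ ?_)
  · exact (hgf.sub (hi.const_mul _)).abs
  · exact (integrable_norm_sq _).const_mul C
  · filter_upwards [hf, hg, coeFn_powerNL (p := 2 * k) hf, Lp.coeFn_sub g f] with x h1 h2 h3 h4
    rw [h3, h4]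
    exact h _ _ h2 h1

/-! ### The averaged nonlinearity over a window of propagation times -/

/-- The integrand of the averaged nonlinearity. -/
def nlIntegrand (p : ℕ) (f : L2 d) (σ : ℝ) : L2 d := freeProp (-σ) (powerNL p (freeProp σ f))

/-- The averaged nonlinearity over the window `[α, β]`. -/
def windowNL (p : ℕ) (α β : ℝ) (f : L2 d) : L2 d := ∫ σ in α..β, nlIntegrand p f σ

/-- The potential energy over the window `[α, β]`. -/
def windowPot (p : ℕ) (α β : ℝ) (f : L2 d) : ℝ := ∫ σ in α..β, lpMass p (freeProp σ f)

theorem nonlinearity_eq (p : ℕ) (f : L2 d) : nonlinearity p f = windowNL p 0 1 f := rfl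

theorem potential_eq (p : ℕ) (f : L2 d) : potential p f = windowPot p 0 1 f := rfl

theorem tendsto_norm_freeProp_sub (f : L2 d) (σ₀ : ℝ) :
    Tendsto (fun σ => ‖freeProp σ f - freeProp σ₀ f‖) (𝓝 σ₀) (𝓝 0) :=
  tendsto_iff_norm_sub_tendsto_zero.1 ((continuous_freeProp_left f).tendsto σ₀)

theorem UnifBdd.continuousOn_powerNL {I : Set ℝ} {M : ℝ} {f : L2 d}
    (hf : UnifBdd I M f) (p : ℕ) : ContinuousOn (fun σ => powerNL p (freeProp σ f)) I := by
  intro σ₀ h₀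
  rw [ContinuousWithinAt, tendsto_iff_norm_sub_tendsto_zero]
  have h1 : Tendsto (fun σ => (p + 1) * M ^ p * ‖freeProp σ f - freeProp σ₀ f‖) (𝓝[I] σ₀)
      (𝓝 0) := by
    have := (tendsto_norm_freeProp_sub f σ₀).const_mul ((p + 1) * M ^ p)
    rw [mul_zero] at this
    exact this.mono_left nhdsWithin_le_nhds
  refine squeeze_zero' (Eventually.of_forall fun _ => norm_nonneg _) ?_ h1
  filter_upwards [self_mem_nhdsWithin] with σ hσ
  exact norm_powerNL_sub_le (hf σ hσ) (hf σ₀ h₀)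

theorem UnifBdd.continuousOn_nlIntegrand {I : Set ℝ} {M : ℝ} {f : L2 d}
    (hf : UnifBdd I M f) (p : ℕ) : ContinuousOn (nlIntegrand p f) I := by
  have := (continuous_freeProp (d := d)).comp_continuousOn
    (continuousOn_id.neg.prodMk (hf.continuousOn_powerNL p))
  exact this

theorem UnifBdd.intervalIntegrable_nlIntegrand {α β M : ℝ} (hαβ : α ≤ β)
    {f : L2 d} (hf : UnifBdd (Icc α β) M f) (p : ℕ) :
    IntervalIntegrable (nlIntegrand p f) volume α β :=
  ContinuousOn.intervalIntegrable (by
    rw [uIcc_of_le hαβ]; exact hf.continuousOn_nlIntegrand p)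

theorem UnifBdd.continuousOn_lpMass {I : Set ℝ} {M : ℝ} {f : L2 d}
    (hf : UnifBdd I M f) (k : ℕ) : ContinuousOn (fun σ => lpMass (2 * k) (freeProp σ f)) I := by
  obtain ⟨C, hC, h⟩ := exists_lpMass_taylor_bound (d := d) k M
  intro σ₀ h₀
  rw [ContinuousWithinAt, tendsto_iff_norm_sub_tendsto_zero]
  set A := (2 * k + 2) * ‖powerNL (2 * k) (freeProp σ₀ f)‖
  have h1 : Tendsto (fun σ => C * ‖freeProp σ f - freeProp σ₀ f‖ ^ 2 +
      A * ‖freeProp σ f - freeProp σ₀ f‖) (𝓝[I] σ₀) (𝓝 0) := by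
    have c := tendsto_norm_freeProp_sub f σ₀
    have := ((c.pow 2).const_mul C).add (c.const_mul A)
    simp only [mul_zero, ne_eq, OfNat.ofNat_ne_zero, not_false_eq_true, zero_pow, add_zero] at this
    exact this.mono_left nhdsWithin_le_nhds
  refine squeeze_zero' (Eventually.of_forall fun _ => norm_nonneg _) ?_ h1
  filter_upwards [self_mem_nhdsWithin] with σ hσ
  have b := h (freeProp σ₀ f) (freeProp σ f) (hf _ h₀) (hf _ hσ)
  have b2 : |(2 * k + 2) * (inner ℂ (powerNL (2 * k) (freeProp σ₀ f))
      (freeProp σ f - freeProp σ₀ f)).re| ≤ A * ‖freeProp σ f - freeProp σ₀ f‖ := by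
    rw [abs_mul, abs_of_nonneg (by positivity : (0 : ℝ) ≤ 2 * k + 2), mul_assoc]
    gcongr
    exact (Complex.abs_re_le_norm _).trans (norm_inner_le_norm _ _)
  rw [Real.norm_eq_abs]
  calc _ = |(lpMass (2 * k) (freeProp σ f) - lpMass (2 * k) (freeProp σ₀ f) -
        (2 * k + 2) * (inner ℂ (powerNL (2 * k) (freeProp σ₀ f))
          (freeProp σ f - freeProp σ₀ f)).re) + (2 * k + 2) *
        (inner ℂ (powerNL (2 * k) (freeProp σ₀ f)) (freeProp σ f - freeProp σ₀ f)).re| := by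
        congr 1; ring
    _ ≤ _ := (abs_add_le _ _).trans (add_le_add b b2)

theorem norm_windowNL_sub_le {p : ℕ} {α β M : ℝ} (hαβ : α ≤ β) {f g : L2 d}
    (hf : UnifBdd (Icc α β) M f) (hg : UnifBdd (Icc α β) M g) :
    ‖windowNL p α β f - windowNL p α β g‖ ≤ (β - α) * ((p + 1) * M ^ p) * ‖f - g‖ := by
  rw [windowNL, windowNL, ← intervalIntegral.integral_sub
    (hf.intervalIntegrable_nlIntegrand hαβ p) (hg.intervalIntegrable_nlIntegrand hαβ p)]
  have := intervalIntegral.norm_integral_le_of_norm_le_const (a := α) (b := β)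
    (f := fun σ => nlIntegrand p f σ - nlIntegrand p g σ) (C := (p + 1) * M ^ p * ‖f - g‖)
    fun σ hσ => by
      rw [uIoc_of_le hαβ] at hσ
      have hσ' := Ioc_subset_Icc_self hσ
      rw [nlIntegrand, nlIntegrand, ← freeProp_sub, norm_freeProp]
      refine (norm_powerNL_sub_le (hf σ hσ') (hg σ hσ')).trans (le_of_eq ?_)
      rw [← freeProp_sub, norm_freeProp]
  refine this.trans (le_of_eq ?_)
  rw [abs_of_nonneg (by linarith)]
  ring

theorem inner_windowNL {p : ℕ} {α β M : ℝ} (hαβ : α ≤ β) {f : L2 d}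
    (hf : UnifBdd (Icc α β) M f) (g : L2 d) :
    inner ℂ (windowNL p α β f) g =
      ∫ σ in α..β, inner ℂ (powerNL p (freeProp σ f)) (freeProp σ g) := by
  have h := (innerSL ℂ g).intervalIntegral_comp_comm
    (hf.intervalIntegrable_nlIntegrand hαβ p)
  rw [← inner_conj_symm, ← innerSL_apply_apply ℂ g, windowNL, ← h,
    ← intervalIntegral.intervalIntegral_conj]
  refine intervalIntegral.integral_congr fun σ _ => ?_
  simp only [innerSL_apply_apply, inner_conj_symm]
  rw [nlIntegrand, inner_freeProp_neg_left]

/-- Averages the expansion over σ; since e^{iσΔ} is an isometry the remainder is the same for every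
σ. It is used along the solution, for energy conservation, and along the chirps, for the virial
identity. -/
theorem exists_windowPot_taylor_bound (k : ℕ) {α β M : ℝ} (hαβ : α ≤ β) :
    ∃ C : ℝ, 0 ≤ C ∧ ∀ f g : L2 d, UnifBdd (Icc α β) M f → UnifBdd (Icc α β) M g →
    |windowPot (2 * k) α β g - windowPot (2 * k) α β f -
      (2 * k + 2) * (inner ℂ (windowNL (2 * k) α β f) (g - f)).re| ≤ C * ‖g - f‖ ^ 2 := by
  obtain ⟨C, hC, h⟩ := exists_lpMass_taylor_bound (d := d) k M
  refine ⟨C * (β - α), mul_nonneg hC (by linarith), fun f g hf hg => ?_⟩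
  have iF : ∀ {f : L2 d}, UnifBdd (Icc α β) M f →
      IntervalIntegrable (fun σ => lpMass (2 * k) (freeProp σ f)) volume α β := fun hf =>
    ContinuousOn.intervalIntegrable (by rw [uIcc_of_le hαβ]; exact hf.continuousOn_lpMass k)
  have cI : ContinuousOn (fun σ => inner ℂ (powerNL (2 * k) (freeProp σ f))
      (freeProp σ (g - f))) (uIcc α β) := by
    rw [uIcc_of_le hαβ]
    exact (hf.continuousOn_powerNL _).inner (𝕜 := ℂ)
      (continuous_freeProp_left (g - f)).continuousOn
  have hre : (inner ℂ (windowNL (2 * k) α β f) (g - f)).re =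
      ∫ σ in α..β, (inner ℂ (powerNL (2 * k) (freeProp σ f)) (freeProp σ (g - f))).re := by
    rw [inner_windowNL hαβ hf]
    exact (Complex.reCLM.intervalIntegral_comp_comm cI.intervalIntegrable).symm
  have iR : IntervalIntegrable (fun σ =>
      (inner ℂ (powerNL (2 * k) (freeProp σ f)) (freeProp σ (g - f))).re) volume α β :=
    (Complex.continuous_re.comp_continuousOn cI).intervalIntegrable
  rw [hre, windowPot, windowPot, ← intervalIntegral.integral_sub (iF hg) (iF hf),
    ← intervalIntegral.integral_const_mul,
    ← intervalIntegral.integral_sub ((iF hg).sub (iF hf)) (iR.const_mul _)]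
  rw [← Real.norm_eq_abs]
  refine (intervalIntegral.norm_integral_le_of_norm_le_const (C := C * ‖g - f‖ ^ 2)
    fun σ hσ => ?_).trans (le_of_eq ?_)
  · rw [uIoc_of_le hαβ] at hσ
    have hσ' := Ioc_subset_Icc_self hσ
    have := h _ _ (hf σ hσ') (hg σ hσ')
    rw [← freeProp_sub, norm_freeProp] at this
    exact this
  · rw [abs_of_nonneg (by linarith)]
    ring

/-! ### The factorization of the free propagator -/

/-- The phase `x ↦ b |x|²`. -/
def chirp (b : ℝ) : C(Sp d, ℝ) where
  toFun x := b * ‖x‖ ^ 2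

theorem norm_cexp_neg_div_le {b : ℂ} (hb : 0 ≤ b.re) {r : ℝ} (hr : 0 ≤ r) :
    ‖Complex.exp (-(r : ℂ) / b)‖ ≤ 1 := by
  rw [Complex.norm_exp, Real.exp_le_one_iff, neg_div, Complex.neg_re, neg_nonpos, div_eq_mul_inv,
    Complex.re_ofReal_mul, Complex.inv_re]
  exact mul_nonneg hr (div_nonneg hb (Complex.normSq_nonneg _))

theorem integral_fourier_mul_gaussian {b : ℂ} (hb : 0 < b.re) (φ : 𝓢(Sp d, ℂ)) (x : Sp d) :
    ∫ ξ, 𝓕 (φ : Sp d → ℂ) ξ *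
        Complex.exp (-b * ‖ξ‖ ^ 2 + 2 * Real.pi * Complex.I * (inner ℝ x ξ : ℝ)) =
      (Real.pi / b) ^ (d / 2 : ℂ) *
        ∫ y, φ y * Complex.exp (-((Real.pi ^ 2 * ‖x - y‖ ^ 2 : ℝ) : ℂ) / b) := by
  have hg : Integrable fun ξ : Sp d =>
      Complex.exp (-b * ‖ξ‖ ^ 2 + 2 * Real.pi * Complex.I * (inner ℝ x ξ : ℝ)) :=
    GaussianFourier.integrable_cexp_neg_mul_sq_norm_add hb (2 * Real.pi * Complex.I) x
  have h := VectorFourier.integral_fourierIntegral_smul_eq_flip (L := innerₗ (Sp d))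
    (μ := volume) (ν := volume) (f := φ) Real.continuous_fourierChar
    (by simpa using continuous_inner (𝕜 := ℝ) (E := Sp d)) φ.integrable hg
  rw [flip_innerₗ] at h
  refine Eq.trans h ?_
  rw [← integral_const_mul]
  congr 1
  ext y
  have := fourier_gaussian_innerProductSpace' hb x y
  rw [finrank_euclideanSpace_fin] at this
  rw [smul_eq_mul]
  refine (congrArg (fun z => φ y * z) this).trans ?_
  rw [mul_left_comm]
  congr 4
  push_cast
  ring

/-- The oscillatory kernel is the boundary value of the Gaussian one: add ε > 0 to the exponent and
let ε → 0 by dominated convergence on both sides, using that φ and its transform are integrable. -/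
theorem integral_fourier_mul_schrodinger {σ : ℝ} (hσ : σ ≠ 0) (φ : 𝓢(Sp d, ℂ)) (x : Sp d) :
    ∫ ξ, 𝓕 (φ : Sp d → ℂ) ξ * Complex.exp (-(4 * Real.pi ^ 2 * σ * Complex.I) * ‖ξ‖ ^ 2 +
        2 * Real.pi * Complex.I * (inner ℝ x ξ : ℝ)) =
      (Real.pi / (4 * Real.pi ^ 2 * σ * Complex.I)) ^ (d / 2 : ℂ) *
        ∫ y, φ y * Complex.exp (-((Real.pi ^ 2 * ‖x - y‖ ^ 2 : ℝ) : ℂ) /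
          (4 * Real.pi ^ 2 * σ * Complex.I)) := by
  set b₀ : ℂ := 4 * Real.pi ^ 2 * σ * Complex.I
  have hpi : (Real.pi : ℂ) ≠ 0 := by exact_mod_cast Real.pi_ne_zero
  have hσ' : (σ : ℂ) ≠ 0 := by exact_mod_cast hσ
  have hb₀ : b₀ ≠ 0 := by simp [b₀, hσ]
  have hb₀re : b₀.re = 0 := by
    have : b₀ = ((4 * Real.pi ^ 2 * σ : ℝ) : ℂ) * Complex.I := by simp [b₀]
    rw [this, Complex.re_ofReal_mul, Complex.I_re, mul_zero]
  have hre : ∀ ε : ℝ, (ε + b₀ : ℂ).re = ε := fun ε => by simp [hb₀re]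
  have hlim : Tendsto (fun ε : ℝ => (ε + b₀ : ℂ)) (𝓝[>] 0) (𝓝 b₀) := by
    have : Continuous fun ε : ℝ => (ε + b₀ : ℂ) := by fun_prop
    have := this.tendsto 0
    simp only [Complex.ofReal_zero, zero_add] at this
    exact this.mono_left nhdsWithin_le_nhds
  have hφ := φ.integrable (μ := volume)
  have hψ : Integrable (𝓕 (φ : Sp d → ℂ)) := by
    rw [← SchwartzMap.fourier_coe]; exact (𝓕 φ).integrable
  have L1 : Tendsto (fun ε : ℝ => ∫ ξ, 𝓕 (φ : Sp d → ℂ) ξ *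
      Complex.exp (-(ε + b₀) * ‖ξ‖ ^ 2 + 2 * Real.pi * Complex.I * (inner ℝ x ξ : ℝ))) (𝓝[>] 0)
      (𝓝 (∫ ξ, 𝓕 (φ : Sp d → ℂ) ξ *
        Complex.exp (-b₀ * ‖ξ‖ ^ 2 + 2 * Real.pi * Complex.I * (inner ℝ x ξ : ℝ)))) := by
    refine tendsto_integral_filter_of_dominated_convergence (fun ξ => ‖𝓕 (φ : Sp d → ℂ) ξ‖)
      ?_ ?_ hψ.norm ?_
    · refine Eventually.of_forall fun ε => hψ.1.mul (Continuous.aestronglyMeasurable ?_)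
      fun_prop
    · filter_upwards [self_mem_nhdsWithin] with ε hε
      refine Eventually.of_forall fun ξ => ?_
      rw [norm_mul]
      refine mul_le_of_le_one_right (norm_nonneg _) ?_
      rw [Complex.norm_exp, Real.exp_le_one_iff]
      have e1 : (-(ε + b₀) * ‖ξ‖ ^ 2 + 2 * Real.pi * Complex.I * (inner ℝ x ξ : ℝ) : ℂ) =
          ((‖ξ‖ ^ 2 : ℝ) : ℂ) * (-(ε + b₀)) +
            ((2 * Real.pi * inner ℝ x ξ : ℝ) : ℂ) * Complex.I := by
        push_cast; ring
      rw [e1, Complex.add_re, Complex.re_ofReal_mul, Complex.re_ofReal_mul, Complex.neg_re, hre]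
      have : 0 ≤ ‖ξ‖ ^ 2 * ε := mul_nonneg (by positivity) (le_of_lt hε)
      simp
      linarith
    · refine Eventually.of_forall fun ξ => Tendsto.const_mul _ ?_
      exact (Complex.continuous_exp.tendsto _).comp ((hlim.neg.mul_const _).add_const _)
  have L2' : Tendsto (fun ε : ℝ => (Real.pi / (ε + b₀)) ^ (d / 2 : ℂ) *
        ∫ y, φ y * Complex.exp (-((Real.pi ^ 2 * ‖x - y‖ ^ 2 : ℝ) : ℂ) / (ε + b₀))) (𝓝[>] 0)
      (𝓝 ((Real.pi / b₀) ^ (d / 2 : ℂ) *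
        ∫ y, φ y * Complex.exp (-((Real.pi ^ 2 * ‖x - y‖ ^ 2 : ℝ) : ℂ) / b₀))) := by
    refine Tendsto.mul ?_ ?_
    · refine Tendsto.cpow (tendsto_const_nhds.div hlim hb₀) tendsto_const_nhds (Or.inr ?_)
      -- The base of the complex power is nonzero and purely imaginary, hence off the branch cut.
      rw [show (Real.pi : ℂ) / b₀ = ((-(4 * Real.pi * σ)⁻¹ : ℝ) : ℂ) * Complex.I by
        simp only [b₀]; push_cast; field_simp; simp]
      rw [Complex.im_ofReal_mul, Complex.I_im, mul_one, neg_ne_zero]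
      have := Real.pi_ne_zero
      positivity
    · refine tendsto_integral_filter_of_dominated_convergence (fun y => ‖φ y‖) ?_ ?_ hφ.norm ?_
      · refine Eventually.of_forall fun ε => hφ.1.mul (Continuous.aestronglyMeasurable ?_)
        fun_prop
      · filter_upwards [self_mem_nhdsWithin] with ε hε
        refine Eventually.of_forall fun y => ?_
        rw [norm_mul]
        refine mul_le_of_le_one_right (norm_nonneg _) (norm_cexp_neg_div_le ?_ (by positivity))
        rw [hre]
        exact le_of_lt hε
      · refine Eventually.of_forall fun y => Tendsto.const_mul _ ?_
        exact (Complex.continuous_exp.tendsto _).comp (tendsto_const_nhds.div hlim hb₀)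
  refine tendsto_nhds_unique L1 (L2'.congr' ?_)
  filter_upwards [self_mem_nhdsWithin] with ε hε
  exact (integral_fourier_mul_gaussian (by rw [hre]; exact hε) φ x).symm

/-- The modulus of the factor in the factorization of the free propagator. -/
def propFactor (d : ℕ) (σ : ℝ) : ℝ := (4 * Real.pi * |σ|)⁻¹ ^ ((d : ℝ) / 2)

/-- Expanding |x - y|² in the kernel factors e^{iσΔ} as phase · dilation · Fourier transform ·
chirp. Only moduli are needed, so the outer phase and the argument of the constant disappear. -/
theorem norm_fourierInv_schrodinger {σ : ℝ} (hσ : σ ≠ 0) (φ : 𝓢(Sp d, ℂ)) (x : Sp d) :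
    ‖𝓕⁻ (fun ξ => Complex.exp (schrodingerPhase σ ξ * Complex.I) * 𝓕 (φ : Sp d → ℂ) ξ) x‖ =
      propFactor d σ * ‖𝓕 (fun y => Complex.exp (chirp (4 * σ)⁻¹ y * Complex.I) * φ y)
        ((4 * Real.pi * σ)⁻¹ • x)‖ := by
  have hpi : (Real.pi : ℂ) ≠ 0 := by exact_mod_cast Real.pi_ne_zero
  have hσ' : (σ : ℂ) ≠ 0 := by exact_mod_cast hσ
  have e1 : 𝓕⁻ (fun ξ => Complex.exp (schrodingerPhase σ ξ * Complex.I) *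
      𝓕 (φ : Sp d → ℂ) ξ) x =
      ∫ ξ, 𝓕 (φ : Sp d → ℂ) ξ * Complex.exp (-(4 * Real.pi ^ 2 * σ * Complex.I) * ‖ξ‖ ^ 2 +
        2 * Real.pi * Complex.I * (inner ℝ x ξ : ℝ)) := by
    rw [Real.fourierInv_eq']
    congr 1
    ext ξ
    rw [smul_eq_mul, ← mul_assoc, ← Complex.exp_add, mul_comm]
    congr 2
    simp only [schrodingerPhase, ContinuousMap.coe_mk, real_inner_comm x ξ]
    push_cast
    ring
  have e2 : ∫ y, φ y * Complex.exp (-((Real.pi ^ 2 * ‖x - y‖ ^ 2 : ℝ) : ℂ) /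
          (4 * Real.pi ^ 2 * σ * Complex.I)) =
      Complex.exp (((4 * σ)⁻¹ * ‖x‖ ^ 2 : ℝ) * Complex.I) *
        𝓕 (fun y => Complex.exp (chirp (4 * σ)⁻¹ y * Complex.I) * φ y)
        ((4 * Real.pi * σ)⁻¹ • x) := by
    rw [Real.fourier_eq', ← integral_const_mul]
    congr 1
    ext y
    rw [smul_eq_mul, ← mul_assoc, ← mul_assoc, ← Complex.exp_add, ← Complex.exp_add, mul_comm]
    congr 2
    simp only [chirp, ContinuousMap.coe_mk, inner_smul_right, norm_sub_sq_real,
      real_inner_comm y x]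
    push_cast
    have hI : Complex.I ^ 2 = -1 := Complex.I_sq
    field_simp
    rw [hI]
    ring
  rw [e1, integral_fourier_mul_schrodinger hσ, e2, norm_mul, norm_mul,
    Complex.norm_exp_ofReal_mul_I, one_mul]
  congr 1
  rw [show (d / 2 : ℂ) = ((d / 2 : ℝ) : ℂ) by push_cast; rfl, Complex.norm_cpow_real, propFactor]
  congr 1
  simp only [norm_div, norm_mul, Complex.norm_real, Complex.norm_I, norm_pow, Real.norm_eq_abs,
    abs_of_pos Real.pi_pos, Complex.norm_ofNat]
  have := Real.pi_ne_zero
  have : |σ| ≠ 0 := abs_ne_zero.2 hσ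
  field_simp

theorem ae_comp_smul {P : Sp d → Prop} {c : ℝ} (hc : c ≠ 0) (hP : ∀ᵐ x, P x) :
    ∀ᵐ x, P (c • x) := by
  rw [ae_iff] at hP ⊢
  have := Measure.addHaar_preimage_smul (volume : Measure (Sp d)) hc {x | ¬ P x}
  rw [hP, mul_zero] at this
  exact this

/-! ### Extension of the factorization from Schwartz functions to L², and the lens transformation -/

theorem exists_subseq_ae_tendsto {F : ℕ → L2 d} {f : L2 d} (h : Tendsto F atTop (𝓝 f)) :
    ∃ ns : ℕ → ℕ, StrictMono ns ∧
      ∀ᵐ x, Tendsto (fun n => F (ns n) x) atTop (𝓝 (f x)) :=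
  (tendstoInMeasure_of_tendsto_Lp h).exists_seq_tendsto_ae

theorem exists_schwartz_seq (f : L2 d) :
    ∃ φ : ℕ → 𝓢(Sp d, ℂ), Tendsto (fun n => ((φ n).toLp 2 : L2 d)) atTop (𝓝 f) := by
  have hd := SchwartzMap.denseRange_toLpCLM (F := ℂ) (E := Sp d) (p := 2) (μ := volume)
      ENNReal.ofNat_ne_top
  obtain ⟨x, hx, hlim⟩ := mem_closure_iff_seq_limit.1 (hd f)
  choose φ hφ using hx
  refine ⟨φ, ?_⟩
  convert hlim using 2 with n
  exact hφ n

theorem ae_norm_freeProp_eq_of_schwartz {σ : ℝ} (hσ : σ ≠ 0) (φ : 𝓢(Sp d, ℂ)) :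
    ∀ᵐ x, ‖freeProp σ (φ.toLp 2 : L2 d) x‖ = propFactor d σ *
      ‖(𝓕 (phaseMul (chirp (4 * σ)⁻¹) (φ.toLp 2 : L2 d)) : L2 d) ((4 * Real.pi * σ)⁻¹ • x)‖ := by
  have hc : (4 * Real.pi * σ)⁻¹ ≠ 0 := by have := Real.pi_ne_zero; positivity
  have key : ∀ (m : C(Sp d, ℝ)) (ψ : 𝓢(Sp d, ℂ)), ∃ (h2 : MemLp (fun x =>
      Complex.exp (m x * Complex.I) * ψ x) 2 volume),
      Integrable (fun x => Complex.exp (m x * Complex.I) * ψ x) ∧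
      phaseMul m (ψ.toLp 2 : L2 d) = h2.toLp := fun m ψ => by
    have hae : (fun x => Complex.exp (m x * Complex.I) * (ψ.toLp 2 : L2 d) x) =ᵐ[volume]
        fun x => Complex.exp (m x * Complex.I) * ψ x := by
      filter_upwards [ψ.coeFn_toLp 2] with x hx
      rw [hx]
    have h2 : MemLp (fun x => Complex.exp (m x * Complex.I) * ψ x) 2 volume :=
      (memLp_congr_ae hae).1 (memLp_phase_mul _ _)
    refine ⟨h2, ?_, MemLp.toLp_congr (memLp_phase_mul _ _) h2 hae⟩
    exact ψ.integrable.bdd_mul (c := 1) (Continuous.aestronglyMeasurable (by fun_prop))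
      (Eventually.of_forall fun x => by simp [Complex.norm_exp_ofReal_mul_I])
  obtain ⟨a2, a1, ae⟩ := key (schrodingerPhase σ) (𝓕 φ)
  obtain ⟨b2, b1, be⟩ := key (chirp (4 * σ)⁻¹) φ
  rw [freeProp_eq_fourierInv, SchwartzMap.toLp_fourier_eq, ae, be]
  filter_upwards [fourierInv_toLp_of_integrable a1 a2,
    ae_comp_smul hc (fourier_toLp_of_integrable b1 b2)] with x hx hy
  rw [hx, hy]
  exact norm_fourierInv_schrodinger hσ φ x

/-- Both sides come from L²-continuous maps; along a Schwartz approximation two successive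
subsequences make both converge almost everywhere, so the identity of moduli passes to the limit. -/
theorem ae_norm_freeProp_eq {σ : ℝ} (hσ : σ ≠ 0) (f : L2 d) :
    ∀ᵐ x, ‖freeProp σ f x‖ = propFactor d σ *
      ‖(𝓕 (phaseMul (chirp (4 * σ)⁻¹) f) : L2 d) ((4 * Real.pi * σ)⁻¹ • x)‖ := by
  have hc : (4 * Real.pi * σ)⁻¹ ≠ 0 := by have := Real.pi_ne_zero; positivity
  obtain ⟨φ, hφ⟩ := exists_schwartz_seq f
  have t1 : Tendsto (fun n => freeProp σ ((φ n).toLp 2 : L2 d)) atTop (𝓝 (freeProp σ f)) := by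
    simp_rw [← freePropIsom_apply]
    exact ((freePropIsom σ).continuous.tendsto f).comp hφ
  have t2 : Tendsto (fun n => (𝓕 (phaseMul (chirp (4 * σ)⁻¹) ((φ n).toLp 2 : L2 d)) : L2 d)) atTop
      (𝓝 (𝓕 (phaseMul (chirp (4 * σ)⁻¹) f) : L2 d)) :=
    (((Lp.fourierTransformₗᵢ (Sp d) ℂ).continuous.comp
      (phaseMul (chirp (4 * σ)⁻¹)).continuous).tendsto f).comp hφ
  obtain ⟨ns, hns, h1⟩ := exists_subseq_ae_tendsto t1
  obtain ⟨ms, hms, h2⟩ := exists_subseq_ae_tendsto (t2.comp hns.tendsto_atTop)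
  have h3 := ae_all_iff.2 fun n => ae_norm_freeProp_eq_of_schwartz hσ (φ (ns (ms n)))
  filter_upwards [h1, ae_comp_smul hc h2, h3] with x a1 a2 a3
  refine tendsto_nhds_unique (a1.comp hms.tendsto_atTop).norm ?_
  refine (a2.norm.const_mul (propFactor d σ)).congr fun n => ?_
  exact (a3 n).symm

/-- The lens transformation. -/
theorem ae_norm_freeProp_chirp {b σ : ℝ} (hb : 0 < 1 + 4 * b * σ) (f : L2 d) :
    ∀ᵐ x, ‖freeProp σ (phaseMul (chirp b) f) x‖ = (1 + 4 * b * σ)⁻¹ ^ ((d : ℝ) / 2) *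
      ‖freeProp (σ / (1 + 4 * b * σ)) f ((1 + 4 * b * σ)⁻¹ • x)‖ := by
  rcases eq_or_ne σ 0 with rfl | hσ
  · filter_upwards [coeFn_phaseMul (chirp b) f] with x hx
    simp only [mul_zero, add_zero, inv_one, Real.one_rpow, one_mul, one_smul, div_one,
      freeProp_zero, hx, norm_mul, Complex.norm_exp_ofReal_mul_I]
  set l := 1 + 4 * b * σ with hl
  have hσ' : σ / l ≠ 0 := div_ne_zero hσ hb.ne'
  filter_upwards [ae_norm_freeProp_eq hσ (phaseMul (chirp b) f),
    ae_comp_smul (inv_ne_zero hb.ne') (ae_norm_freeProp_eq hσ' f)] with x h1 h2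
  -- The whole lens effect: the chirp rates add, (4σ)⁻¹ + b = (4σ/l)⁻¹, so the extra chirp only
  -- replaces σ by σ/l.
  have e1 : phaseMul (chirp (4 * σ)⁻¹) (phaseMul (chirp b) f) =
      phaseMul (chirp (4 * (σ / l))⁻¹) f := by
    rw [phaseMul_phaseMul]
    congr 2
    ext y
    simp only [chirp, ContinuousMap.add_apply, ContinuousMap.coe_mk, hl]
    field_simp
  have e2 : (4 * Real.pi * (σ / l))⁻¹ • l⁻¹ • x = (4 * Real.pi * σ)⁻¹ • x := by
    rw [smul_smul]
    congr 1
    have := Real.pi_ne_zero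
    field_simp
  have e3 : propFactor d σ = l⁻¹ ^ ((d : ℝ) / 2) * propFactor d (σ / l) := by
    rw [propFactor, propFactor, ← Real.mul_rpow (by positivity) (by positivity), abs_div,
      abs_of_pos hb]
    congr 1
    have := Real.pi_ne_zero
    have : |σ| ≠ 0 := abs_ne_zero.2 hσ
    field_simp
  rw [h1, h2, e1, e2, e3, mul_assoc]

/-- With l = 1 + 4bσ, the amplitude contributes l^{-d(k+1)} and the change of variables x = l y
gives back l^d. -/
theorem lpMass_freeProp_chirp (k : ℕ) {b σ : ℝ} (hb : 0 < 1 + 4 * b * σ) (f : L2 d) :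
    lpMass (2 * k) (freeProp σ (phaseMul (chirp b) f)) =
      ((1 + 4 * b * σ) ^ (d * k))⁻¹ * lpMass (2 * k) (freeProp (σ / (1 + 4 * b * σ)) f) := by
  set l := 1 + 4 * b * σ
  rw [lpMass, lpMass]
  have hpow : (l⁻¹ ^ ((d : ℝ) / 2)) ^ (2 * k + 2) = l⁻¹ ^ (d * (k + 1)) := by
    rw [← Real.rpow_natCast, ← Real.rpow_mul (by positivity), ← Real.rpow_natCast]
    congr 1
    push_cast
    ring
  have e1 : ∫ x, ‖freeProp σ (phaseMul (chirp b) f) x‖ ^ (2 * k + 2) =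
      ∫ x, (l⁻¹) ^ (d * (k + 1)) * (fun y => ‖freeProp (σ / l) f y‖ ^ (2 * k + 2)) (l⁻¹ • x) := by
    refine integral_congr_ae ?_
    filter_upwards [ae_norm_freeProp_chirp hb f] with x hx
    rw [hx, mul_pow, hpow]
  rw [e1, integral_const_mul, Measure.integral_comp_inv_smul volume
    (fun y => ‖freeProp (σ / l) f y‖ ^ (2 * k + 2)) l, finrank_euclideanSpace_fin,
    abs_of_pos (by positivity), smul_eq_mul, ← mul_assoc]
  congr 1
  rw [inv_pow, mul_add, pow_add, mul_one]
  field_simp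

theorem UnifBdd.chirp {M : ℝ} {f : L2 d} (hf : UnifBdd univ M f) {I : Set ℝ} {b : ℝ}
    (hb : ∀ σ ∈ I, 1 / 2 ≤ 1 + 4 * b * σ) :
    UnifBdd I (2 ^ ((d : ℝ) / 2) * M) (phaseMul (chirp b) f) := fun σ hσ => by
  have h0 : 0 < 1 + 4 * b * σ := by linarith [hb σ hσ]
  filter_upwards [ae_norm_freeProp_chirp h0 f,
    ae_comp_smul (inv_ne_zero h0.ne') (hf (σ / (1 + 4 * b * σ)) (mem_univ _))] with x h1 h2
  rw [h1]
  gcongr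
  rw [inv_le_comm₀ h0 (by norm_num)]
  linarith [hb σ hσ]

/-! ### The potential energy under the lens transformation -/

theorem hasDerivAt_lens_endpoint (y : ℝ) : HasDerivAt (fun b : ℝ => y / (1 + 4 * b * y))
    (-4 * y ^ 2) 0 := by
  have h : HasDerivAt (fun b : ℝ => 1 + 4 * b * y) (4 * y) 0 := by
    simpa using (((hasDerivAt_id (0 : ℝ)).const_mul 4).mul_const y).const_add 1
  have := (hasDerivAt_const (0 : ℝ) y).div h (by simp)
  refine this.congr_deriv ?_
  ring

/-- The endpoints move with velocity -4y² at b = 0, which gives the boundary terms; the weight is 1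
- 4(n+1)bs + O(b²), which gives the integral term. Only continuity of `F` is available, so no
derivative falls on it. -/
theorem hasDerivAt_lens_integral {F : ℝ → ℝ} (hF : Continuous F) (n : ℕ) (α β : ℝ) :
    HasDerivAt (fun b : ℝ => ∫ s in (α / (1 + 4 * b * α))..(β / (1 + 4 * b * β)),
        (1 - 4 * b * s) ^ (n + 1) * F s)
      (-4 * β ^ 2 * F β + 4 * α ^ 2 * F α - 4 * (n + 1) * ∫ s in α..β, s * F s) 0 := by
  set B : ℝ → ℝ → ℝ := fun y b => y / (1 + 4 * b * y)
  have hB : ∀ y, HasDerivAt (B y) (-4 * y ^ 2) 0 := hasDerivAt_lens_endpoint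
  have hB0 : ∀ y, B y 0 = y := fun y => by simp [B]
  have hF1 : Continuous fun s => s * F s := continuous_id.mul hF
  have prim : ∀ {G : ℝ → ℝ}, Continuous G → ∀ y,
      HasDerivAt (fun b => ∫ s in (0 : ℝ)..(B y b), G s) (G y * (-4 * y ^ 2)) 0 := fun {G} hG y => by
    have h1 : HasDerivAt (fun z => ∫ s in (0 : ℝ)..z, G s) (G y) (B y 0) := by
      rw [hB0]
      exact intervalIntegral.integral_hasDerivAt_right (hG.intervalIntegrable _ _)
        (hG.stronglyMeasurableAtFilter _ _) hG.continuousAt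
    exact h1.comp 0 (hB y)
  -- The part of the weight beyond first order. It is O(b²) because the endpoints stay bounded for
  -- small b, so its derivative at 0 vanishes.
  set R : ℝ → ℝ := fun b => ∫ s in (B α b)..(B β b),
    ((1 - 4 * b * s) ^ (n + 1) - 1 ^ (n + 1) - (n + 1) * 1 ^ n * ((1 - 4 * b * s) - 1)) * F s
  have hR : HasDerivAt R 0 0 := by
    obtain ⟨C, hC, hbd⟩ := exists_pow_taylor_bound n 2
    set L := |α| + |β| + 1
    obtain ⟨K, hK⟩ := (isCompact_Icc (a := -L) (b := L)).exists_bound_of_continuousOn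
      hF.continuousOn
    have hK0 : 0 ≤ K := (norm_nonneg _).trans (hK 0 ⟨neg_nonpos.2 (by positivity), by positivity⟩)
    have hev : ∀ y : ℝ, |y| < L → ∀ᶠ b in 𝓝 (0 : ℝ), |B y b| < L := fun y hy => by
      have := (hB y).continuousAt.abs
      refine this.eventually_lt_const ?_
      simpa only [hB0] using hy
    have hsm : ∀ᶠ b in 𝓝 (0 : ℝ), |b| < (4 * L)⁻¹ :=
      (continuous_abs.tendsto (0 : ℝ)).eventually_lt_const (by simp; positivity)
    have hO : R =O[𝓝 0] fun b => ‖b - 0‖ ^ 2 := by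
      refine Asymptotics.IsBigO.of_bound (C * (4 * L) ^ 2 * K * (2 * L)) ?_
      filter_upwards [hev α (by simp only [L]; linarith [abs_nonneg β]),
        hev β (by simp only [L]; linarith [abs_nonneg α]), hsm] with b h1 h2 h3
      refine (intervalIntegral.norm_integral_le_of_norm_le_const
        (C := C * (4 * L) ^ 2 * K * b ^ 2) fun s hs => ?_).trans ?_
      · have hs' : |s| ≤ L := by
          have := uIoc_subset_uIcc hs
          rw [abs_lt] at h1 h2
          rw [abs_le]
          rcases mem_uIcc.1 this with h | h <;> constructor <;> linarith [h.1, h.2]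
        have hbs : |4 * b * s| ≤ 1 := by
          rw [abs_mul, abs_mul, abs_of_pos (by norm_num : (0 : ℝ) < 4)]
          calc 4 * |b| * |s| ≤ 4 * (4 * L)⁻¹ * L := by gcongr
            _ = 1 := by
              have : L ≠ 0 := by positivity
              field_simp
        have t := hbd (1 - 4 * b * s) 1 (by rw [abs_le] at hbs ⊢; constructor <;> linarith [hbs.1, hbs.2])
          (by norm_num)
        rw [norm_mul, Real.norm_eq_abs]
        calc _ ≤ (C * (1 - 4 * b * s - 1) ^ 2) * K :=
              mul_le_mul t (hK s (abs_le.1 hs')) (norm_nonneg _) (by positivity)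
          _ = C * (4 * |s|) ^ 2 * K * b ^ 2 := by rw [mul_pow 4 |s|, sq_abs]; ring
          _ ≤ _ := by gcongr
      · have hd : |B β b - B α b| ≤ 2 * L := by
          refine (abs_sub _ _).trans ?_
          linarith
        rw [Real.norm_of_nonneg (by positivity), sub_zero, Real.norm_eq_abs, sq_abs]
        calc _ ≤ C * (4 * L) ^ 2 * K * b ^ 2 * (2 * L) := by gcongr
          _ = _ := by ring
    have := (hO.hasFDerivAt (by norm_num)).hasDerivAt
    simpa using this
  have split : (fun b : ℝ => ∫ s in (α / (1 + 4 * b * α))..(β / (1 + 4 * b * β)),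
        (1 - 4 * b * s) ^ (n + 1) * F s) = fun b =>
      (((∫ s in (0 : ℝ)..(B β b), F s) - ∫ s in (0 : ℝ)..(B α b), F s) -
        4 * (n + 1) * b * ((∫ s in (0 : ℝ)..(B β b), s * F s) -
          ∫ s in (0 : ℝ)..(B α b), s * F s)) + R b := by
    ext b
    have i1 : ∀ x y, IntervalIntegrable F volume x y := fun x y => hF.intervalIntegrable x y
    have i2 : ∀ x y, IntervalIntegrable (fun s => s * F s) volume x y :=
      fun x y => hF1.intervalIntegrable x y
    rw [intervalIntegral.integral_interval_sub_left (i1 _ _) (i1 _ _),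
      intervalIntegral.integral_interval_sub_left (i2 _ _) (i2 _ _),
      ← intervalIntegral.integral_const_mul, ← intervalIntegral.integral_sub (i1 _ _)
      ((i2 _ _).const_mul _), ← intervalIntegral.integral_add]
    · refine intervalIntegral.integral_congr fun s _ => ?_
      simp only [one_pow]
      ring
    · exact (i1 _ _).sub ((i2 _ _).const_mul _)
    · exact Continuous.intervalIntegrable (by fun_prop) _ _
  rw [split]
  have main := (((prim hF β).sub (prim hF α)).sub
    ((((hasDerivAt_id (0 : ℝ)).const_mul (4 * ((n : ℝ) + 1))).mul
      ((prim hF1 β).sub (prim hF1 α))))).add hR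
  refine main.congr_deriv ?_
  simp only [Pi.sub_apply, hB0, id, mul_zero, zero_mul, add_zero, mul_one]
  rw [intervalIntegral.integral_interval_sub_left (hF1.intervalIntegrable _ _)
    (hF1.intervalIntegrable _ _)]
  ring

/-- Substitute s = σ/l with l = 1 + 4bσ: then ds = l⁻² dσ and l⁻¹ = 1 - 4bs, so l^{-dk} dσ becomes
(1 - 4bs)^{dk-2} ds, with dk - 2 = n + 1. -/
theorem windowPot_chirp {k n : ℕ} (hn : d * k = n + 3) {M : ℝ} {f : L2 d}
    (hf : UnifBdd univ M f) {α β b : ℝ} (hb : ∀ σ ∈ uIcc α β, 0 < 1 + 4 * b * σ) :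
    windowPot (2 * k) α β (phaseMul (chirp b) f) =
      ∫ s in (α / (1 + 4 * b * α))..(β / (1 + 4 * b * β)),
        (1 - 4 * b * s) ^ (n + 1) * lpMass (2 * k) (freeProp s f) := by
  have hF : Continuous fun s => lpMass (2 * k) (freeProp s f) :=
    continuousOn_univ.1 (hf.continuousOn_lpMass k)
  have key := intervalIntegral.integral_comp_mul_deriv (a := α) (b := β)
    (f := fun σ => σ / (1 + 4 * b * σ)) (f' := fun σ => ((1 + 4 * b * σ) ^ 2)⁻¹)
    (g := fun s => (1 - 4 * b * s) ^ (n + 1) * lpMass (2 * k) (freeProp s f))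
    (fun σ hσ => by
      have h0 := (hb σ hσ).ne'
      have h : HasDerivAt (fun σ : ℝ => 1 + 4 * b * σ) (4 * b) σ := by
        simpa using ((hasDerivAt_id σ).const_mul (4 * b)).const_add 1
      refine ((hasDerivAt_id σ).div h h0).congr_deriv ?_
      simp only [id]
      field_simp
      ring)
    (ContinuousOn.inv₀ (by fun_prop) fun σ hσ => (pow_pos (hb σ hσ) 2).ne')
    (Continuous.mul (by fun_prop) hF)
  rw [← key, windowPot]
  refine intervalIntegral.integral_congr fun σ hσ => ?_
  have h0 := hb σ hσ
  simp only [Function.comp]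
  rw [lpMass_freeProp_chirp k h0, hn]
  have e : 1 - 4 * b * (σ / (1 + 4 * b * σ)) = (1 + 4 * b * σ)⁻¹ := by
    field_simp
    ring
  rw [e, inv_pow, pow_add _ n 3, pow_succ _ n]
  field_simp

/-! ### The position operator -/

/-- `g = x_j f`. -/
def IsPos (j : Fin d) (f g : L2 d) : Prop := g =ᵐ[volume] fun x => (x j : ℂ) * f x

theorem sum_norm_sq_isPos {f : L2 d} {X : Fin d → L2 d} (hX : ∀ j, IsPos j f (X j)) :
    (∀ᵐ x, ∑ j, ‖X j x‖ ^ 2 = ‖x‖ ^ 2 * ‖f x‖ ^ 2) := by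
  filter_upwards [ae_all_iff.2 hX] with x hx
  simp_rw [hx, norm_mul, mul_pow, ← Finset.sum_mul, Complex.norm_real, EuclideanSpace.norm_sq_eq]

theorem variance_eq_sum {f : L2 d} {X : Fin d → L2 d} (hX : ∀ j, IsPos j f (X j)) :
    variance f = ∑ j, ‖X j‖ ^ 2 := by
  simp_rw [norm_sq_eq_integral]
  rw [← integral_finsetSum _ fun j _ => integrable_norm_sq (X j)]
  refine integral_congr_ae ?_
  filter_upwards [sum_norm_sq_isPos hX] with x hx
  exact hx.symm

theorem sum_inner_isPos {f g : L2 d} {X Y : Fin d → L2 d} (hX : ∀ j, IsPos j f (X j))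
    (hY : ∀ j, IsPos j g (Y j)) :
    Integrable (fun x => ((‖x‖ ^ 2 : ℝ) : ℂ) * inner ℂ (g x) (f x)) ∧
    ∫ x, ((‖x‖ ^ 2 : ℝ) : ℂ) * inner ℂ (g x) (f x) = ∑ j, inner ℂ (Y j) (X j) := by
  have hae : (fun x => ∑ j, inner ℂ (Y j x) (X j x)) =ᵐ[volume]
      fun x => ((‖x‖ ^ 2 : ℝ) : ℂ) * inner ℂ (g x) (f x) := by
    filter_upwards [ae_all_iff.2 hX, ae_all_iff.2 hY] with x h1 h2
    simp_rw [h1, h2, EuclideanSpace.norm_sq_eq]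
    push_cast
    rw [Finset.sum_mul]
    refine Finset.sum_congr rfl fun j _ => ?_
    rw [← smul_eq_mul, ← smul_eq_mul, inner_smul_left, inner_smul_right, Complex.conj_ofReal,
      ← Complex.ofReal_pow, Real.norm_eq_abs, sq_abs]
    push_cast
    ring
  have hi : ∀ j ∈ Finset.univ, Integrable fun x => inner ℂ (Y j x) (X j x) := fun j _ =>
    L2.integrable_inner (𝕜 := ℂ) (Y j) (X j)
  refine ⟨(integrable_finsetSum _ hi).congr hae, ?_⟩
  rw [← integral_congr_ae hae, integral_finsetSum _ hi]
  rfl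

theorem norm_cexp_mul_I_sub_one_le (t : ℝ) : ‖Complex.exp (t * Complex.I) - 1‖ ≤ |t| := by
  rw [mul_comm]
  exact Real.norm_exp_I_mul_ofReal_sub_one_le

theorem tendsto_cexp_sub_one_div (r : ℝ) :
    Tendsto (fun b : ℝ => (Complex.exp ((b * r : ℝ) * Complex.I) - 1) / b) (𝓝[≠] 0)
      (𝓝 (r * Complex.I)) := by
  have h : HasDerivAt (fun b : ℝ => Complex.exp ((b * r : ℝ) * Complex.I)) (r * Complex.I) 0 := by
    have h1 : HasDerivAt (fun b : ℝ => ((b * r : ℝ) : ℂ) * Complex.I) (r * Complex.I) 0 := by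
      have := ((hasDerivAt_id (0 : ℝ)).mul_const r).ofReal_comp.mul_const Complex.I
      simpa using this
    have := h1.cexp
    simpa using this
  refine (hasDerivAt_iff_tendsto_slope.1 h).congr fun b => ?_
  rw [slope_def_module, sub_zero, Complex.real_smul]
  simp
  ring

/-- The formal derivative i|x|²f need not lie in L², so the limit is taken only weakly, against a
`g` that also has a first moment; |x|²|f||g| dominates. -/
theorem tendsto_inner_chirp_sub {f g : L2 d} {X Y : Fin d → L2 d} (hX : ∀ j, IsPos j f (X j))
    (hY : ∀ j, IsPos j g (Y j)) :
    Tendsto (fun b : ℝ => (inner ℂ g (phaseMul (chirp b) f - f)) / (b : ℂ)) (𝓝[>] 0)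
      (𝓝 (Complex.I * ∑ j, inner ℂ (Y j) (X j))) := by
  obtain ⟨hi, hs⟩ := sum_inner_isPos hX hY
  rw [← hs, ← integral_const_mul]
  have e : ∀ b : ℝ, inner ℂ g (phaseMul (chirp b) f - f) / (b : ℂ) =
      ∫ x, (Complex.exp ((b * ‖x‖ ^ 2 : ℝ) * Complex.I) - 1) / b * inner ℂ (g x) (f x) := by
    intro b
    rw [L2.inner_def, ← integral_div]
    refine integral_congr_ae ?_
    filter_upwards [Lp.coeFn_sub (phaseMul (chirp b) f) f, coeFn_phaseMul (chirp b) f]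
      with x h1 h2
    rw [h1, Pi.sub_apply, h2, show Complex.exp (chirp b x * Complex.I) * f x - f x =
      (Complex.exp ((b * ‖x‖ ^ 2 : ℝ) * Complex.I) - 1) • f x by
        rw [smul_eq_mul, sub_mul, one_mul]; rfl, inner_smul_right]
    ring
  simp_rw [e]
  refine tendsto_integral_filter_of_dominated_convergence
    (fun x => ‖((‖x‖ ^ 2 : ℝ) : ℂ) * inner ℂ (g x) (f x)‖) ?_ ?_ hi.norm ?_
  · refine Eventually.of_forall fun b => ?_
    exact (Continuous.aestronglyMeasurable (by fun_prop)).mul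
      ((Lp.memLp g).1.inner (𝕜 := ℂ) (Lp.memLp f).1)
  · filter_upwards [self_mem_nhdsWithin] with b hb
    refine Eventually.of_forall fun x => ?_
    have hb' : 0 < b := hb
    rw [norm_mul, norm_mul]
    gcongr
    rw [norm_div, Complex.norm_real, Complex.norm_real, Real.norm_of_nonneg hb'.le,
      div_le_iff₀ hb']
    refine (norm_cexp_mul_I_sub_one_le _).trans (le_of_eq ?_)
    rw [abs_of_nonneg (by positivity), Real.norm_of_nonneg (by positivity)]
    ring
  · refine Eventually.of_forall fun x => ?_
    have := ((tendsto_cexp_sub_one_div (‖x‖ ^ 2)).mono_left (nhdsGT_le_nhdsNE 0)).mul_const (inner ℂ (g x) (f x))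
    convert this using 2
    ring

/-- One moment suffices to make the quadratic Taylor remainder o(b): |e^{ib|x|²} - 1|² is at most
2b|x|², which dominates after division by b, and at most b²|x|⁴, which gives the pointwise limit. -/
theorem tendsto_norm_sq_chirp_sub {f : L2 d} {X : Fin d → L2 d} (hX : ∀ j, IsPos j f (X j)) :
    Tendsto (fun b : ℝ => ‖phaseMul (chirp b) f - f‖ ^ 2 / b) (𝓝[>] 0) (𝓝 0) := by
  have hi : Integrable fun x : Sp d => ‖x‖ ^ 2 * ‖f x‖ ^ 2 :=
    (integrable_finsetSum _ fun j _ => integrable_norm_sq (X j)).congr (sum_norm_sq_isPos hX)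
  have e : ∀ b : ℝ, ‖phaseMul (chirp b) f - f‖ ^ 2 / b =
      ∫ x, ‖Complex.exp ((b * ‖x‖ ^ 2 : ℝ) * Complex.I) - 1‖ ^ 2 / b * ‖f x‖ ^ 2 := by
    intro b
    rw [norm_sq_eq_integral, ← integral_div]
    refine integral_congr_ae ?_
    filter_upwards [Lp.coeFn_sub (phaseMul (chirp b) f) f, coeFn_phaseMul (chirp b) f]
      with x h1 h2
    rw [h1, Pi.sub_apply, h2, show Complex.exp (chirp b x * Complex.I) * f x - f x =
      (Complex.exp ((b * ‖x‖ ^ 2 : ℝ) * Complex.I) - 1) * f x by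
        rw [sub_mul, one_mul]; rfl, norm_mul]
    ring
  simp_rw [e]
  suffices h : Tendsto (fun b : ℝ =>
      ∫ x, ‖Complex.exp ((b * ‖x‖ ^ 2 : ℝ) * Complex.I) - 1‖ ^ 2 / b * ‖f x‖ ^ 2) (𝓝[>] 0)
      (𝓝 (∫ _x : Sp d, (0 : ℝ))) by simpa using h
  refine tendsto_integral_filter_of_dominated_convergence
    (fun x => 2 * (‖x‖ ^ 2 * ‖f x‖ ^ 2)) ?_ ?_ (hi.const_mul 2) ?_
  · refine Eventually.of_forall fun b => ?_
    exact (Continuous.aestronglyMeasurable (by fun_prop)).mul ((Lp.memLp f).1.norm.pow 2)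
  · filter_upwards [self_mem_nhdsWithin] with b hb
    refine Eventually.of_forall fun x => ?_
    have hb' : 0 < b := hb
    rw [Real.norm_of_nonneg (by positivity), ← mul_assoc]
    gcongr
    rw [div_le_iff₀ hb', sq]
    have h1 := norm_cexp_mul_I_sub_one_le (b * ‖x‖ ^ 2)
    rw [abs_of_nonneg (by positivity)] at h1
    have h2 : ‖Complex.exp ((b * ‖x‖ ^ 2 : ℝ) * Complex.I) - 1‖ ≤ 2 := by
      refine (norm_sub_le _ _).trans ?_
      rw [Complex.norm_exp_ofReal_mul_I, norm_one]
      norm_num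
    calc _ ≤ 2 * (b * ‖x‖ ^ 2) := by gcongr
      _ = _ := by ring
  · refine Eventually.of_forall fun x => ?_
    have t : Tendsto (fun b : ℝ => b * (‖x‖ ^ 2) ^ 2 * ‖f x‖ ^ 2) (𝓝[>] 0) (𝓝 0) := by
      have : Continuous fun b : ℝ => b * (‖x‖ ^ 2) ^ 2 * ‖f x‖ ^ 2 := by fun_prop
      have := this.tendsto 0
      simp only [zero_mul] at this
      exact this.mono_left nhdsWithin_le_nhds
    refine squeeze_zero' ?_ ?_ t
    · filter_upwards [self_mem_nhdsWithin] with b hb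
      have hb' : 0 < b := hb
      positivity
    · filter_upwards [self_mem_nhdsWithin] with b hb
      have hb' : 0 < b := hb
      gcongr
      rw [div_le_iff₀ hb']
      have h1 := norm_cexp_mul_I_sub_one_le (b * ‖x‖ ^ 2)
      rw [abs_of_nonneg (by positivity)] at h1
      calc _ ≤ (b * ‖x‖ ^ 2) ^ 2 := by gcongr
        _ = _ := by ring

/-- The virial identity for the averaged nonlinearity. -/
theorem sum_im_inner_windowNL {k n : ℕ} (hn : d * k = n + 3) {M : ℝ} (hM : 0 ≤ M) {f : L2 d}
    (hf : UnifBdd univ M f) {α β : ℝ} (hαβ : α ≤ β) {X Y : Fin d → L2 d}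
    (hX : ∀ j, IsPos j f (X j)) (hY : ∀ j, IsPos j (windowNL (2 * k) α β f) (Y j)) :
    (2 * k + 2) * ∑ j, (inner ℂ (X j) (Y j)).im =
      -4 * β ^ 2 * lpMass (2 * k) (freeProp β f) + 4 * α ^ 2 * lpMass (2 * k) (freeProp α f) -
        4 * (n + 1) * ∫ s in α..β, s * lpMass (2 * k) (freeProp s f) := by
  -- The right derivative of `H` at 0 is computed twice: `hlim1` by the lens transformation, `hlim2`
  -- by Taylor expansion. The chirped functions share the sup bound `M'` as long as 1 + 4bσ ≥ 1/2 on
  -- the window.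
  set H : ℝ → ℝ := fun b => windowPot (2 * k) α β (phaseMul (chirp b) f)
  set g := windowNL (2 * k) α β f
  have hF : Continuous fun s => lpMass (2 * k) (freeProp s f) :=
    continuousOn_univ.1 (hf.continuousOn_lpMass k)
  have hsmall : ∀ᶠ b in 𝓝 (0 : ℝ), ∀ σ ∈ Icc α β, 1 / 2 ≤ 1 + 4 * b * σ := by
    have : ∀ᶠ b in 𝓝 (0 : ℝ), |b| < (8 * (|α| + |β| + 1))⁻¹ :=
      (continuous_abs.tendsto (0 : ℝ)).eventually_lt_const (by simp; positivity)
    filter_upwards [this] with b hb σ hσ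
    have hσ' : |σ| ≤ |α| + |β| + 1 := by
      rw [abs_le]
      constructor <;> linarith [hσ.1, hσ.2, neg_abs_le α, le_abs_self β, abs_nonneg α, abs_nonneg β]
    have : |4 * b * σ| ≤ 1 / 2 := by
      rw [abs_mul, abs_mul, abs_of_pos (by norm_num : (0 : ℝ) < 4)]
      calc 4 * |b| * |σ| ≤ 4 * (8 * (|α| + |β| + 1))⁻¹ * (|α| + |β| + 1) := by gcongr
        _ = 1 / 2 := by field_simp; norm_num
    linarith [neg_abs_le (4 * b * σ)]
  have hH0 : H 0 = windowPot (2 * k) α β f := by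
    simp only [H]
    congr 1
    convert phaseMul_zero f
    ext x
    simp [chirp]
  have hderiv : HasDerivAt H (-4 * β ^ 2 * lpMass (2 * k) (freeProp β f) +
      4 * α ^ 2 * lpMass (2 * k) (freeProp α f) -
        4 * (n + 1) * ∫ s in α..β, s * lpMass (2 * k) (freeProp s f)) 0 := by
    refine (hasDerivAt_lens_integral hF n α β).congr_of_eventuallyEq ?_
    filter_upwards [hsmall] with b hb
    refine windowPot_chirp hn hf fun σ hσ => ?_
    rw [uIcc_of_le hαβ] at hσ
    linarith [hb σ hσ]
  have hlim1 : Tendsto (fun b => (H b - H 0) / b) (𝓝[>] 0) (𝓝 (-4 * β ^ 2 * lpMass (2 * k)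
      (freeProp β f) + 4 * α ^ 2 * lpMass (2 * k) (freeProp α f) -
        4 * (n + 1) * ∫ s in α..β, s * lpMass (2 * k) (freeProp s f))) := by
    have := (hasDerivAt_iff_tendsto_slope.1 hderiv).mono_left
      (nhdsWithin_mono (0 : ℝ) fun x (hx : 0 < x) => (ne_of_gt hx : x ≠ 0))
    refine this.congr fun b => ?_
    rw [slope_def_field, sub_zero]
  have hre : Tendsto (fun b : ℝ => (inner ℂ g (phaseMul (chirp b) f - f)).re / b) (𝓝[>] 0)
      (𝓝 (∑ j, (inner ℂ (X j) (Y j)).im)) := by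
    have := (Complex.continuous_re.tendsto _).comp (tendsto_inner_chirp_sub hX hY)
    refine (this.congr fun b => ?_).trans_eq ?_
    · simp only [Function.comp]
      rw [Complex.div_ofReal_re]
    · congr 1
      rw [Complex.I_mul_re, Complex.im_sum, ← Finset.sum_neg_distrib]
      refine Finset.sum_congr rfl fun j _ => ?_
      rw [← inner_conj_symm, Complex.conj_im, neg_neg]
  set M' := (1 + 2 ^ ((d : ℝ) / 2)) * M
  obtain ⟨C, hC, hT⟩ := exists_windowPot_taylor_bound (d := d) k (M := M') hαβ
  have hlim2 : Tendsto (fun b => (H b - H 0) / b) (𝓝[>] 0)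
      (𝓝 ((2 * k + 2) * ∑ j, (inner ℂ (X j) (Y j)).im)) := by
    have t1 := hre.const_mul (2 * (k : ℝ) + 2)
    have t2 := (tendsto_norm_sq_chirp_sub hX).const_mul C
    rw [mul_zero] at t2
    refine tendsto_of_tendsto_of_dist t1 (squeeze_zero' (Eventually.of_forall fun _ => dist_nonneg)
      ?_ t2)
    filter_upwards [self_mem_nhdsWithin, hsmall.filter_mono nhdsWithin_le_nhds] with b hb hb2
    have hb' : 0 < b := hb
    have h2 : (0 : ℝ) ≤ 2 ^ ((d : ℝ) / 2) := by positivity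
    have := hT f (phaseMul (chirp b) f) (hf.mono (subset_univ _) (by
        simp only [M']; nlinarith)) ((hf.chirp hb2).mono le_rfl (by simp only [M']; nlinarith))
    rw [dist_comm, Real.dist_eq, hH0]
    rw [show (H b - windowPot (2 * k) α β f) / b -
      (2 * k + 2) * ((inner ℂ g (phaseMul (chirp b) f - f)).re / b) =
      (H b - windowPot (2 * k) α β f - (2 * k + 2) *
        (inner ℂ g (phaseMul (chirp b) f - f)).re) / b by ring, abs_div, abs_of_pos hb',
      ← mul_div_assoc]
    gcongr
  exact tendsto_nhds_unique hlim2 hlim1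

/-! ### Difference quotients for the position and momentum operators -/

/-- The standard basis vectors. -/
def basisVec (j : Fin d) : Sp d := EuclideanSpace.single j 1

theorem inner_basisVec (j : Fin d) (x : Sp d) : inner ℝ (basisVec j) x = x j := by
  simp [basisVec, EuclideanSpace.inner_single_left]

theorem norm_basisVec (j : Fin d) : ‖basisVec j‖ = 1 := by simp [basisVec]

/-- Multiplication by `exp (i ε x_j)`. -/
def weyl (j : Fin d) (ε : ℝ) : L2 d →ₗᵢ[ℂ] L2 d := phaseMul (planeWave (ε • basisVec j))

theorem coeFn_weyl (j : Fin d) (ε : ℝ) (f : L2 d) :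
    weyl j ε f =ᵐ[volume] fun x => Complex.exp ((ε * x j : ℝ) * Complex.I) * f x := by
  filter_upwards [coeFn_phaseMul (planeWave (ε • basisVec j)) f] with x hx
  rw [weyl, hx]
  simp only [planeWave, ContinuousMap.coe_mk, inner_smul_left, inner_basisVec, conj_trivial]

/-- The difference quotient `(exp (i ε x_j) - 1) / (i ε)`. -/
def posQuot (j : Fin d) (ε : ℝ) : L2 d →L[ℂ] L2 d :=
  ((ε : ℂ) * Complex.I)⁻¹ • ((weyl j ε).toContinuousLinearMap - ContinuousLinearMap.id ℂ (L2 d))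

theorem posQuot_apply (j : Fin d) (ε : ℝ) (f : L2 d) :
    posQuot j ε f = ((ε : ℂ) * Complex.I)⁻¹ • (weyl j ε f - f) := rfl

theorem weyl_sub_eq (j : Fin d) {ε : ℝ} (hε : ε ≠ 0) (f : L2 d) :
    weyl j ε f - f = ((ε : ℂ) * Complex.I) • posQuot j ε f := by
  have : (ε : ℂ) * Complex.I ≠ 0 := mul_ne_zero (by exact_mod_cast hε) Complex.I_ne_zero
  rw [posQuot_apply, smul_smul, mul_inv_cancel₀ this, one_smul]

theorem coeFn_posQuot (j : Fin d) (ε : ℝ) (f : L2 d) : posQuot j ε f =ᵐ[volume] fun x =>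
    ((Complex.exp ((ε * x j : ℝ) * Complex.I) - 1) / ε) * (-Complex.I * f x) := by
  rw [posQuot_apply]
  filter_upwards [Lp.coeFn_smul ((ε : ℂ) * Complex.I)⁻¹ (weyl j ε f - f),
    Lp.coeFn_sub (weyl j ε f) f, coeFn_weyl j ε f] with x h1 h2 h3
  rw [h1, Pi.smul_apply, h2, Pi.sub_apply, h3, smul_eq_mul, mul_inv, Complex.inv_I]
  ring

theorem norm_cexp_sub_one_div_le (ε r : ℝ) :
    ‖(Complex.exp ((ε * r : ℝ) * Complex.I) - 1) / ε‖ ≤ |r| := by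
  rcases eq_or_ne ε 0 with rfl | hε
  · simp
  · rw [norm_div, Complex.norm_real, Real.norm_eq_abs, div_le_iff₀ (abs_pos.2 hε), ← abs_mul,
      mul_comm r]
    exact norm_cexp_mul_I_sub_one_le _

theorem IsPos.norm_posQuot_le {j : Fin d} {f X : L2 d} (h : IsPos j f X) (ε : ℝ) :
    ‖posQuot j ε f‖ ≤ ‖X‖ := by
  refine Lp.norm_le_norm_of_ae_le ?_
  filter_upwards [coeFn_posQuot j ε f, h] with x h1 h2
  rw [h1, h2, norm_mul, norm_mul, norm_mul, norm_neg, Complex.norm_I, one_mul, Complex.norm_real,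
    Real.norm_eq_abs]
  gcongr
  exact norm_cexp_sub_one_div_le _ _

theorem tendsto_posQuot_pointwise (j : Fin d) (f : L2 d) (x : Sp d) :
    Tendsto (fun ε : ℝ => ((Complex.exp ((ε * x j : ℝ) * Complex.I) - 1) / ε) *
      (-Complex.I * f x)) (𝓝[≠] 0) (𝓝 ((x j : ℂ) * f x)) := by
  have := (tendsto_cexp_sub_one_div (x j)).mul_const (-Complex.I * f x)
  convert this using 2
  rw [show (x j : ℂ) * Complex.I * (-Complex.I * f x) =
    -(Complex.I * Complex.I) * (x j * f x) by ring, Complex.I_mul_I]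
  ring

theorem IsPos.tendsto_posQuot {j : Fin d} {f X : L2 d} (h : IsPos j f X) :
    Tendsto (fun ε => posQuot j ε f) (𝓝[≠] 0) (𝓝 X) := by
  refine tendsto_L2_of_dominated (fun ε => coeFn_posQuot j ε f) h
    (G := fun x => 2 * ‖X x‖) ((Lp.memLp _).norm.const_mul 2) (Eventually.of_forall fun ε => ?_)
    (Eventually.of_forall fun x => tendsto_posQuot_pointwise j f x)
  filter_upwards [h] with x hx
  refine (norm_sub_le _ _).trans ?_
  rw [two_mul, hx]
  refine add_le_add ?_ le_rfl
  rw [norm_mul, norm_mul, norm_mul, norm_neg, Complex.norm_I, one_mul, Complex.norm_real,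
    Real.norm_eq_abs]
  gcongr
  exact norm_cexp_sub_one_div_le _ _

/-- The sequence `1 / (n + 1)` of step sizes. -/
def stepSeq (n : ℕ) : ℝ := 1 / ((n : ℝ) + 1)

theorem stepSeq_pos (n : ℕ) : 0 < stepSeq n := by unfold stepSeq; positivity

theorem stepSeq_le_one (n : ℕ) : stepSeq n ≤ 1 := by
  unfold stepSeq
  rw [div_le_one (by positivity)]
  linarith [(Nat.cast_nonneg n : (0 : ℝ) ≤ n)]

theorem tendsto_stepSeq : Tendsto stepSeq atTop (𝓝[≠] 0) := by
  refine tendsto_nhdsWithin_iff.2 ⟨tendsto_one_div_add_atTop_nhds_zero_nat,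
    Eventually.of_forall fun n => (stepSeq_pos n).ne'⟩

theorem isPos_of_tendsto_posQuot {j : Fin d} {f X : L2 d}
    (h : Tendsto (fun ε => posQuot j ε f) (𝓝[≠] 0) (𝓝 X)) : IsPos j f X := by
  obtain ⟨ns, hns, hae⟩ := exists_subseq_ae_tendsto (h.comp tendsto_stepSeq)
  filter_upwards [hae, ae_all_iff.2 fun n => coeFn_posQuot j (stepSeq n) f] with x h1 h2
  refine tendsto_nhds_unique h1 ?_
  refine (((tendsto_posQuot_pointwise j f x).comp tendsto_stepSeq).comp
    hns.tendsto_atTop).congr fun n => ?_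
  simp only [Function.comp]
  rw [h2]

/-- Fatou: the quotients converge pointwise to x_j f, so a uniform L² bound puts x_j f in L². -/
theorem exists_isPos_of_bounded {j : Fin d} {f : L2 d} {C : ℝ}
    (h : ∀ n, ‖posQuot j (stepSeq n) f‖ ≤ C) : ∃ X : L2 d, IsPos j f X := by
  have hC : 0 ≤ C := (norm_nonneg _).trans (h 0)
  have hmeas : AEStronglyMeasurable (fun x : Sp d => (x j : ℂ) * f x) volume :=
    (Continuous.aestronglyMeasurable (by fun_prop)).mul (Lp.memLp f).1
  have hmem : MemLp (fun x : Sp d => (x j : ℂ) * f x) 2 volume := by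
    refine ⟨hmeas, ?_⟩
    have hle := Lp.eLpNorm_lim_le_liminf_eLpNorm (p := 2) (μ := (volume : Measure (Sp d)))
      (f := fun n => (posQuot j (stepSeq n) f : Sp d → ℂ)) (fun n => (Lp.memLp _).1)
      (fun x : Sp d => (x j : ℂ) * f x) (by
        filter_upwards [ae_all_iff.2 fun n => coeFn_posQuot j (stepSeq n) f] with x h2
        refine ((tendsto_posQuot_pointwise j f x).comp tendsto_stepSeq).congr fun n => ?_
        simp only [Function.comp]
        rw [h2])
    refine lt_of_le_of_lt (hle.trans ?_) (ENNReal.ofReal_lt_top (r := C))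
    refine (Filter.liminf_le_liminf (v := fun _ => ENNReal.ofReal C)
      (Eventually.of_forall fun n => ?_)).trans (by simp)
    rw [← ENNReal.ofReal_toReal (Lp.memLp (posQuot j (stepSeq n) f)).2.ne, ← Lp.norm_def]
    exact ENNReal.ofReal_le_ofReal (h n)
  exact ⟨hmem.toLp, hmem.coeFn_toLp⟩

theorem tendsto_weyl (j : Fin d) (f : L2 d) : Tendsto (fun ε => weyl j ε f) (𝓝[≠] 0) (𝓝 f) := by
  refine tendsto_L2_of_dominated (fun ε => coeFn_weyl j ε f) (ae_eq_refl _)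
    (G := fun x => 2 * ‖f x‖) ((Lp.memLp _).norm.const_mul 2)
    (Eventually.of_forall fun ε => Eventually.of_forall fun x => ?_)
    (Eventually.of_forall fun x => ?_)
  · refine (norm_sub_le _ _).trans ?_
    rw [norm_mul, Complex.norm_exp_ofReal_mul_I, one_mul, two_mul]
  · have : Continuous fun ε : ℝ => Complex.exp ((ε * x j : ℝ) * Complex.I) * f x := by fun_prop
    have := this.tendsto 0
    simp only [zero_mul, Complex.ofReal_zero, Complex.exp_zero, one_mul] at this
    exact this.mono_left nhdsWithin_le_nhds

/-- `k = -i ∂_j f`. -/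
def IsMom (j : Fin d) (f k : L2 d) : Prop :=
  (𝓕 k : L2 d) =ᵐ[volume] fun ξ => ((2 * Real.pi * ξ j : ℝ) : ℂ) * (𝓕 f : L2 d) ξ

theorem IsMom.isPos {j : Fin d} {f k : L2 d} (h : IsMom j f k) :
    IsPos j (𝓕 f) (((2 * Real.pi)⁻¹ : ℂ) • (𝓕 k : L2 d)) := by
  filter_upwards [Lp.coeFn_smul ((2 * Real.pi)⁻¹ : ℂ) (𝓕 k : L2 d), h] with ξ h1 h2
  rw [h1, Pi.smul_apply, h2, smul_eq_mul]
  have : (Real.pi : ℂ) ≠ 0 := by exact_mod_cast Real.pi_ne_zero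
  push_cast
  field_simp

/-- On the Fourier side a translation is a plane wave, so this is the convergence of the position
quotients with step 2πε. -/
theorem IsMom.tendsto_trans {j : Fin d} {f k : L2 d} (h : IsMom j f k) :
    Tendsto (fun ε : ℝ => ((ε : ℂ) * Complex.I)⁻¹ • (trans (-ε • basisVec j) f - f)) (𝓝[≠] 0)
      (𝓝 k) := by
  have hpi : (Real.pi : ℂ) ≠ 0 := by exact_mod_cast Real.pi_ne_zero
  have h1 : Tendsto (fun ε : ℝ => 2 * Real.pi * ε) (𝓝[≠] 0) (𝓝[≠] 0) := by
    refine tendsto_nhdsWithin_iff.2 ⟨?_, ?_⟩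
    · have : Continuous fun ε : ℝ => 2 * Real.pi * ε := by fun_prop
      have := this.tendsto 0
      rw [mul_zero] at this
      exact this.mono_left nhdsWithin_le_nhds
    · filter_upwards [self_mem_nhdsWithin] with ε hε
      exact mul_ne_zero (by have := Real.pi_ne_zero; positivity) hε
  have h2 := (h.isPos.tendsto_posQuot.comp h1).const_smul (2 * Real.pi : ℂ)
  have h3 := ((Lp.fourierTransformₗᵢ (Sp d) ℂ).symm.continuous.tendsto _).comp h2
  have e : (Lp.fourierTransformₗᵢ (Sp d) ℂ).symm
      ((2 * Real.pi : ℂ) • ((2 * Real.pi)⁻¹ : ℂ) • (𝓕 k : L2 d)) = k := by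
    rw [smul_smul, mul_inv_cancel₀ (mul_ne_zero two_ne_zero hpi), one_smul]
    exact (Lp.fourierTransformₗᵢ (Sp d) ℂ).symm_apply_apply k
  rw [e] at h3
  refine h3.congr fun ε => ?_
  simp only [Function.comp]
  rw [LinearIsometryEquiv.symm_apply_eq]
  change _ = (𝓕 (((ε : ℂ) * Complex.I)⁻¹ • (trans (-ε • basisVec j) f - f)) : L2 d)
  rw [posQuot_apply, FourierTransform.fourier_smul, sub_eq_add_neg, sub_eq_add_neg,
    FourierTransform.fourier_add, FourierTransform.fourier_neg, fourier_trans, weyl, smul_smul]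
  congr 1
  · push_cast
    field_simp
  · congr 4
    rw [smul_smul]
    congr 1
    ring

theorem IsMom.tendsto_trans_mul {j : Fin d} {f k : L2 d} (h : IsMom j f k) (c : ℝ) :
    Tendsto (fun ε : ℝ => ((ε : ℂ) * Complex.I)⁻¹ • (trans (-(c * ε) • basisVec j) f - f)) (𝓝[≠] 0)
      (𝓝 ((c : ℂ) • k)) := by
  rcases eq_or_ne c 0 with rfl | hc
  · have : trans (0 : Sp d) f = f := by
      refine Lp.ext ?_
      filter_upwards [coeFn_trans 0 f] with x hx
      rw [hx, sub_zero]
    simp [this]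
  have h1 : Tendsto (fun ε : ℝ => c * ε) (𝓝[≠] 0) (𝓝[≠] 0) := by
    refine tendsto_nhdsWithin_iff.2 ⟨?_, ?_⟩
    · have : Continuous fun ε : ℝ => c * ε := by fun_prop
      have := this.tendsto 0
      rw [mul_zero] at this
      exact this.mono_left nhdsWithin_le_nhds
    · filter_upwards [self_mem_nhdsWithin] with ε hε
      exact mul_ne_zero hc hε
  refine ((h.tendsto_trans.comp h1).const_smul (c : ℂ)).congr fun ε => ?_
  simp only [Function.comp]
  rw [smul_smul]
  congr 1
  have : (c : ℂ) ≠ 0 := by exact_mod_cast hc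
  push_cast
  rw [mul_assoc, mul_inv, ← mul_assoc, mul_inv_cancel₀ this, one_mul]

/-- Galilean covariance read as a conjugation: moving e^{iεx_j} through e^{iaΔ} costs a translation
by -2aε and a phase of order ε². The first order in ε is the operator x_j + 2aP_j. -/
theorem weyl_freeProp (j : Fin d) (ε a : ℝ) (f : L2 d) :
    weyl j ε (freeProp a f) = freeProp a (Complex.exp ((a * ε ^ 2 : ℝ) * Complex.I) •
      weyl j ε (trans (-(2 * a * ε) • basisVec j) f)) := by
  have h := freeProp_phaseMul_planeWave (-a) (ε • basisVec j) (freeProp a f)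
  have h2 := congrArg (freeProp a) h
  rw [freeProp_freeProp, add_neg_cancel, freeProp_zero, freeProp_freeProp, neg_add_cancel,
    freeProp_zero, norm_smul, norm_basisVec, mul_one, Real.norm_eq_abs, sq_abs, smul_smul] at h2
  rw [weyl, h2]
  congr 3
  · push_cast; ring_nf
  · congr 3; ring

/-- `x_j e^{iaΔ} = e^{iaΔ} (x_j + 2 a P_j)`. -/
theorem IsPos.freeProp {j : Fin d} {f X k : L2 d} (hX : IsPos j f X) (hk : IsMom j f k) (a : ℝ) :
    IsPos j (freeProp a f) (freeProp a (X + ((2 * a : ℝ) : ℂ) • k)) := by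
  refine isPos_of_tendsto_posQuot ?_
  -- After conjugation the quotient splits into the translation quotient, tending to 2aP_j f, the
  -- position quotient, tending to x_j f, and the phase error, which is O(ε).
  have hmain : Tendsto (fun ε : ℝ => Complex.exp ((a * ε ^ 2 : ℝ) * Complex.I) •
      (weyl j ε (((ε : ℂ) * Complex.I)⁻¹ • (trans (-(2 * a * ε) • basisVec j) f - f)) +
        posQuot j ε f) + ((Complex.exp ((a * ε ^ 2 : ℝ) * Complex.I) - 1) *
        ((ε : ℂ) * Complex.I)⁻¹) • f) (𝓝[≠] 0)
      (𝓝 ((1 : ℂ) • (((2 * a : ℝ) : ℂ) • k + X) + (0 : ℂ) • f)) := by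
    refine Tendsto.add (Tendsto.smul ?_ (Tendsto.add ?_ hX.tendsto_posQuot)) (Tendsto.smul_const ?_ _)
    · have : Continuous fun ε : ℝ => Complex.exp ((a * ε ^ 2 : ℝ) * Complex.I) := by fun_prop
      have := this.tendsto 0
      simp only [ne_eq, OfNat.ofNat_ne_zero, not_false_eq_true, zero_pow, mul_zero,
        Complex.ofReal_zero, zero_mul, Complex.exp_zero] at this
      exact this.mono_left nhdsWithin_le_nhds
    · have t1 := hk.tendsto_trans_mul (2 * a)
      have t2 := tendsto_weyl j (((2 * a : ℝ) : ℂ) • k)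
      rw [tendsto_iff_norm_sub_tendsto_zero] at t1 t2 ⊢
      have t3 := t1.add t2
      rw [add_zero] at t3
      refine squeeze_zero (fun _ => norm_nonneg _) (fun ε => ?_) t3
      refine (norm_sub_le_norm_sub_add_norm_sub _ (weyl j ε (((2 * a : ℝ) : ℂ) • k)) _).trans ?_
      rw [← map_sub, LinearIsometry.norm_map]
    · have t : Tendsto (fun ε : ℝ => |a * ε|) (𝓝[≠] 0) (𝓝 0) := by
        have : Continuous fun ε : ℝ => |a * ε| := by fun_prop
        have := this.tendsto 0
        simp only [mul_zero, abs_zero] at this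
        exact this.mono_left nhdsWithin_le_nhds
      refine squeeze_zero_norm (fun ε => ?_) t
      rcases eq_or_ne ε 0 with rfl | hε
      · simp
      rw [norm_mul, norm_inv, norm_mul, Complex.norm_I, mul_one, Complex.norm_real,
        Real.norm_eq_abs, ← div_eq_mul_inv, div_le_iff₀ (abs_pos.2 hε), ← abs_mul]
      refine (norm_cexp_mul_I_sub_one_le _).trans (le_of_eq ?_)
      congr 1
      ring
  rw [one_smul, zero_smul, add_zero, add_comm] at hmain
  have h2 := ((freePropIsom a).continuous.tendsto _).comp hmain
  simp only [freePropIsom_apply] at h2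
  refine h2.congr fun ε => ?_
  simp only [Function.comp, freePropIsom_apply]
  conv_rhs => rw [posQuot_apply, weyl_freeProp, ← freeProp_sub, ← freeProp_smul]
  congr 1
  rw [posQuot_apply, map_smul, map_sub]
  module

/-! ### Galilean covariance of the averaged nonlinearity -/

theorem powerNL_smul {p : ℕ} {M : ℝ} {f : L2 d} (hf : ∀ᵐ x, ‖f x‖ ≤ M) {c : ℂ} (hc : ‖c‖ = 1) :
    powerNL p (c • f) = c • powerNL p f := by
  have hcf : ∀ᵐ x, ‖(c • f : L2 d) x‖ ≤ M := by
    filter_upwards [Lp.coeFn_smul c f, hf] with x h1 h2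
    rw [h1, Pi.smul_apply, norm_smul, hc, one_mul]
    exact h2
  refine Lp.ext ?_
  filter_upwards [coeFn_powerNL (p := p) hcf, coeFn_powerNL (p := p) hf, Lp.coeFn_smul c f,
    Lp.coeFn_smul c (powerNL p f)] with x h1 h2 h3 h4
  rw [h1, h4, Pi.smul_apply, h2, h3, Pi.smul_apply, norm_smul, hc, one_mul, smul_eq_mul,
    smul_eq_mul]
  ring

theorem ae_norm_phaseMul_le {M : ℝ} {f : L2 d} (hf : ∀ᵐ x, ‖f x‖ ≤ M) (m : C(Sp d, ℝ)) :
    ∀ᵐ x, ‖phaseMul m f x‖ ≤ M := by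
  filter_upwards [coeFn_phaseMul m f, hf] with x h1 h2
  rwa [h1, norm_mul, Complex.norm_exp_ofReal_mul_I, one_mul]

theorem ae_norm_trans_le {M : ℝ} {f : L2 d} (hf : ∀ᵐ x, ‖f x‖ ≤ M) (h : Sp d) :
    ∀ᵐ x, ‖trans h f x‖ ≤ M := by
  filter_upwards [coeFn_trans h f, ae_comp_sub h hf] with x h1 h2
  rwa [h1]

theorem powerNL_phaseMul {p : ℕ} {M : ℝ} {f : L2 d} (hf : ∀ᵐ x, ‖f x‖ ≤ M) (m : C(Sp d, ℝ)) :
    powerNL p (phaseMul m f) = phaseMul m (powerNL p f) := by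
  refine Lp.ext ?_
  filter_upwards [coeFn_powerNL (p := p) (ae_norm_phaseMul_le hf m), coeFn_powerNL (p := p) hf,
    coeFn_phaseMul m f, coeFn_phaseMul m (powerNL p f)] with x h1 h2 h3 h4
  rw [h1, h4, h2, h3, norm_mul, Complex.norm_exp_ofReal_mul_I, one_mul]
  ring

theorem powerNL_trans {p : ℕ} {M : ℝ} {f : L2 d} (hf : ∀ᵐ x, ‖f x‖ ≤ M) (h : Sp d) :
    powerNL p (trans h f) = trans h (powerNL p f) := by
  refine Lp.ext ?_
  filter_upwards [coeFn_powerNL (p := p) (ae_norm_trans_le hf h),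
    ae_comp_sub h (coeFn_powerNL (p := p) hf), coeFn_trans h f,
    coeFn_trans h (powerNL p f)] with x h1 h2 h3 h4
  rw [h1, h4, h2, h3]

theorem UnifBdd.phaseMul_planeWave {I : Set ℝ} {M : ℝ} {f : L2 d} (hf : UnifBdd I M f)
    (h : Sp d) : UnifBdd I M (phaseMul (planeWave h) f) := fun σ hσ => by
  rw [freeProp_phaseMul_planeWave]
  filter_upwards [Lp.coeFn_smul (Complex.exp ((-(σ * ‖h‖ ^ 2) : ℝ) * Complex.I))
    (phaseMul (planeWave h) (trans ((2 * σ) • h) (freeProp σ f))),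
    ae_norm_phaseMul_le (ae_norm_trans_le (hf σ hσ) ((2 * σ) • h)) (planeWave h)] with x h1 h2
  rw [h1, Pi.smul_apply, norm_smul, Complex.norm_exp_ofReal_mul_I, one_mul]
  exact h2

/-- The propagator turns a plane wave into a constant phase, the plane wave and a translation. All
three commute with |·|^p ·, and propagating back undoes the extra factors. -/
theorem nlIntegrand_phaseMul_planeWave {p : ℕ} {I : Set ℝ} {M : ℝ} {f : L2 d}
    (hf : UnifBdd I M f) (h : Sp d) {σ : ℝ} (hσ : σ ∈ I) :
    nlIntegrand p (phaseMul (planeWave h) f) σ = phaseMul (planeWave h) (nlIntegrand p f σ) := by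
  have hb := hf σ hσ
  rw [nlIntegrand, freeProp_phaseMul_planeWave,
    powerNL_smul (ae_norm_phaseMul_le (ae_norm_trans_le hb _) _) (Complex.norm_exp_ofReal_mul_I _),
    powerNL_phaseMul (ae_norm_trans_le hb _), powerNL_trans hb]
  have e : powerNL p (freeProp σ f) = freeProp σ (nlIntegrand p f σ) := by
    rw [nlIntegrand, freeProp_freeProp, add_neg_cancel, freeProp_zero]
  rw [e, ← freeProp_phaseMul_planeWave, freeProp_freeProp, neg_add_cancel, freeProp_zero]

theorem windowNL_phaseMul_planeWave {p : ℕ} {α β M : ℝ} (hαβ : α ≤ β) {f : L2 d}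
    (hf : UnifBdd (Icc α β) M f) (h : Sp d) :
    windowNL p α β (phaseMul (planeWave h) f) = phaseMul (planeWave h) (windowNL p α β f) := by
  have h1 := (phaseMul (planeWave h)).toContinuousLinearMap.intervalIntegral_comp_comm
    (hf.intervalIntegrable_nlIntegrand hαβ p)
  refine Eq.trans ?_ h1
  refine intervalIntegral.integral_congr fun σ hσ => ?_
  rw [uIcc_of_le hαβ] at hσ
  exact nlIntegrand_phaseMul_planeWave hf h hσ

/-- By covariance, e^{iεx_j}N(f) - N(f) is the difference of N at two functions with the same sup
bound, so the Lipschitz bound applies, uniformly in ε. -/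
theorem norm_posQuot_windowNL_le {p : ℕ} {α β M : ℝ} (hαβ : α ≤ β) {f : L2 d}
    (hf : UnifBdd (Icc α β) M f) (j : Fin d) (ε : ℝ) :
    ‖posQuot j ε (windowNL p α β f)‖ ≤
      (β - α) * ((p + 1) * M ^ p) * ‖posQuot j ε f‖ := by
  rw [posQuot_apply, posQuot_apply, norm_smul, norm_smul, weyl,
    ← windowNL_phaseMul_planeWave hαβ hf, mul_left_comm]
  gcongr
  exact norm_windowNL_sub_le hαβ (hf.phaseMul_planeWave _) hf

/-- The group law and the substitution σ ↦ σ - a. This is why the virial identity is proved for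
arbitrary windows. -/
theorem freeProp_windowNL {p : ℕ} {α β M : ℝ} (hαβ : α ≤ β) {f : L2 d}
    (hf : UnifBdd (Icc α β) M f) (a : ℝ) :
    freeProp a (windowNL p α β f) = windowNL p (α - a) (β - a) (freeProp a f) := by
  have h1 := (freePropIsom a).toContinuousLinearMap.intervalIntegral_comp_comm
    (hf.intervalIntegrable_nlIntegrand hαβ p)
  rw [windowNL, windowNL, ← freePropIsom_apply]
  refine h1.symm.trans ?_
  rw [← intervalIntegral.integral_comp_sub_right]
  refine intervalIntegral.integral_congr fun σ _ => ?_
  change freePropIsom a (nlIntegrand p f σ) = nlIntegrand p (freeProp a f) (σ - a)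
  rw [freePropIsom_apply, nlIntegrand, nlIntegrand, freeProp_freeProp, freeProp_freeProp]
  congr 1
  · ring
  · congr 2; ring

theorem UnifBdd.freeProp {M : ℝ} {f : L2 d} (hf : UnifBdd univ M f) (a : ℝ) :
    UnifBdd univ M (freeProp a f) := fun σ _ => by
  rw [freeProp_freeProp]
  exact hf _ (mem_univ _)

/-! ### The Laplacian and the kinetic energy -/

/-- `g = Δ f`. -/
def IsLap (f g : L2 d) : Prop :=
  (𝓕 g : L2 d) =ᵐ[volume] fun ξ => ((-(2 * Real.pi * ‖ξ‖) ^ 2 : ℝ) : ℂ) * (𝓕 f : L2 d) ξ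

theorem memLp_mul_of_sobolevNorm {s : ℝ} {f : L2 d} (hf : sobolevNorm s f < ∞)
    {m : Sp d → ℝ} (hm : Continuous m) (hle : ∀ ξ, |m ξ| ≤ sobolevWeight s ξ) :
    MemLp (fun ξ => (m ξ : ℂ) * (𝓕 f : L2 d) ξ) 2 volume := by
  have hw : MemLp (fun ξ => (sobolevWeight s ξ : ℂ) * (𝓕 f : L2 d) ξ) 2 volume :=
    ⟨(Complex.continuous_ofReal.comp (continuous_sobolevWeight s)).aestronglyMeasurable.mul
      (Lp.memLp _).1, hf⟩
  refine hw.of_le ((Complex.continuous_ofReal.comp hm).aestronglyMeasurable.mul (Lp.memLp _).1)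
    (Eventually.of_forall fun ξ => ?_)
  rw [norm_mul, norm_mul, Complex.norm_real, Complex.norm_real, Real.norm_eq_abs, Real.norm_eq_abs,
    abs_of_pos (sobolevWeight_pos s ξ)]
  gcongr
  exact hle ξ

theorem sq_le_sobolevWeight {s : ℝ} (hs : 2 ≤ s) (ξ : Sp d) :
    1 + (2 * Real.pi * ‖ξ‖) ^ 2 ≤ sobolevWeight s ξ := by
  have h1 : 1 ≤ 1 + (2 * Real.pi * ‖ξ‖) ^ 2 := by nlinarith [sq_nonneg (2 * Real.pi * ‖ξ‖)]
  calc _ = (1 + (2 * Real.pi * ‖ξ‖) ^ 2) ^ (1 : ℝ) := (Real.rpow_one _).symm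
    _ ≤ _ := Real.rpow_le_rpow_of_exponent_le h1 (by linarith)

theorem isLap_laplacian {s : ℝ} (hs : 2 ≤ s) {f : L2 d} (hf : sobolevNorm s f < ∞) :
    IsLap f (laplacian f) := by
  have h : MemLp (fun ξ => ((-(2 * Real.pi * ‖ξ‖) ^ 2 : ℝ) : ℂ) * (𝓕 f : L2 d) ξ) 2 volume :=
    memLp_mul_of_sobolevNorm hf (by fun_prop) fun ξ => by
      rw [abs_neg, abs_of_nonneg (by positivity)]
      linarith [sq_le_sobolevWeight hs ξ]
  rw [laplacian, fourierMultiplier, dif_pos h, IsLap, FourierTransform.fourier_fourierInv_eq]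
  exact h.coeFn_toLp

theorem exists_isMom {s : ℝ} (hs : 2 ≤ s) {f : L2 d} (hf : sobolevNorm s f < ∞) (j : Fin d) :
    ∃ k : L2 d, IsMom j f k := by
  have h : MemLp (fun ξ : Sp d => ((2 * Real.pi * ξ j : ℝ) : ℂ) * (𝓕 f : L2 d) ξ) 2 volume :=
    memLp_mul_of_sobolevNorm hf (by fun_prop) fun ξ => by
      refine le_trans ?_ (sq_le_sobolevWeight hs ξ)
      have h1 : |ξ j| ≤ ‖ξ‖ := by
        simpa using PiLp.norm_apply_le ξ j
      rw [abs_mul, abs_of_pos (by positivity : 0 < 2 * Real.pi)]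
      have : 2 * Real.pi * |ξ j| ≤ 2 * Real.pi * ‖ξ‖ := by gcongr
      nlinarith [sq_nonneg (2 * Real.pi * ‖ξ‖ - 1)]
  refine ⟨𝓕⁻ (h.toLp : L2 d), ?_⟩
  rw [IsMom, FourierTransform.fourier_fourierInv_eq]
  exact h.coeFn_toLp

theorem IsMom.freeProp {j : Fin d} {f k : L2 d} (h : IsMom j f k) (a : ℝ) :
    IsMom j (freeProp a f) (freeProp a k) := by
  rw [IsMom, fourier_freeProp, fourier_freeProp]
  filter_upwards [coeFn_phaseMul (schrodingerPhase a) (𝓕 f : L2 d),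
    coeFn_phaseMul (schrodingerPhase a) (𝓕 k : L2 d), h] with ξ h1 h2 h3
  rw [h1, h2, h3]
  ring

theorem IsLap.freeProp {f g : L2 d} (h : IsLap f g) (a : ℝ) :
    IsLap (freeProp a f) (freeProp a g) := by
  rw [IsLap, fourier_freeProp, fourier_freeProp]
  filter_upwards [coeFn_phaseMul (schrodingerPhase a) (𝓕 f : L2 d),
    coeFn_phaseMul (schrodingerPhase a) (𝓕 g : L2 d), h] with ξ h1 h2 h3
  rw [h1, h2, h3]
  ring

theorem kinetic_eq_sum {f : L2 d} {P : Fin d → L2 d} (hP : ∀ j, IsMom j f (P j)) :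
    kinetic f = ∑ j, ‖P j‖ ^ 2 := by
  have e : ∀ j, ‖P j‖ ^ 2 = ∫ ξ, ‖(𝓕 (P j) : L2 d) ξ‖ ^ 2 := fun j => by
    rw [← norm_sq_eq_integral, Lp.norm_fourier_eq]
  simp_rw [e]
  rw [← integral_finsetSum _ fun j _ => integrable_norm_sq _]
  refine integral_congr_ae ?_
  filter_upwards [ae_all_iff.2 hP] with ξ hξ
  simp_rw [hξ, norm_mul, mul_pow, ← Finset.sum_mul, Complex.norm_real, norm_mul, mul_pow,
    ← Finset.mul_sum, EuclideanSpace.norm_sq_eq]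
  simp

theorem kinetic_nonneg (f : L2 d) : 0 ≤ kinetic f :=
  integral_nonneg fun _ => by positivity

theorem inner_ofReal_mul_left (r : ℝ) (z w : ℂ) : inner ℂ ((r : ℂ) * z) w = r * inner ℂ z w := by
  rw [← smul_eq_mul, inner_smul_left, Complex.conj_ofReal]

theorem inner_ofReal_mul_right (r : ℝ) (z w : ℂ) : inner ℂ z ((r : ℂ) * w) = r * inner ℂ z w := by
  rw [← smul_eq_mul, inner_smul_right]

theorem inner_isLap_symm {f g Lf Lg : L2 d} (hf : IsLap f Lf) (hg : IsLap g Lg) :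
    inner ℂ f Lg = inner ℂ Lf g := by
  rw [← Lp.inner_fourier_eq f, ← Lp.inner_fourier_eq Lf, L2.inner_def, L2.inner_def]
  refine integral_congr_ae ?_
  filter_upwards [hf, hg] with ξ h1 h2
  rw [h1, h2, inner_ofReal_mul_left, inner_ofReal_mul_right]

theorem kinetic_eq_neg_inner {f Lf : L2 d} (hf : IsLap f Lf) :
    kinetic f = -(inner ℂ f Lf).re := by
  rw [← Lp.inner_fourier_eq, L2.inner_def, kinetic]
  have h := integral_re (𝕜 := ℂ) (L2.integrable_inner (𝕜 := ℂ) (𝓕 f : L2 d) (𝓕 Lf : L2 d))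
  refine Eq.trans ?_ (congrArg Neg.neg h)
  rw [← integral_neg]
  refine integral_congr_ae ?_
  filter_upwards [hf] with ξ h1
  rw [h1, ← smul_eq_mul (((-(2 * Real.pi * ‖ξ‖) ^ 2 : ℝ) : ℂ)), inner_smul_right,
    inner_self_eq_norm_sq_to_K]
  have : (((-(2 * Real.pi * ‖ξ‖) ^ 2 : ℝ) : ℂ) * ((‖(𝓕 f : L2 d) ξ‖ : ℝ) : ℂ) ^ 2) =
    ((-(2 * Real.pi * ‖ξ‖) ^ 2 * ‖(𝓕 f : L2 d) ξ‖ ^ 2 : ℝ) : ℂ) := by push_cast; ring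
  refine Eq.trans ?_ (congrArg (fun z : ℂ => -z.re) this).symm
  simp only [Complex.ofReal_re]
  ring

theorem im_inner_isMom {j : Fin d} {f k : L2 d} (h : IsMom j f k) : (inner ℂ k f).im = 0 := by
  rw [← Lp.inner_fourier_eq, L2.inner_def]
  have e : ∫ ξ, inner ℂ ((𝓕 k : L2 d) ξ) ((𝓕 f : L2 d) ξ) =
      ((∫ ξ : Sp d, 2 * Real.pi * ξ j * ‖(𝓕 f : L2 d) ξ‖ ^ 2 : ℝ) : ℂ) := by
    rw [← integral_complex_ofReal]
    refine integral_congr_ae ?_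
    filter_upwards [h] with ξ hξ
    rw [hξ, ← smul_eq_mul, inner_smul_left, Complex.conj_ofReal, inner_self_eq_norm_sq_to_K]
    push_cast
    rfl
  rw [e, Complex.ofReal_im]

/-! ### Commutation of plane waves with the Laplacian -/

theorem fourier_weyl (j : Fin d) (ε : ℝ) (f : L2 d) : (𝓕 (weyl j ε f) : L2 d) =ᵐ[volume]
    fun ξ => (𝓕 f : L2 d) (ξ - (2 * Real.pi)⁻¹ • ε • basisVec j) := by
  rw [weyl, fourier_phaseMul_planeWave]
  exact coeFn_trans _ _

/-- In frequency the plane wave is a shift, and |ξ - h|² - |ξ|² is affine in ξ, so the commutator is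
exact and of first order. -/
theorem inner_weyl_commutator {j : Fin d} {f Lf k : L2 d} (hL : IsLap f Lf) (hk : IsMom j f k)
    (ε : ℝ) : inner ℂ f (weyl j ε Lf) - inner ℂ Lf (weyl j ε f) =
      2 * ε * inner ℂ k (weyl j ε f) - ε ^ 2 * inner ℂ f (weyl j ε f) := by
  simp only [← Lp.inner_fourier_eq _ (weyl j ε _), L2.inner_def]
  have hi : ∀ a b : L2 d, Integrable fun x => inner ℂ (a x) (b x) :=
    fun a b => L2.integrable_inner (𝕜 := ℂ) a b
  rw [← integral_sub (hi _ _) (hi _ _), ← integral_const_mul, ← integral_const_mul,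
    ← integral_sub ((hi _ _).const_mul _) ((hi _ _).const_mul _)]
  refine integral_congr_ae ?_
  filter_upwards [fourier_weyl j ε f, fourier_weyl j ε Lf, hL, hk,
    ae_comp_sub ((2 * Real.pi)⁻¹ • ε • basisVec j) hL] with ξ h1 h2 h3 h4 h5
  rw [h1, h2, h3, h4, h5]
  simp only [inner_ofReal_mul_left, inner_ofReal_mul_right]
  have e : (-(2 * Real.pi * ‖ξ - (2 * Real.pi)⁻¹ • ε • basisVec j‖) ^ 2 : ℝ) =
      -(2 * Real.pi * ‖ξ‖) ^ 2 + 2 * ε * (2 * Real.pi * ξ j) - ε ^ 2 := by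
    rw [mul_pow, norm_sub_sq_real, smul_smul, inner_smul_right, norm_smul, norm_basisVec,
      real_inner_comm, inner_basisVec, mul_one, Real.norm_eq_abs, sq_abs]
    have := Real.pi_ne_zero
    field_simp
    ring
  rw [e]
  push_cast
  ring

/-- The commutator of the difference quotients with the free flow. -/
theorem re_inner_posQuot_laplacian {j : Fin d} {f Lf k : L2 d} (hL : IsLap f Lf)
    (hk : IsMom j f k) {ε : ℝ} (hε : ε ≠ 0) :
    2 * (inner ℂ (posQuot j ε f) (posQuot j ε ((-Complex.I) • Lf))).re =
      -4 * (inner ℂ k (posQuot j ε f)).re + 2 * ε * (inner ℂ f (posQuot j ε f)).re := by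
  have hε' : (ε : ℂ) ≠ 0 := by exact_mod_cast hε
  have hc := inner_weyl_commutator hL hk ε
  have him := im_inner_isMom hk
  have hff : (inner ℂ f f).im = 0 := inner_self_im (𝕜 := ℂ) f
  have hLr : (inner ℂ f Lf).im = 0 := by
    have h := inner_isLap_symm hL hL
    have h2 := inner_conj_symm (𝕜 := ℂ) f Lf
    rw [← h] at h2
    have := congrArg Complex.im h2
    rw [Complex.conj_im] at this
    linarith
  have e1 : weyl j ε f = f + ((ε : ℂ) * Complex.I) • posQuot j ε f := by
    rw [← weyl_sub_eq j hε]; abel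
  have e2 : weyl j ε Lf = Lf + ((ε : ℂ) * Complex.I) • posQuot j ε Lf := by
    rw [← weyl_sub_eq j hε]; abel
  -- Unitarity and the commutator identity are both expanded in the quotients. In the difference of
  -- their imaginary parts the terms of first order cancel, and what remains is ε² times the claim.
  have hw : inner ℂ (weyl j ε f) (weyl j ε Lf) = inner ℂ f Lf := LinearIsometry.inner_map_map _ _ _
  have hsym := inner_isLap_symm hL hL
  rw [e1, e2] at hw
  rw [e2, e1] at hc
  simp only [inner_add_left, inner_add_right, inner_smul_left, inner_smul_right, map_mul,
    Complex.conj_ofReal, Complex.conj_I] at hw hc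
  rw [map_smul, inner_smul_right]
  have hw' := congrArg Complex.im hw
  have hc' := congrArg Complex.im hc
  have hqL : (inner ℂ (posQuot j ε f) Lf).re = (inner ℂ Lf (posQuot j ε f)).re := by
    rw [← inner_conj_symm, Complex.conj_re]
  have hε2 : ε ^ 2 ≠ 0 := pow_ne_zero 2 hε
  rw [← hsym] at hc'
  simp only [Complex.add_im, Complex.sub_im, Complex.mul_im, Complex.mul_re, Complex.neg_re,
    Complex.neg_im, Complex.I_re, Complex.I_im, Complex.ofReal_re, Complex.ofReal_im,
    Complex.add_re, sq, Complex.re_ofNat, Complex.im_ofNat, him, hff, hLr, hqL] at hw' hc' ⊢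
  have hz : ε ^ 2 * (2 * (inner ℂ (posQuot j ε f) (posQuot j ε Lf)).im -
      (-4 * (inner ℂ k (posQuot j ε f)).re + 2 * ε * (inner ℂ f (posQuot j ε f)).re)) = 0 := by
    linear_combination 2 * hw' - 2 * hc'
  have := (mul_eq_zero.1 hz).resolve_left hε2
  linarith

/-! ### Regularity of solutions -/

theorem sobolevNorm_le_add (s : ℝ) (f g : L2 d) :
    sobolevNorm s f ≤ sobolevNorm s (f - g) + sobolevNorm s g := by
  have hm : ∀ h : L2 d, AEStronglyMeasurable
      (fun ξ => ((sobolevWeight s ξ : ℝ) : ℂ) * (𝓕 h : L2 d) ξ) volume := fun h =>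
    (Complex.continuous_ofReal.comp (continuous_sobolevWeight s)).aestronglyMeasurable.mul
      (Lp.memLp _).1
  have e : (fun ξ => ((sobolevWeight s ξ : ℝ) : ℂ) * (𝓕 f : L2 d) ξ) =ᵐ[volume]
      (fun ξ => ((sobolevWeight s ξ : ℝ) : ℂ) * (𝓕 (f - g) : L2 d) ξ) +
        fun ξ => ((sobolevWeight s ξ : ℝ) : ℂ) * (𝓕 g : L2 d) ξ := by
    have h0 : (𝓕 f : L2 d) = 𝓕 (f - g) + 𝓕 g := by
      rw [← FourierTransform.fourier_add, sub_add_cancel]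
    filter_upwards [Lp.coeFn_add (𝓕 (f - g) : L2 d) (𝓕 g : L2 d)] with ξ hξ
    rw [h0, hξ, Pi.add_apply, Pi.add_apply, mul_add]
  calc sobolevNorm s f = eLpNorm (fun ξ => ((sobolevWeight s ξ : ℝ) : ℂ) * (𝓕 f : L2 d) ξ) 2
        volume := rfl
    _ ≤ _ := by
      rw [eLpNorm_congr_ae e]
      exact eLpNorm_add_le (hm _) (hm _) (by norm_num)

theorem IsLap.norm_le {s : ℝ} (hs : 2 ≤ s) {f g : L2 d} (h : IsLap f g)
    (hf : sobolevNorm s f < ∞) : ‖g‖ ≤ (sobolevNorm s f).toReal := by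
  rw [← Lp.norm_fourier_eq, Lp.norm_def]
  refine ENNReal.toReal_mono hf.ne (eLpNorm_mono_ae ?_)
  filter_upwards [h] with ξ hξ
  rw [hξ, norm_mul, norm_mul, Complex.norm_real, Complex.norm_real]
  gcongr
  have := sq_le_sobolevWeight hs ξ
  rw [sobolevWeight] at this
  rw [norm_neg, Real.norm_of_nonneg (by positivity), Real.norm_of_nonneg (by positivity)]
  linarith

theorem IsLap.sub {f g Lf Lg : L2 d} (hf : IsLap f Lf) (hg : IsLap g Lg) :
    IsLap (f - g) (Lf - Lg) := by
  have e : ∀ a b : L2 d, (𝓕 (a - b) : L2 d) = 𝓕 a - 𝓕 b := fun a b => by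
    rw [sub_eq_add_neg, FourierTransform.fourier_add, FourierTransform.fourier_neg, sub_eq_add_neg]
  rw [IsLap, e, e]
  filter_upwards [Lp.coeFn_sub (𝓕 f : L2 d) (𝓕 g : L2 d),
    Lp.coeFn_sub (𝓕 Lf : L2 d) (𝓕 Lg : L2 d), hf, hg] with ξ h1 h2 h3 h4
  rw [h1, h2, Pi.sub_apply, Pi.sub_apply, h3, h4, mul_sub]

theorem real_smul_L2 (r : ℝ) (f : L2 d) : r • f = (r : ℂ) • f := by
  refine Lp.ext ?_
  filter_upwards [Lp.coeFn_smul r f, Lp.coeFn_smul (r : ℂ) f] with x h1 h2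
  rw [h1, h2, Pi.smul_apply, Pi.smul_apply, Complex.real_smul, smul_eq_mul]

section Solution

variable {k : ℕ} {s T : ℝ} {u : ℝ → L2 d}

/-- Continuity in Hˢ bounds the norm near each time, compactness makes the bound uniform, and the
Sobolev embedding turns it into a sup bound for all propagation times. -/
theorem IsSolution.exists_unifBdd (hu : IsSolution (-1) (2 * k) s (Icc T 0) u)
    (hs : (d : ℝ) / 2 < s) : ∃ M, 0 ≤ M ∧ ∀ t ∈ Icc T 0, UnifBdd univ M (u t) := by
  have hR : ∃ R : ℝ≥0∞, R ≠ ∞ ∧ ∀ t ∈ Icc T 0, t ∈ Icc T 0 → sobolevNorm s (u t) ≤ R := by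
    refine IsCompact.induction_on (isCompact_Icc (a := T) (b := 0))
      (p := fun S => ∃ R : ℝ≥0∞, R ≠ ∞ ∧ ∀ t ∈ S, t ∈ Icc T 0 → sobolevNorm s (u t) ≤ R)
      ⟨0, by simp, by simp⟩ ?_ ?_ ?_
    · rintro S S' hSS ⟨R, hR, h⟩
      exact ⟨R, hR, fun t ht => h t (hSS ht)⟩
    · rintro S S' ⟨R, hR, h⟩ ⟨R', hR', h'⟩
      refine ⟨max R R', (max_lt hR.lt_top hR'.lt_top).ne, ?_⟩
      rintro t (ht | ht) hJ
      · exact (h t ht hJ).trans (le_max_left _ _)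
      · exact (h' t ht hJ).trans (le_max_right _ _)
    · intro t₀ h₀
      have h1 : ∀ᶠ t in 𝓝[Icc T 0] t₀, sobolevNorm s (u t - u t₀) < 1 :=
        (hu.continuous_sobolev t₀ h₀).eventually_lt_const (by norm_num)
      refine ⟨_, h1, 1 + sobolevNorm s (u t₀), ?_, fun t ht _ => ?_⟩
      · exact (ENNReal.add_lt_top.2 ⟨by norm_num, hu.mem_sobolev t₀ h₀⟩).ne
      · exact (sobolevNorm_le_add s (u t) (u t₀)).trans (add_le_add (le_of_lt ht) le_rfl)
  obtain ⟨R, hR, h⟩ := hR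
  obtain ⟨M, hM, hb⟩ := exists_unifBdd_of_sobolevNorm_le (d := d) hs hR
  exact ⟨M, hM, fun t ht => hb (u t) (h t ht ht)⟩

/-- The time derivative prescribed by the equation. -/
def velocity (p : ℕ) (f : L2 d) : L2 d :=
  (-Complex.I) • laplacian f + Complex.I • nonlinearity p f

theorem IsSolution.hasDerivWithinAt {p : ℕ} {J : Set ℝ} (hu : IsSolution (-1) p s J u) {t : ℝ}
    (ht : t ∈ J) : HasDerivWithinAt u (velocity p (u t)) J t := by
  obtain ⟨u', h1, h2⟩ := hu.equation t ht
  convert h1 using 1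
  have h3 : u' = (-Complex.I) • (Complex.I • u') := by
    rw [smul_smul, neg_mul, Complex.I_mul_I, neg_neg, one_smul]
  have h4 : Complex.I • u' = laplacian (u t) - nonlinearity p (u t) := by
    rw [← sub_eq_zero, ← h2]
    push_cast
    module
  rw [h3, h4, velocity]
  module

theorem IsSolution.continuousOn_laplacian {p : ℕ} {J : Set ℝ} (hu : IsSolution (-1) p s J u)
    (hs : 2 ≤ s) : ContinuousOn (fun t => laplacian (u t)) J := by
  intro t₀ h₀
  rw [ContinuousWithinAt, tendsto_iff_norm_sub_tendsto_zero]
  have hlim := hu.continuous_sobolev t₀ h₀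
  have h1 : Tendsto (fun t => (sobolevNorm s (u t - u t₀)).toReal) (𝓝[J] t₀) (𝓝 0) := by
    have := (ENNReal.tendsto_toReal (ENNReal.zero_ne_top)).comp hlim
    rwa [ENNReal.toReal_zero] at this
  refine squeeze_zero' (Eventually.of_forall fun _ => norm_nonneg _) ?_ h1
  filter_upwards [self_mem_nhdsWithin, hlim.eventually_lt_const (ENNReal.zero_lt_top)]
    with t ht hfin
  exact ((isLap_laplacian hs (hu.mem_sobolev t ht)).sub
    (isLap_laplacian hs (hu.mem_sobolev t₀ h₀))).norm_le hs hfin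

theorem IsSolution.continuousOn {p : ℕ} {J : Set ℝ} (hu : IsSolution (-1) p s J u) :
    ContinuousOn u J := fun _ ht => (hu.hasDerivWithinAt ht).continuousWithinAt

theorem IsSolution.continuousOn_velocity {p : ℕ} {J : Set ℝ} (hu : IsSolution (-1) p s J u)
    (hs : 2 ≤ s) {M : ℝ} (hM : ∀ t ∈ J, UnifBdd univ M (u t)) :
    ContinuousOn (fun t => velocity p (u t)) J := by
  have hL := (hu.continuousOn_laplacian hs).const_smul (-Complex.I)
  suffices hN : ContinuousOn (fun t => nonlinearity p (u t)) J from
    hL.add (hN.const_smul Complex.I)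
  intro t₀ h₀
  rw [ContinuousWithinAt, tendsto_iff_norm_sub_tendsto_zero]
  have h1 : Tendsto (fun t => (1 - 0) * ((p + 1) * M ^ p) * ‖u t - u t₀‖) (𝓝[J] t₀) (𝓝 0) := by
    have := (tendsto_iff_norm_sub_tendsto_zero.1 (hu.continuousOn t₀ h₀)).const_mul
      ((1 - 0) * ((p + 1) * M ^ p))
    rwa [mul_zero] at this
  refine squeeze_zero' (Eventually.of_forall fun _ => norm_nonneg _) ?_ h1
  filter_upwards [self_mem_nhdsWithin] with t ht
  exact norm_windowNL_sub_le zero_le_one ((hM t ht).mono (subset_univ _) le_rfl)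
    ((hM t₀ h₀).mono (subset_univ _) le_rfl)

/-! ### Conservation of energy -/

/-- By symmetry of the Laplacian, K(u(t)) - K(u(t₀)) = -Re⟨u(t) - u(t₀), Δu(t) + Δu(t₀)⟩. Hence L²
differentiability of u together with L² continuity of Δu is enough. -/
theorem hasDerivWithinAt_kinetic (hs : 2 ≤ s) {p : ℕ} {J : Set ℝ}
    (hu : IsSolution (-1) p s J u) {t₀ : ℝ} (h₀ : t₀ ∈ J) :
    HasDerivWithinAt (fun t => kinetic (u t))
      (-2 * (inner ℂ (velocity p (u t₀)) (laplacian (u t₀))).re) J t₀ := by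
  rw [hasDerivWithinAt_iff_tendsto_slope]
  have hL : ∀ t ∈ J, IsLap (u t) (laplacian (u t)) := fun t ht =>
    isLap_laplacian hs (hu.mem_sobolev t ht)
  have h1 := (hasDerivWithinAt_iff_tendsto_slope.1 (hu.hasDerivWithinAt h₀))
  have h2 : Tendsto (fun t => laplacian (u t) + laplacian (u t₀)) (𝓝[J \ {t₀}] t₀)
      (𝓝 (laplacian (u t₀) + laplacian (u t₀))) :=
    ((hu.continuousOn_laplacian hs t₀ h₀).mono_left
      (nhdsWithin_mono _ sdiff_subset)).add_const _
  have h3 := ((Complex.continuous_re.tendsto _).comp (h1.inner h2 (𝕜 := ℂ))).neg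
  have e : -(inner ℂ (velocity p (u t₀)) (laplacian (u t₀) + laplacian (u t₀))).re =
      -2 * (inner ℂ (velocity p (u t₀)) (laplacian (u t₀))).re := by
    rw [inner_add_right, Complex.add_re]; ring
  rw [e] at h3
  refine h3.congr' ?_
  filter_upwards [self_mem_nhdsWithin] with t ht
  simp only [Function.comp]
  rw [slope_def_field, slope_def_module, kinetic_eq_neg_inner (hL t ht.1),
    kinetic_eq_neg_inner (hL t₀ h₀), real_smul_L2, inner_smul_left, Complex.conj_ofReal,
    Complex.re_ofReal_mul, inner_add_right, inner_sub_left, inner_sub_left, Complex.add_re,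
    Complex.sub_re, Complex.sub_re]
  have s1 : (inner ℂ (u t) (laplacian (u t₀))).re = (inner ℂ (u t₀) (laplacian (u t))).re := by
    rw [inner_isLap_symm (hL t ht.1) (hL t₀ h₀), ← inner_conj_symm, Complex.conj_re]
  rw [s1]
  ring

theorem hasDerivWithinAt_potential {J : Set ℝ}
    (hu : IsSolution (-1) (2 * k) s J u) {M : ℝ} (hM : ∀ t ∈ J, UnifBdd univ M (u t))
    {t₀ : ℝ} (h₀ : t₀ ∈ J) :
    HasDerivWithinAt (fun t => potential (2 * k) (u t))
      ((2 * k + 2) * (inner ℂ (nonlinearity (2 * k) (u t₀)) (velocity (2 * k) (u t₀))).re)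
      J t₀ := by
  obtain ⟨C, hC, hT⟩ := exists_windowPot_taylor_bound (d := d) k (M := M) zero_le_one
  rw [hasDerivWithinAt_iff_tendsto_slope]
  have h1 := (hasDerivWithinAt_iff_tendsto_slope.1 (hu.hasDerivWithinAt h₀))
  have t1 := ((Complex.continuous_re.tendsto _).comp
    ((tendsto_const_nhds (x := nonlinearity (2 * k) (u t₀))).inner h1 (𝕜 := ℂ))).const_mul
    (2 * (k : ℝ) + 2)
  have hc : Tendsto (fun t => ‖u t - u t₀‖) (𝓝[J \ {t₀}] t₀) (𝓝 0) :=
    tendsto_iff_norm_sub_tendsto_zero.1 ((hu.continuousOn t₀ h₀).mono_left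
      (nhdsWithin_mono _ sdiff_subset))
  have t2 := (hc.const_mul C).mul h1.norm
  rw [mul_zero, zero_mul] at t2
  refine tendsto_of_tendsto_of_dist t1 (squeeze_zero' (Eventually.of_forall fun _ => dist_nonneg)
      ?_ t2)
  filter_upwards [self_mem_nhdsWithin] with t ht
  have hne : t - t₀ ≠ 0 := sub_ne_zero.2 ht.2
  have b := hT (u t₀) (u t) ((hM t₀ h₀).mono (subset_univ _) le_rfl)
    ((hM t ht.1).mono (subset_univ _) le_rfl)
  simp only [Function.comp]
  rw [dist_comm, Real.dist_eq, slope_def_field, slope_def_module, real_smul_L2,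
    inner_smul_right, Complex.re_ofReal_mul, potential_eq, potential_eq, nonlinearity_eq, norm_smul,
    Complex.norm_real, norm_inv, Real.norm_eq_abs]
  rw [show (windowPot (2 * k) 0 1 (u t) - windowPot (2 * k) 0 1 (u t₀)) / (t - t₀) -
      (2 * k + 2) * ((t - t₀)⁻¹ * (inner ℂ (windowNL (2 * k) 0 1 (u t₀)) (u t - u t₀)).re) =
      (t - t₀)⁻¹ * (windowPot (2 * k) 0 1 (u t) - windowPot (2 * k) 0 1 (u t₀) -
      (2 * k + 2) * (inner ℂ (windowNL (2 * k) 0 1 (u t₀)) (u t - u t₀)).re) by ring, abs_mul,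
      abs_inv]
  calc _ ≤ |t - t₀|⁻¹ * (C * ‖u t - u t₀‖ ^ 2) := by gcongr
    _ = _ := by ring

theorem energy_eq (k : ℕ) (f : L2 d) : energy (-1) (2 * k) f =
    1 / 2 * kinetic f + 1 / (2 * k + 2) * potential (2 * k) f := by
  rw [energy]
  push_cast
  ring

/-- Hamiltonian structure: u_t = i(N - Δu), and dE/dt = Re⟨u_t, N - Δu⟩ = 0. -/
theorem IsSolution.energy_eq_energy (hs : 2 ≤ s)
    (hu : IsSolution (-1) (2 * k) s (Icc T 0) u) {M : ℝ}
    (hM : ∀ t ∈ Icc T 0, UnifBdd univ M (u t)) {t : ℝ} (ht : t ∈ Icc T 0) :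
    energy (-1) (2 * k) (u t) = energy (-1) (2 * k) (u 0) := by
  have hd : ∀ t ∈ Icc T 0, HasDerivWithinAt (fun t => energy (-1) (2 * k) (u t)) 0 (Icc T 0) t := by
    intro t ht
    simp_rw [energy_eq]
    have h1 := ((hasDerivWithinAt_kinetic hs hu ht).const_mul (1 / 2)).add
      ((hasDerivWithinAt_potential hu hM ht).const_mul (1 / (2 * (k : ℝ) + 2)))
    refine h1.congr_deriv ?_
    set N := nonlinearity (2 * k) (u t)
    set Lu := laplacian (u t)
    have hv : velocity (2 * k) (u t) = Complex.I • (N - Lu) := by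
      rw [velocity]; module
    have h2 : (inner ℂ (velocity (2 * k) (u t)) (N - Lu)).re = 0 := by
      rw [hv, inner_smul_left, inner_self_eq_norm_sq_to_K, Complex.conj_I]
      simp [← Complex.ofReal_pow]
    rw [inner_sub_right, Complex.sub_re] at h2
    have h3 : (inner ℂ N (velocity (2 * k) (u t))).re =
        (inner ℂ (velocity (2 * k) (u t)) N).re := by
      rw [← inner_conj_symm, Complex.conj_re]
    rw [h3]
    have : (2 * (k : ℝ) + 2) ≠ 0 := by positivity
    field_simp
    linarith
  have hconst := constant_of_derivWithin_zero (fun t ht => (hd t ht).differentiableWithinAt)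
    (f := fun t => energy (-1) (2 * k) (u t)) (a := T) (b := 0)
    (fun t ht => by
      refine (hd t (Ico_subset_Icc_self ht)).derivWithin ?_
      exact uniqueDiffOn_Icc (lt_of_le_of_lt ht.1 ht.2) t (Ico_subset_Icc_self ht))
  exact (hconst t ht).trans (hconst 0 ⟨ht.1.trans ht.2, le_rfl⟩).symm

end Solution

section Solution

variable {k : ℕ} {s T : ℝ} {u : ℝ → L2 d}

/-! ### Evolution of the position observables -/

/-- `freeProp a` followed by a difference quotient of `x_j`. -/
def quotProp (j : Fin d) (ε a : ℝ) : L2 d →L[ℂ] L2 d :=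
  posQuot j ε ∘L (freePropIsom a).toContinuousLinearMap

theorem quotProp_apply (j : Fin d) (ε a : ℝ) (f : L2 d) :
    quotProp j ε a f = posQuot j ε (freeProp a f) := by
  rw [← freePropIsom_apply]; rfl

theorem hasDerivWithinAt_norm_sq_clm (Q : L2 d →L[ℂ] L2 d) {J : Set ℝ} {v : ℝ → L2 d} {v' : L2 d}
    {t : ℝ} (hv : HasDerivWithinAt v v' J t) :
    HasDerivWithinAt (fun t => ‖Q (v t)‖ ^ 2) (2 * (inner ℂ (Q (v t)) (Q v')).re) J t := by
  have h1 : HasDerivWithinAt (fun t => Q (v t)) (Q v') J t :=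
    (Q.restrictScalars ℝ).hasFDerivAt.comp_hasDerivWithinAt t hv
  have h2 := Complex.reCLM.hasFDerivAt.comp_hasDerivWithinAt t (h1.inner ℂ h1)
  have e : (fun t => ‖Q (v t)‖ ^ 2) = Complex.reCLM ∘ fun t => inner ℂ (Q (v t)) (Q (v t)) := by
    funext t
    rw [Function.comp, inner_self_eq_norm_sq_to_K, Complex.reCLM_apply]
    simp [← Complex.ofReal_pow]
  rw [e]
  refine h2.congr_deriv ?_
  rw [Complex.reCLM_apply, Complex.add_re, ← inner_conj_symm (Q v'), Complex.conj_re, two_mul]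

theorem re_inner_quotProp_velocity {p : ℕ} (hs : 2 ≤ s) {M : ℝ} {f P : L2 d}
    (hf : sobolevNorm s f < ∞) (hM : UnifBdd univ M f) {j : Fin d} (hP : IsMom j f P) {ε : ℝ}
    (hε : ε ≠ 0) (a : ℝ) :
    2 * (inner ℂ (quotProp j ε a f) (quotProp j ε a (velocity p f))).re =
      -4 * (inner ℂ (freeProp a P) (quotProp j ε a f)).re +
      2 * ε * (inner ℂ (freeProp a f) (quotProp j ε a f)).re -
      2 * (inner ℂ (quotProp j ε a f)
        (posQuot j ε (windowNL p (-a) (1 - a) (freeProp a f)))).im := by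
  have h1 := re_inner_posQuot_laplacian ((isLap_laplacian hs hf).freeProp a) (hP.freeProp a) hε
  have h2 := freeProp_windowNL (p := p) zero_le_one (hM.mono (subset_univ _) le_rfl) a
  rw [zero_sub] at h2
  rw [quotProp_apply, quotProp_apply, velocity, freeProp_add, freeProp_smul, freeProp_smul, map_add,
    inner_add_right, Complex.add_re, mul_add, h1, nonlinearity_eq, h2, map_smul _ Complex.I,
    inner_smul_right, Complex.I_mul_re]
  ring

theorem continuousOn_re_inner_quotProp_velocity {p : ℕ} {J : Set ℝ} (hu : IsSolution (-1) p s J u)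
    (hs : 2 ≤ s) {M : ℝ} (hM : ∀ t ∈ J, UnifBdd univ M (u t)) (j : Fin d) (ε a : ℝ) :
    ContinuousOn (fun t => 2 * (inner ℂ (quotProp j ε a (u t))
      (quotProp j ε a (velocity p (u t)))).re) J := by
  refine continuousOn_const.mul (Complex.continuous_re.comp_continuousOn ?_)
  exact ((quotProp j ε a).continuous.comp_continuousOn hu.continuousOn).inner (𝕜 := ℂ)
    ((quotProp j ε a).continuous.comp_continuousOn (hu.continuousOn_velocity hs hM))

theorem potential_nonneg (p : ℕ) (f : L2 d) : 0 ≤ potential p f :=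
  intervalIntegral.integral_nonneg zero_le_one fun _ _ => integral_nonneg fun _ => by positivity

theorem kinetic_le_two_energy (k : ℕ) (f : L2 d) : kinetic f ≤ 2 * energy (-1) (2 * k) f := by
  rw [energy_eq]
  have : 0 ≤ 1 / (2 * (k : ℝ) + 2) * potential (2 * k) f :=
    mul_nonneg (by positivity) (potential_nonneg _ _)
  linarith

theorem IsMom.norm_sq_le_kinetic (hs : 2 ≤ s) {f P : L2 d} (hf : sobolevNorm s f < ∞) {j : Fin d}
    (hP : IsMom j f P) : ‖P‖ ^ 2 ≤ kinetic f := by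
  choose Q hQ using exists_isMom hs hf
  have e : ‖P‖ = ‖Q j‖ := by
    have : (𝓕 P : L2 d) = 𝓕 (Q j) := Lp.ext (hP.trans (hQ j).symm)
    rw [← Lp.norm_fourier_eq P, this, Lp.norm_fourier_eq]
  rw [kinetic_eq_sum hQ, e]
  exact Finset.single_le_sum (f := fun j => ‖Q j‖ ^ 2) (fun _ _ => by positivity)
    (Finset.mem_univ j)

/-- The bound is uniform in ε ≤ 1. It feeds Gronwall when finiteness of the variance is propagated,
and dominates when ε → 0 in the virial identity. -/
theorem abs_re_inner_quotProp_velocity_le {p : ℕ} (hs : 2 ≤ s) {M : ℝ} {f P : L2 d}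
    (hf : sobolevNorm s f < ∞) (hM : UnifBdd univ M f) {j : Fin d} (hP : IsMom j f P) {ε : ℝ}
    (hε : 0 < ε) (hε1 : ε ≤ 1) (a : ℝ) :
    |2 * (inner ℂ (quotProp j ε a f) (quotProp j ε a (velocity p f))).re| ≤
      4 * ‖P‖ * ‖quotProp j ε a f‖ + 2 * ‖f‖ * ‖quotProp j ε a f‖ +
        2 * ((p + 1) * M ^ p) * ‖quotProp j ε a f‖ ^ 2 := by
  rw [re_inner_quotProp_velocity hs hf hM hP hε.ne' a]
  set Q := quotProp j ε a f
  have b1 : |(inner ℂ (freeProp a P) Q).re| ≤ ‖P‖ * ‖Q‖ :=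
    (Complex.abs_re_le_norm _).trans ((norm_inner_le_norm _ _).trans_eq (by rw [norm_freeProp]))
  have b2 : |(inner ℂ (freeProp a f) Q).re| ≤ ‖f‖ * ‖Q‖ :=
    (Complex.abs_re_le_norm _).trans ((norm_inner_le_norm _ _).trans_eq (by rw [norm_freeProp]))
  have b3 : |(inner ℂ Q (posQuot j ε (windowNL p (-a) (1 - a) (freeProp a f)))).im| ≤
      ((p + 1) * M ^ p) * ‖Q‖ ^ 2 := by
    refine (Complex.abs_im_le_norm _).trans ((norm_inner_le_norm _ _).trans ?_)
    have := norm_posQuot_windowNL_le (p := p) (show -a ≤ 1 - a by linarith)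
      ((hM.freeProp a).mono (subset_univ _) le_rfl) j ε
    rw [← quotProp_apply, show (1 - a - -a) = 1 by ring, one_mul] at this
    calc _ ≤ ‖Q‖ * ((p + 1) * M ^ p * ‖Q‖) := by gcongr
      _ = _ := by ring
  have b4 : |ε * (inner ℂ (freeProp a f) Q).re| ≤ ‖f‖ * ‖Q‖ := by
    rw [abs_mul, abs_of_pos hε]
    calc _ ≤ 1 * (‖f‖ * ‖Q‖) := by gcongr
      _ = _ := one_mul _
  rw [abs_le] at *
  constructor <;> linarith [b1.1, b1.2, b3.1, b3.2, b4.1, b4.2]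

theorem IsPos.tendsto_stepSeq {j : Fin d} {f X : L2 d} (h : IsPos j f X) :
    Tendsto (fun n => posQuot j (stepSeq n) f) atTop (𝓝 X) :=
  h.tendsto_posQuot.comp GabitovTuritsyn.tendsto_stepSeq

theorem exists_isPos_norm_le {j : Fin d} {f : L2 d} {C : ℝ}
    (h : ∀ n, ‖posQuot j (stepSeq n) f‖ ≤ C) : ∃ X : L2 d, IsPos j f X ∧ ‖X‖ ≤ C := by
  obtain ⟨X, hX⟩ := exists_isPos_of_bounded h
  exact ⟨X, hX, le_of_tendsto hX.tendsto_stepSeq.norm (Eventually.of_forall h)⟩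

/-- The variance of a solution with finite initial variance stays finite. -/
theorem IsSolution.exists_isPos (hs : 2 ≤ s) (hu : IsSolution (-1) (2 * k) s (Icc T 0) u)
    {M : ℝ} (hM0 : 0 ≤ M) (hM : ∀ t ∈ Icc T 0, UnifBdd univ M (u t)) {j : Fin d} {X₀ : L2 d}
    (hX₀ : IsPos j (u 0) X₀) :
    ∃ C, ∀ t ∈ Icc T 0, ∃ X : L2 d, IsPos j (u t) X ∧ ‖X‖ ≤ C := by
  obtain ⟨m, hm⟩ := isCompact_Icc.exists_bound_of_continuousOn hu.continuousOn
  set κ := √(2 * energy (-1) (2 * k) (u 0)) with hκ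
  set L := ((2 * k : ℕ) + 1) * M ^ (2 * k) with hL
  have hL0 : 0 ≤ L := by positivity
  -- With q the norm of the quotient, the derivative of q² is at most (4κ + 2m)q + 2Lq² ≤ (2κ + m)²
  -- + (1 + 2L)q². Gronwall is applied in the reversed time x = -t, starting from t = 0.
  refine ⟨√(gronwallBound (‖X₀‖ ^ 2) (1 + 2 * L) ((2 * κ + m) ^ 2) (-T)), fun t ht =>
    exists_isPos_norm_le fun n => ?_⟩
  have hneg : ∀ x ∈ Icc 0 (-T), -x ∈ Icc T 0 := fun x hx => ⟨by linarith [hx.2], by linarith [hx.1]⟩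
  have hder : ∀ t ∈ Icc T 0, HasDerivWithinAt (fun t => ‖quotProp j (stepSeq n) 0 (u t)‖ ^ 2)
      (2 * (inner ℂ (quotProp j (stepSeq n) 0 (u t))
        (quotProp j (stepSeq n) 0 (velocity (2 * k) (u t)))).re) (Icc T 0) t := fun t ht =>
    hasDerivWithinAt_norm_sq_clm _ (hu.hasDerivWithinAt ht)
  have hder' : ∀ x ∈ Icc 0 (-T), HasDerivWithinAt
      (fun x => ‖quotProp j (stepSeq n) 0 (u (-x))‖ ^ 2)
      (2 * (inner ℂ (quotProp j (stepSeq n) 0 (u (-x)))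
        (quotProp j (stepSeq n) 0 (velocity (2 * k) (u (-x))))).re * (-1)) (Icc 0 (-T)) x :=
    fun x hx => (hder (-x) (hneg x hx)).comp x (hasDerivAt_neg x).hasDerivWithinAt hneg
  have hq0 : ∀ f : L2 d, quotProp j (stepSeq n) 0 f = posQuot j (stepSeq n) f := fun f => by
    rw [quotProp_apply, freeProp_zero]
  have h := norm_le_gronwallBound_of_norm_deriv_right_le (δ := ‖X₀‖ ^ 2) (K := 1 + 2 * L)
    (ε := (2 * κ + m) ^ 2) (fun x hx => (hder' x hx).continuousWithinAt)
    (fun x hx => (hder' x (Ico_subset_Icc_self hx)).mono_of_mem_nhdsWithin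
      (Icc_mem_nhdsGE_of_mem hx)) ?_ ?_ (-t) ⟨by linarith [ht.2], by linarith [ht.1]⟩
  · rw [neg_neg, Real.norm_of_nonneg (by positivity), sub_zero, hq0] at h
    refine Real.le_sqrt_of_sq_le (h.trans ?_)
    exact gronwallBound_mono (by positivity) (by positivity) (by positivity) (by linarith [ht.1])
  · rw [Real.norm_of_nonneg (by positivity), neg_zero, hq0]
    gcongr
    exact hX₀.norm_posQuot_le _
  · intro x hx
    have hx' := hneg x (Ico_subset_Icc_self hx)
    have hfin := hu.mem_sobolev _ hx'
    obtain ⟨P, hP⟩ := exists_isMom hs hfin j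
    have b := abs_re_inner_quotProp_velocity_le (p := 2 * k) hs hfin (hM _ hx') hP (stepSeq_pos n)
      (stepSeq_le_one n) 0
    have hPκ : ‖P‖ ≤ κ := by
      refine Real.le_sqrt_of_sq_le ((hP.norm_sq_le_kinetic hs hfin).trans ?_)
      rw [← hu.energy_eq_energy hs hM hx']
      exact kinetic_le_two_energy _ _
    have hmu := hm _ hx'
    rw [mul_neg_one, norm_neg, Real.norm_eq_abs, Real.norm_of_nonneg (by positivity)]
    rw [← hL] at b
    set q := ‖quotProp j (stepSeq n) 0 (u (-x))‖
    have hq : 0 ≤ q := norm_nonneg _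
    have b1 : ‖P‖ * q ≤ κ * q := by gcongr
    have b2 : ‖u (-x)‖ * q ≤ m * q := by gcongr
    nlinarith [sq_nonneg (2 * κ + m - q)]

/-- The fundamental theorem of calculus holds for the bounded quotients, and ε → 0 under the
integral by dominated convergence. The chosen `X`, `Y`, `P` carry no assumed regularity in time, so
the integrand gets its measurability as a limit and the identity is stated in integrated form. -/
theorem IsSolution.norm_sq_isPos_sub (hs : 2 ≤ s) (hu : IsSolution (-1) (2 * k) s (Icc T 0) u)
    {M : ℝ} (hM0 : 0 ≤ M) (hM : ∀ t ∈ Icc T 0, UnifBdd univ M (u t)) {j : Fin d} (a : ℝ)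
    {P X Y : ℝ → L2 d} {C : ℝ} (hP : ∀ t ∈ Icc T 0, IsMom j (u t) (P t))
    (hX : ∀ t ∈ Icc T 0, IsPos j (freeProp a (u t)) (X t)) (hXC : ∀ t ∈ Icc T 0, ‖X t‖ ≤ C)
    (hY : ∀ t ∈ Icc T 0, IsPos j (windowNL (2 * k) (-a) (1 - a) (freeProp a (u t))) (Y t))
    {t₁ : ℝ} (ht₁ : t₁ ∈ Icc T 0) :
    IntervalIntegrable (fun t => 4 * (inner ℂ (freeProp a (P t)) (X t)).re +
      2 * (inner ℂ (X t) (Y t)).im) volume t₁ 0 ∧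
    ‖X t₁‖ ^ 2 - ‖X 0‖ ^ 2 = ∫ t in t₁..0, (4 * (inner ℂ (freeProp a (P t)) (X t)).re +
      2 * (inner ℂ (X t) (Y t)).im) := by
  obtain ⟨m, hm⟩ := isCompact_Icc.exists_bound_of_continuousOn hu.continuousOn
  set κ := √(2 * energy (-1) (2 * k) (u 0)) with hκ
  set L := ((2 * k : ℕ) + 1) * M ^ (2 * k) with hL
  have hL0 : 0 ≤ L := by positivity
  have hsub : Icc t₁ 0 ⊆ Icc T 0 := Icc_subset_Icc_left ht₁.1
  have h0 : (0 : ℝ) ∈ Icc T 0 := ⟨ht₁.1.trans ht₁.2, le_rfl⟩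
  set g := fun t => 4 * (inner ℂ (freeProp a (P t)) (X t)).re + 2 * (inner ℂ (X t) (Y t)).im
  set D := fun n t => -(2 * (inner ℂ (quotProp j (stepSeq n) a (u t))
        (quotProp j (stepSeq n) a (velocity (2 * k) (u t)))).re) with hD
  have hDcont : ∀ n, ContinuousOn (D n) (Icc t₁ 0) := fun n =>
    ((continuousOn_re_inner_quotProp_velocity hu hs hM j (stepSeq n) a).mono hsub).neg
  have hDmeas : ∀ n, AEStronglyMeasurable (D n) (volume.restrict (Ioc t₁ 0)) := fun n =>
    ((hDcont n).mono Ioc_subset_Icc_self).aestronglyMeasurable measurableSet_Ioc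
  have hQX : ∀ t ∈ Icc T 0, Tendsto (fun n => quotProp j (stepSeq n) a (u t)) atTop (𝓝 (X t)) :=
    fun t ht => by
      simp_rw [quotProp_apply]
      exact (hX t ht).tendsto_stepSeq
  have hlim : ∀ t ∈ Icc T 0, Tendsto (fun n => D n t) atTop (𝓝 (g t)) := by
    intro t ht
    have t1 := (Complex.continuous_re.tendsto _).comp
      ((tendsto_const_nhds (x := freeProp a (P t))).inner (hQX t ht) (𝕜 := ℂ))
    have t2 := (Complex.continuous_re.tendsto _).comp
      ((tendsto_const_nhds (x := freeProp a (u t))).inner (hQX t ht) (𝕜 := ℂ))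
    have t3 := (Complex.continuous_im.tendsto _).comp
      ((hQX t ht).inner (hY t ht).tendsto_stepSeq (𝕜 := ℂ))
    have t4 : Tendsto stepSeq atTop (𝓝 0) := tendsto_stepSeq.mono_right nhdsWithin_le_nhds
    have t5 := ((t1.const_mul 4).add (t3.const_mul 2)).sub ((t4.const_mul 2).mul t2)
    rw [mul_zero, zero_mul, sub_zero] at t5
    refine t5.congr fun n => ?_
    simp only [hD, Function.comp]
    rw [re_inner_quotProp_velocity hs (hu.mem_sobolev t ht) (hM t ht) (hP t ht)
      (stepSeq_pos n).ne' a]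
    ring
  set B := 4 * κ * C + 2 * m * C + 2 * L * C ^ 2
  have hbound : ∀ n, ∀ t ∈ Icc T 0, ‖D n t‖ ≤ B := by
    intro n t ht
    have hfin := hu.mem_sobolev _ ht
    have b := abs_re_inner_quotProp_velocity_le (p := 2 * k) hs hfin (hM _ ht) (hP t ht)
      (stepSeq_pos n) (stepSeq_le_one n) a
    have hPκ : ‖P t‖ ≤ κ := by
      refine Real.le_sqrt_of_sq_le (((hP t ht).norm_sq_le_kinetic hs hfin).trans ?_)
      rw [← hu.energy_eq_energy hs hM ht]
      exact kinetic_le_two_energy _ _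
    have hmu := hm _ ht
    have hq : ‖quotProp j (stepSeq n) a (u t)‖ ≤ C := by
      rw [quotProp_apply]
      exact ((hX t ht).norm_posQuot_le _).trans (hXC t ht)
    rw [← hL] at b
    rw [hD, norm_neg, Real.norm_eq_abs]
    refine b.trans ?_
    have hm0 : 0 ≤ m := (norm_nonneg _).trans hmu
    change _ ≤ 4 * κ * C + 2 * m * C + 2 * L * C ^ 2
    gcongr
  have hDint : ∀ n, ∫ t in t₁..0, D n t = ‖quotProp j (stepSeq n) a (u t₁)‖ ^ 2 -
      ‖quotProp j (stepSeq n) a (u 0)‖ ^ 2 := by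
    intro n
    have hder : ∀ t ∈ Icc T 0, HasDerivWithinAt (fun t => -‖quotProp j (stepSeq n) a (u t)‖ ^ 2)
        (D n t) (Icc T 0) t := fun t ht =>
      (hasDerivWithinAt_norm_sq_clm _ (hu.hasDerivWithinAt ht)).neg
    rw [intervalIntegral.integral_eq_sub_of_hasDerivAt_of_le ht₁.2
      (fun t ht => ((hder t (hsub ht)).mono hsub).continuousWithinAt)
      (fun t ht => ((hder t (hsub (Ioo_subset_Icc_self ht))).mono hsub).hasDerivAt
        (Icc_mem_nhds ht.1 ht.2)) ((hDcont n).intervalIntegrable_of_Icc ht₁.2)]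
    ring
  have hB : Integrable (fun _ : ℝ => B) (volume.restrict (Ioc t₁ 0)) := integrable_const _
  have haeb : ∀ n, ∀ᵐ t ∂(volume.restrict (Ioc t₁ 0)), ‖D n t‖ ≤ B := fun n =>
    (ae_restrict_iff' measurableSet_Ioc).2 (Eventually.of_forall fun t ht =>
      hbound n t (hsub (Ioc_subset_Icc_self ht)))
  have hael : ∀ᵐ t ∂(volume.restrict (Ioc t₁ 0)), Tendsto (fun n => D n t) atTop (𝓝 (g t)) :=
    (ae_restrict_iff' measurableSet_Ioc).2 (Eventually.of_forall fun t ht =>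
      hlim t (hsub (Ioc_subset_Icc_self ht)))
  refine ⟨(intervalIntegrable_iff_integrableOn_Ioc_of_le ht₁.2).2
    ⟨aestronglyMeasurable_of_tendsto_ae atTop hDmeas hael,
      hasFiniteIntegral_of_dominated_convergence hB.2 haeb hael⟩, ?_⟩
  have hL1 := tendsto_integral_of_dominated_convergence (fun _ => B) hDmeas hB haeb hael
  have hL2 : Tendsto (fun n => ∫ t in t₁..0, D n t) atTop (𝓝 (‖X t₁‖ ^ 2 - ‖X 0‖ ^ 2)) := by
    simp_rw [hDint]
    exact ((hQX t₁ ht₁).norm.pow 2).sub ((hQX 0 h0).norm.pow 2)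
  simp_rw [intervalIntegral.integral_of_le ht₁.2] at hL2 ⊢
  exact tendsto_nhds_unique hL2 hL1

end Solution

/-! ### The virial identities -/

section Solution

variable {k n : ℕ} {s T : ℝ} {u : ℝ → L2 d}

theorem integral_shift_mul_lpMass (p : ℕ) (f : L2 d) (a : ℝ) :
    ∫ σ in (-a)..(1 - a), σ * lpMass p (freeProp σ (freeProp a f)) =
      ∫ σ in (0 : ℝ)..1, (σ - a) * lpMass p (freeProp σ f) := by
  have h := intervalIntegral.integral_comp_sub_right (a := 0) (b := 1)
    (fun σ => σ * lpMass p (freeProp σ (freeProp a f))) a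
  rw [zero_sub] at h
  rw [← h]
  refine intervalIntegral.integral_congr fun σ _ => ?_
  simp only [freeProp_freeProp, sub_add_cancel]

theorem sum_im_inner_windowNL_freeProp (hn : d * k = n + 3) {M : ℝ} (hM : 0 ≤ M) {f : L2 d}
    (hf : UnifBdd univ M f) (a : ℝ) {X Y : Fin d → L2 d}
    (hX : ∀ j, IsPos j (freeProp a f) (X j))
    (hY : ∀ j, IsPos j (windowNL (2 * k) (-a) (1 - a) (freeProp a f)) (Y j)) :
    (2 * k + 2) * ∑ j, (inner ℂ (X j) (Y j)).im =
      -4 * (1 - a) ^ 2 * lpMass (2 * k) (freeProp 1 f) + 4 * a ^ 2 * lpMass (2 * k) f -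
        4 * (n + 1) * ∫ σ in (0 : ℝ)..1, (σ - a) * lpMass (2 * k) (freeProp σ f) := by
  rw [sum_im_inner_windowNL hn hM (hf.freeProp a) (by linarith) hX hY, integral_shift_mul_lpMass,
    freeProp_freeProp, freeProp_freeProp, sub_add_cancel, neg_add_cancel, freeProp_zero]
  ring

/-- The derivative of `t ↦ -‖x e^{iaΔ} u(t)‖²` along the flow, in terms of `A = Re ⟨-i∇u, x u⟩`. -/
def virialDensity (k n : ℕ) (a A : ℝ) (f : L2 d) : ℝ :=
  4 * A + 8 * a * kinetic f + 2 / (2 * k + 2) *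
    (-4 * (1 - a) ^ 2 * lpMass (2 * k) (freeProp 1 f) + 4 * a ^ 2 * lpMass (2 * k) f -
        4 * (n + 1) * ∫ σ in (0 : ℝ)..1, (σ - a) * lpMass (2 * k) (freeProp σ f))

theorem IsSolution.sum_norm_sq_sub (hn : d * k = n + 3) (hs : 2 ≤ s)
    (hu : IsSolution (-1) (2 * k) s (Icc T 0) u)
    {M : ℝ} (hM0 : 0 ≤ M) (hM : ∀ t ∈ Icc T 0, UnifBdd univ M (u t))
    {P X : Fin d → ℝ → L2 d} {C : ℝ} (hP : ∀ j, ∀ t ∈ Icc T 0, IsMom j (u t) (P j t))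
    (hPC : ∀ j, ∀ t ∈ Icc T 0, ‖P j t‖ ≤ C)
    (hX : ∀ j, ∀ t ∈ Icc T 0, IsPos j (u t) (X j t)) (hXC : ∀ j, ∀ t ∈ Icc T 0, ‖X j t‖ ≤ C)
    (a : ℝ) {t₁ : ℝ} (ht₁ : t₁ ∈ Icc T 0) :
    ∃ G : ℝ → ℝ, IntervalIntegrable G volume t₁ 0 ∧
      ∑ j, ‖X j t₁ + ((2 * a : ℝ) : ℂ) • P j t₁‖ ^ 2 -
        ∑ j, ‖X j 0 + ((2 * a : ℝ) : ℂ) • P j 0‖ ^ 2 = ∫ t in t₁..0, G t ∧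
      ∀ t ∈ Icc T 0,
        G t = virialDensity k n a (∑ j, (inner ℂ (P j t) (X j t)).re) (u t) := by
  set Z : Fin d → ℝ → L2 d := fun j t => X j t + ((2 * a : ℝ) : ℂ) • P j t with hZ
  have hXa : ∀ j, ∀ t ∈ Icc T 0, IsPos j (freeProp a (u t)) (freeProp a (Z j t)) :=
    fun j t ht => (hX j t ht).freeProp (hP j t ht) a
  have hXaC : ∀ j, ∀ t ∈ Icc T 0, ‖freeProp a (Z j t)‖ ≤ C + |2 * a| * C := fun j t ht => by
    rw [norm_freeProp]
    refine (norm_add_le _ _).trans (add_le_add (hXC j t ht) ?_)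
    rw [norm_smul, Complex.norm_real, Real.norm_eq_abs]
    exact mul_le_mul_of_nonneg_left (hPC j t ht) (abs_nonneg _)
  -- The nonlinearity inherits a finite first moment from the Lipschitz bound on its difference
  -- quotients.
  have hYex : ∀ j, ∀ t ∈ Icc T 0,
      ∃ Y : L2 d, IsPos j (windowNL (2 * k) (-a) (1 - a) (freeProp a (u t))) Y := by
    intro j t ht
    refine exists_isPos_of_bounded (C := (1 - a - -a) * (((2 * k : ℕ) + 1) * M ^ (2 * k)) *
      ‖freeProp a (Z j t)‖) fun i => ?_
    refine (norm_posQuot_windowNL_le (by linarith)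
      (((hM t ht).freeProp a).mono (subset_univ _) le_rfl) j _).trans ?_
    refine mul_le_mul_of_nonneg_left ((hXa j t ht).norm_posQuot_le _) ?_
    rw [show (1 - a - -a) = 1 by ring]
    positivity
  choose! Y hY using hYex
  have h := fun j => hu.norm_sq_isPos_sub hs hM0 hM a (hP j) (hXa j) (hXaC j) (hY j) ht₁
  refine ⟨fun t => ∑ j, (4 * (inner ℂ (freeProp a (P j t)) (freeProp a (Z j t))).re +
    2 * (inner ℂ (freeProp a (Z j t)) (Y j t)).im), ?_, ?_, fun t ht => ?_⟩
  · have := IntervalIntegrable.sum Finset.univ fun j _ => (h j).1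
    refine this.congr fun t _ => ?_
    simp
  · rw [intervalIntegral.integral_finsetSum fun j _ => (h j).1, ← Finset.sum_sub_distrib]
    refine Finset.sum_congr rfl fun j _ => ?_
    rw [← (h j).2, norm_freeProp, norm_freeProp]
  · beta_reduce
    rw [Finset.sum_add_distrib, ← Finset.mul_sum, ← Finset.mul_sum, virialDensity,
      ← sum_im_inner_windowNL_freeProp hn hM0 (hM t ht) a (fun j => hXa j t ht)
        (fun j => hY j t ht), kinetic_eq_sum fun j => hP j t ht]
    have e : ∀ j, (inner ℂ (freeProp a (P j t)) (freeProp a (Z j t))).re =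
        (inner ℂ (P j t) (X j t)).re + 2 * a * ‖P j t‖ ^ 2 := fun j => by
      rw [inner_freeProp, hZ, inner_add_right, inner_smul_right, inner_self_eq_norm_sq_to_K,
        Complex.add_re, Complex.re_ofReal_mul]
      simp [← Complex.ofReal_pow]
    simp_rw [e]
    rw [Finset.sum_add_distrib, ← Finset.mul_sum]
    have : (2 * (k : ℝ) + 2) ≠ 0 := by positivity
    field_simp
    ring

theorem intervalIntegrable_mul_lpMass {M : ℝ} {f : L2 d} (hf : UnifBdd univ M f) (a : ℝ) :
    IntervalIntegrable (fun σ => (σ - a) * lpMass (2 * k) (freeProp σ f)) volume 0 1 := by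
  refine Continuous.intervalIntegrable ?_ _ _
  exact (continuous_id.sub continuous_const).mul (continuousOn_univ.1 (hf.continuousOn_lpMass k))

/-- For a = 0 the window is [0,1], where σ ≥ 0, so every nonlinear term is nonpositive and may be
dropped. -/
theorem virialDensity_zero_le (k n : ℕ) (A : ℝ) (f : L2 d) : virialDensity k n 0 A f ≤ 4 * A := by
  have h1 : 0 ≤ ∫ σ in (0 : ℝ)..1, (σ - 0) * lpMass (2 * k) (freeProp σ f) :=
    intervalIntegral.integral_nonneg zero_le_one fun σ hσ =>
      mul_nonneg (by linarith [hσ.1]) (lpMass_nonneg _ _)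
  have h2 := lpMass_nonneg (2 * k) (freeProp 1 f)
  rw [virialDensity]
  have h3 : 0 ≤ 4 * ((n : ℝ) + 1) * ∫ σ in (0 : ℝ)..1, (σ - 0) * lpMass (2 * k) (freeProp σ f) :=
    mul_nonneg (by positivity) h1
  have h4 : 2 / (2 * (k : ℝ) + 2) * (-4 * (1 - 0) ^ 2 * lpMass (2 * k) (freeProp 1 f) +
      4 * 0 ^ 2 * lpMass (2 * k) f -
      4 * (n + 1) * ∫ σ in (0 : ℝ)..1, (σ - 0) * lpMass (2 * k) (freeProp σ f)) ≤ 0 :=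
    mul_nonpos_of_nonneg_of_nonpos (by positivity) (by linarith)
  linarith

/-- The terms in A and in ∫|f|^{p+2} cancel, and the weights satisfy (σ + 1) - (σ - 1) = 2. Compared
with 32E, the kinetic parts agree, and the potential part needs 16(n+1) ≥ 32, which is where dk ≥ 4
enters. -/
theorem le_virialDensity_sub (hn : 1 ≤ n) {M : ℝ} {f : L2 d} (hf : UnifBdd univ M f) (A : ℝ) :
    32 * energy (-1) (2 * k) f ≤ virialDensity k n 1 A f - virialDensity k n (-1) A f := by
  have h1 : (∫ σ in (0 : ℝ)..1, (σ - -1) * lpMass (2 * k) (freeProp σ f)) -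
      ∫ σ in (0 : ℝ)..1, (σ - 1) * lpMass (2 * k) (freeProp σ f) = 2 * potential (2 * k) f := by
    rw [← intervalIntegral.integral_sub (intervalIntegrable_mul_lpMass hf (-1))
      (intervalIntegrable_mul_lpMass hf 1), potential_eq, windowPot,
      ← intervalIntegral.integral_const_mul]
    refine intervalIntegral.integral_congr fun σ _ => ?_
    ring
  have hF := lpMass_nonneg (2 * k) (freeProp 1 f)
  have hU := potential_nonneg (2 * k) f
  have hn' : (1 : ℝ) ≤ n := by exact_mod_cast hn
  have e : virialDensity k n 1 A f - virialDensity k n (-1) A f = 16 * kinetic f +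
      1 / (2 * k + 2) * (32 * lpMass (2 * k) (freeProp 1 f) +
        16 * (n + 1) * potential (2 * k) f) := by
    rw [virialDensity, virialDensity]
    linear_combination (8 * ((n : ℝ) + 1) / (2 * k + 2)) * h1
  rw [e, energy_eq]
  have : 1 / (2 * (k : ℝ) + 2) * (32 * potential (2 * k) f) ≤
      1 / (2 * (k : ℝ) + 2) * (32 * lpMass (2 * k) (freeProp 1 f) +
        16 * (n + 1) * potential (2 * k) f) := by
    gcongr
    nlinarith
  linarith

/-- Polarisation: A is recovered from the two propagated variances a = ±1, so it never has to be
differentiated itself. -/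
theorem norm_add_sq_sub_norm_sub_sq (X P : L2 d) :
    ‖X + ((2 * 1 : ℝ) : ℂ) • P‖ ^ 2 - ‖X + ((2 * (-1) : ℝ) : ℂ) • P‖ ^ 2 =
      8 * (inner ℂ P X).re := by
  rw [@norm_add_sq ℂ, @norm_add_sq ℂ, norm_smul, norm_smul, inner_smul_right, inner_smul_right,
    ← inner_conj_symm X P]
  simp [-inner_conj_symm]
  ring

theorem IsSolution.le_sum_re_inner (hn : d * k = n + 3) (hn1 : 1 ≤ n) (hs : 2 ≤ s)
    (hu : IsSolution (-1) (2 * k) s (Icc T 0) u) (hT : T ≤ 0)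
    {M : ℝ} (hM0 : 0 ≤ M) (hM : ∀ t ∈ Icc T 0, UnifBdd univ M (u t))
    {P X : Fin d → ℝ → L2 d} {C : ℝ} (hP : ∀ j, ∀ t ∈ Icc T 0, IsMom j (u t) (P j t))
    (hPC : ∀ j, ∀ t ∈ Icc T 0, ‖P j t‖ ≤ C)
    (hX : ∀ j, ∀ t ∈ Icc T 0, IsPos j (u t) (X j t)) (hXC : ∀ j, ∀ t ∈ Icc T 0, ‖X j t‖ ≤ C) :
    ∑ j, (inner ℂ (P j 0) (X j 0)).re + 4 * energy (-1) (2 * k) (u 0) * (-T) ≤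
      ∑ j, (inner ℂ (P j T) (X j T)).re := by
  have hTm : T ∈ Icc T 0 := ⟨le_rfl, hT⟩
  obtain ⟨G, hGi, hG, hGe⟩ := hu.sum_norm_sq_sub hn hs hM0 hM hP hPC hX hXC 1 hTm
  obtain ⟨G', hGi', hG', hGe'⟩ := hu.sum_norm_sq_sub hn hs hM0 hM hP hPC hX hXC (-1) hTm
  have e : ∀ t, 8 * ∑ j, (inner ℂ (P j t) (X j t)).re =
      ∑ j, ‖X j t + ((2 * 1 : ℝ) : ℂ) • P j t‖ ^ 2 -
        ∑ j, ‖X j t + ((2 * (-1) : ℝ) : ℂ) • P j t‖ ^ 2 := fun t => by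
    rw [← Finset.sum_sub_distrib, Finset.mul_sum]
    exact Finset.sum_congr rfl fun j _ => (norm_add_sq_sub_norm_sub_sq _ _).symm
  have hint : ∫ _ in T..0, 32 * energy (-1) (2 * k) (u 0) ≤ ∫ t in T..0, (G t - G' t) := by
    refine intervalIntegral.integral_mono_on hT intervalIntegrable_const (hGi.sub hGi')
      fun t ht => ?_
    rw [hGe t ht, hGe' t ht, ← hu.energy_eq_energy hs hM ht]
    exact le_virialDensity_sub hn1 (hM t ht) _
  rw [intervalIntegral.integral_sub hGi hGi', ← hG, ← hG', intervalIntegral.integral_const,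
    smul_eq_mul] at hint
  linarith [e T, e 0]

theorem sum_re_inner_sq_le (P X : Fin d → L2 d) :
    (∑ j, (inner ℂ (P j) (X j)).re) ^ 2 ≤ (∑ j, ‖X j‖ ^ 2) * ∑ j, ‖P j‖ ^ 2 := by
  refine le_trans ?_ (Finset.sum_mul_sq_le_sq_mul_sq Finset.univ (fun j => ‖X j‖) fun j => ‖P j‖)
  refine sq_le_sq' ?_ ?_
  · rw [← Finset.sum_neg_distrib]
    refine Finset.sum_le_sum fun j _ => ?_
    have := (Complex.abs_re_le_norm (inner ℂ (P j) (X j))).trans (norm_inner_le_norm (𝕜 := ℂ) _ _)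
    linarith [neg_abs_le (inner ℂ (P j) (X j)).re]
  · refine Finset.sum_le_sum fun j _ => ?_
    have := (Complex.abs_re_le_norm (inner ℂ (P j) (X j))).trans (norm_inner_le_norm (𝕜 := ℂ) _ _)
    linarith [le_abs_self (inner ℂ (P j) (X j)).re]

/-- An absorption argument: with S the supremum of the variance on [T, 0], |A| ≤ √(2ES) and the case
a = 0 give S ≤ V(0) + S/2 + 16ET². The uniform bound `hXC` makes S finite, so S/2 can be absorbed.
-/
theorem IsSolution.sum_norm_sq_le (hn : d * k = n + 3) (hs : 2 ≤ s)
    (hu : IsSolution (-1) (2 * k) s (Icc T 0) u) (hT : T < 0)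
    {M : ℝ} (hM0 : 0 ≤ M) (hM : ∀ t ∈ Icc T 0, UnifBdd univ M (u t))
    {P X : Fin d → ℝ → L2 d} {C : ℝ} (hP : ∀ j, ∀ t ∈ Icc T 0, IsMom j (u t) (P j t))
    (hPC : ∀ j, ∀ t ∈ Icc T 0, ‖P j t‖ ≤ C)
    (hX : ∀ j, ∀ t ∈ Icc T 0, IsPos j (u t) (X j t)) (hXC : ∀ j, ∀ t ∈ Icc T 0, ‖X j t‖ ≤ C) :
    ∑ j, ‖X j T‖ ^ 2 ≤ 2 * ∑ j, ‖X j 0‖ ^ 2 + 32 * energy (-1) (2 * k) (u 0) * T ^ 2 := by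
  set E := energy (-1) (2 * k) (u 0)
  set V : ℝ → ℝ := fun t => ∑ j, ‖X j t‖ ^ 2
  have hV0 : ∀ t, 0 ≤ V t := fun t => Finset.sum_nonneg fun _ _ => by positivity
  have hTm : T ∈ Icc T 0 := ⟨le_rfl, hT.le⟩
  have hE0 : 0 ≤ E := by
    have := (kinetic_nonneg (u 0)).trans (kinetic_le_two_energy k (u 0))
    linarith
  have hbdd : BddAbove (V '' Icc T 0) := by
    refine ⟨∑ _ : Fin d, C ^ 2, ?_⟩
    rintro _ ⟨t, ht, rfl⟩
    exact Finset.sum_le_sum fun j _ => pow_le_pow_left₀ (norm_nonneg _) (hXC j t ht) 2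
  set S := sSup (V '' Icc T 0)
  have hVS : ∀ t ∈ Icc T 0, V t ≤ S := fun t ht => le_csSup hbdd ⟨t, ht, rfl⟩
  -- AM-GM on √(32ES), weighted so that integration over a time |T| produces exactly S/2.
  have hA : ∀ t ∈ Icc T 0, 4 * ∑ j, (inner ℂ (P j t) (X j t)).re ≤
      S / (2 * (-T)) + 16 * (-T) * E := by
    intro t ht
    have h1 := sum_re_inner_sq_le (fun j => P j t) (fun j => X j t)
    rw [← kinetic_eq_sum fun j => hP j t ht] at h1
    have hK : kinetic (u t) ≤ 2 * E := by
      rw [show E = energy (-1) (2 * k) (u t) from (hu.energy_eq_energy hs hM ht).symm]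
      exact kinetic_le_two_energy _ _
    have hS0 : 0 ≤ S := (hV0 t).trans (hVS t ht)
    set A := ∑ j, (inner ℂ (P j t) (X j t)).re
    have h2 : A ^ 2 ≤ S * (2 * E) := h1.trans
      (mul_le_mul (hVS t ht) hK (kinetic_nonneg _) hS0)
    have hT' : 0 < -T := by linarith
    have hTne : T ≠ 0 := hT.ne
    refine abs_le_of_sq_le_sq' ?_ (by positivity) |>.2
    have h3 : (S / (2 * (-T)) + 16 * (-T) * E) ^ 2 - 16 * (S * (2 * E)) =
        (S / (2 * (-T)) - 16 * (-T) * E) ^ 2 := by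
      field_simp
      ring
    nlinarith [sq_nonneg (S / (2 * (-T)) - 16 * (-T) * E)]
  have hmain : ∀ t₁ ∈ Icc T 0, V t₁ ≤ V 0 + S / 2 + 16 * T ^ 2 * E := by
    intro t₁ ht₁
    obtain ⟨G, hGi, hG, hGe⟩ := hu.sum_norm_sq_sub hn hs hM0 hM hP hPC hX hXC 0 ht₁
    have hint : ∫ t in t₁..0, G t ≤ ∫ _ in t₁..0, (S / (2 * (-T)) + 16 * (-T) * E) := by
      refine intervalIntegral.integral_mono_on ht₁.2 hGi intervalIntegrable_const fun t ht => ?_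
      have ht' : t ∈ Icc T 0 := ⟨ht₁.1.trans ht.1, ht.2⟩
      rw [hGe t ht']
      exact (virialDensity_zero_le _ _ _ _).trans (hA t ht')
    rw [← hG, intervalIntegral.integral_const, smul_eq_mul] at hint
    simp only [mul_zero, Complex.ofReal_zero, zero_smul, add_zero] at hint
    have hS0 : 0 ≤ S := (hV0 _).trans (hVS _ hTm)
    have hT' : 0 < -T := by linarith
    have h2 : (0 - t₁) * (S / (2 * (-T)) + 16 * (-T) * E) ≤
        (-T) * (S / (2 * (-T)) + 16 * (-T) * E) :=
      mul_le_mul_of_nonneg_right (by linarith [ht₁.1]) (by positivity)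
    have h3 : (-T) * (S / (2 * (-T)) + 16 * (-T) * E) = S / 2 + 16 * T ^ 2 * E := by
      have hTne : T ≠ 0 := hT.ne
      field_simp
      ring
    change V t₁ - V 0 ≤ _ at hint
    linarith
  have hS : S ≤ V 0 + S / 2 + 16 * T ^ 2 * E := by
    refine csSup_le ⟨_, T, hTm, rfl⟩ ?_
    rintro _ ⟨t, ht, rfl⟩
    exact hmain t ht
  have := hVS T hTm
  change V T ≤ 2 * V 0 + 32 * E * T ^ 2
  linarith

end Solution

/-! ### Real data -/

/-- P_j f is the limit of 1/(iε) times differences of translates of f. Those differences and x_j f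
are real, so each approximating inner product is purely imaginary. -/
theorem re_inner_isMom_isPos_of_real {j : Fin d} {f P X : L2 d} (hf : ∀ᵐ x, (f x).im = 0)
    (hP : IsMom j f P) (hX : IsPos j f X) : (inner ℂ P X).re = 0 := by
  have h1 := (Complex.continuous_re.tendsto _).comp
    (hP.tendsto_trans.inner (tendsto_const_nhds (x := X)) (𝕜 := ℂ))
  refine tendsto_nhds_unique h1 (tendsto_const_nhds.congr fun ε => ?_)
  simp only [Function.comp]
  rw [inner_smul_left, mul_inv, map_mul, Complex.inv_I, map_neg, Complex.conj_I, neg_neg,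
    map_inv₀, Complex.conj_ofReal, ← Complex.ofReal_inv, mul_assoc, Complex.re_ofReal_mul,
    Complex.I_mul_re]
  have h2 : (inner ℂ (trans (-ε • basisVec j) f - f) X).im = 0 := by
    have h3 := integral_im (𝕜 := ℂ) (L2.integrable_inner (𝕜 := ℂ) (trans (-ε • basisVec j) f - f) X)
    rw [L2.inner_def]
    refine h3.symm.trans ((integral_congr_ae ?_).trans (integral_zero _ _))
    filter_upwards [Lp.coeFn_sub (trans (-ε • basisVec j) f) f, coeFn_trans (-ε • basisVec j) f,
      ae_comp_sub (-ε • basisVec j) hf, hf, hX] with x e1 e2 e3 e4 e5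
    rw [e1, Pi.sub_apply, e2, e5]
    simp [e4, -sub_neg_eq_add, -neg_smul, e3]
  rw [h2]
  simp

theorem exists_isPos_of_memLp {f : L2 d}
    (h : MemLp (fun x : Sp d => (‖x‖ : ℂ) * f x) 2 volume) (j : Fin d) :
    ∃ X : L2 d, IsPos j f X := by
  have h1 : MemLp (fun x : Sp d => (x j : ℂ) * f x) 2 volume := by
    refine h.of_le ((Continuous.aestronglyMeasurable (by fun_prop)).mul (Lp.memLp f).1)
      (Eventually.of_forall fun x => ?_)
    rw [norm_mul, norm_mul, Complex.norm_real, Complex.norm_real, norm_norm]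
    gcongr
    exact PiLp.norm_apply_le x j
  exact ⟨h1.toLp, h1.coeFn_toLp⟩

/-! ### Growth of the kinetic energy -/

theorem IsSolution.energy_le_kinetic {k : ℕ} {s T κ : ℝ} {u : ℝ → L2 d} (hdk : 4 ≤ d * k)
    (hs : 2 ≤ s) (hds : (d : ℝ) / 2 < s) (hT : T < 0)
    (hu : IsSolution (-1) (2 * k) s (Icc T 0) u) (hreal : ∀ᵐ x, (u 0 x).im = 0)
    (hvar : MemLp (fun x => (‖x‖ : ℂ) * u 0 x) 2 volume) (hκ : 0 < κ)
    (hE : 0 < energy (-1) (2 * k) (u 0))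
    (hV : κ * variance (u 0) ≤ energy (-1) (2 * k) (u 0) * T ^ 2) :
    16 / (2 / κ + 32) * energy (-1) (2 * k) (u 0) ≤ kinetic (u T) := by
  obtain ⟨n, hn⟩ : ∃ n, d * k = n + 3 := ⟨d * k - 3, by omega⟩
  obtain ⟨M, hM0, hM⟩ := hu.exists_unifBdd hds
  have h0 : (0 : ℝ) ∈ Icc T 0 := ⟨hT.le, le_rfl⟩
  have hTm : T ∈ Icc T 0 := ⟨le_rfl, hT.le⟩
  have hPex : ∀ j, ∀ t ∈ Icc T 0, ∃ P : L2 d, IsMom j (u t) P := fun j t ht =>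
    exists_isMom hs (hu.mem_sobolev t ht) j
  choose! P hP using hPex
  choose X₀ hX₀ using exists_isPos_of_memLp hvar
  choose B hB using fun j => hu.exists_isPos hs hM0 hM (hX₀ j)
  choose! X hX hXB using hB
  set E := energy (-1) (2 * k) (u 0)
  have hP2 : ∀ j, ∀ t ∈ Icc T 0, ‖P j t‖ ≤ √(2 * E) := fun j t ht => by
    refine Real.le_sqrt_of_sq_le
      (((hP j t ht).norm_sq_le_kinetic hs (hu.mem_sobolev t ht)).trans ?_)
    rw [show E = energy (-1) (2 * k) (u t) from (hu.energy_eq_energy hs hM ht).symm]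
    exact kinetic_le_two_energy _ _
  set C := √(2 * E) + ∑ j, |B j|
  have hPC : ∀ j, ∀ t ∈ Icc T 0, ‖P j t‖ ≤ C := fun j t ht =>
    (hP2 j t ht).trans (le_add_of_nonneg_right (Finset.sum_nonneg fun _ _ => abs_nonneg _))
  have hXC : ∀ j, ∀ t ∈ Icc T 0, ‖X j t‖ ≤ C := fun j t ht => by
    refine ((hXB j t ht).trans (le_abs_self _)).trans (le_trans ?_
      (le_add_of_nonneg_left (Real.sqrt_nonneg _)))
    exact Finset.single_le_sum (f := fun j => |B j|) (fun _ _ => abs_nonneg _) (Finset.mem_univ j)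
  have hA := hu.le_sum_re_inner hn (by omega) hs hT.le hM0 hM hP hPC hX hXC
  have hVT := hu.sum_norm_sq_le hn hs hT hM0 hM hP hPC hX hXC
  rw [Finset.sum_eq_zero fun j _ => re_inner_isMom_isPos_of_real hreal (hP j 0 h0) (hX j 0 h0),
    zero_add] at hA
  rw [← variance_eq_sum fun j => hX j 0 h0] at hVT
  have hCS := sum_re_inner_sq_le (fun j => P j T) (fun j => X j T)
  rw [← kinetic_eq_sum fun j => hP j T hTm] at hCS
  have hV0 : variance (u 0) ≤ E * T ^ 2 / κ := by
    rw [le_div_iff₀ hκ, mul_comm]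
    exact hV
  have hK := kinetic_nonneg (u T)
  have hT2 : 0 < T ^ 2 := sq_pos_of_neg hT
  -- Cauchy–Schwarz at time T, with A(T) bounded below and V(T) above; dividing by E T² > 0 gives
  -- the constant 16/(2/κ + 32).
  have h1 : (4 * E * (-T)) ^ 2 ≤ ((2 / κ + 32) * (E * T ^ 2)) * kinetic (u T) := by
    refine (pow_le_pow_left₀ (mul_nonneg (by positivity) (by linarith)) hA 2).trans
      (hCS.trans (mul_le_mul_of_nonneg_right (hVT.trans ?_) hK))
    calc _ ≤ 2 * (E * T ^ 2 / κ) + 32 * E * T ^ 2 := by gcongr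
      _ = _ := by ring
  rw [div_mul_eq_mul_div, div_le_iff₀ (by positivity)]
  refine le_of_mul_le_mul_left ?_ (mul_pos hE hT2)
  linarith

end GabitovTuritsyn

end

/-! ### The main theorem -/

open GabitovTuritsyn in
theorem mainTheorem6 (d p : ℕ) (hp : 2 ≤ p) (hp_even : Even p) (hdp : 8 ≤ d * p)
    (κ₁ κ₂ : ℝ) (hκ₁ : 0 < κ₁) (hκ : κ₁ ≤ κ₂) :
    ∃ c C : ℝ, 0 < c ∧ 0 < C ∧
      ∀ s : ℝ, 2 ≤ s → (d : ℝ) / 2 < s →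
      ∀ (T : ℝ) (u : ℝ → L2 d), T < 0 → -(1 / 2) ≤ T →
        IsSolution (-1) p s (Set.Icc T 0) u →
        -- the data are real-valued and of finite variance
        (∀ᵐ x, (u 0 x).im = 0) →
        MeasureTheory.MemLp (fun x => (‖x‖ : ℂ) * u 0 x) 2 MeasureTheory.volume →
        -- `T ^ 2` is comparable to variance / energy
        κ₁ * (variance (u 0) / energy (-1) p (u 0)) ≤ T ^ 2 →
        T ^ 2 ≤ κ₂ * (variance (u 0) / energy (-1) p (u 0)) →
        c * potential p (u T) ≤ kinetic (u T) ∧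
        (kinetic (u 0) ≤ potential p (u 0) →
          (c * potential p (u 0) ≤ kinetic (u T) ∧
            kinetic (u T) ≤ C * potential p (u 0)) ∧
          ∃ t ∈ Set.Icc T 0,
            c * potential p (u t) ≤ kinetic (u t) ∧
            kinetic (u t) ≤ C * potential p (u t)) := by
  obtain ⟨k, rfl⟩ : ∃ k, p = 2 * k := even_iff_exists_two_mul.1 hp_even
  have hdk : 4 ≤ d * k := by
    have : d * (2 * k) = 2 * (d * k) := by ring
    omega
  set c₀ := 16 / (2 / κ₁ + 32) with hc₀
  have hc₀0 : 0 < c₀ := by positivity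
  have hc₀1 : c₀ ≤ 1 := by
    rw [hc₀, div_le_one (by positivity)]
    linarith [show 0 < 2 / κ₁ by positivity]
  have hk2 : (2 : ℝ) ≤ 2 * k + 2 := by linarith [(Nat.cast_nonneg k : (0 : ℝ) ≤ k)]
  have hk0 : (0 : ℝ) < 2 * k + 2 := by linarith
  have hk1 : 1 / (2 * (k : ℝ) + 2) ≤ 1 / 2 := one_div_le_one_div_of_le two_pos hk2
  have hc1 : c₀ * (1 / (2 * (k : ℝ) + 2)) ≤ 1 := by
    calc _ ≤ 1 * (1 / 2 : ℝ) := by gcongr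
      _ ≤ 1 := by norm_num
  -- c₀ is the fraction of E that K holds at time T, and E ≥ U/(2k+2). The constant 2 comes from
  -- K(u(T)) ≤ 2E = K(u₀) + 2U(u₀)/(2k+2) ≤ 2U(u₀) when K(u₀) ≤ U(u₀).
  refine ⟨c₀ * (1 / (2 * k + 2)), 2, by positivity, two_pos, ?_⟩
  intro s hs hds T u hT _ hu hreal hvar h1 h2
  obtain ⟨M, -, hM⟩ := hu.exists_unifBdd hds
  have h0 : (0 : ℝ) ∈ Set.Icc T 0 := ⟨hT.le, le_rfl⟩
  have hTm : T ∈ Set.Icc T 0 := ⟨le_rfl, hT.le⟩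
  have hT2 : 0 < T ^ 2 := sq_pos_of_neg hT
  have hU : ∀ f : L2 d, 0 ≤ potential (2 * k) f := potential_nonneg _
  have hE : 0 < energy (-1) (2 * k) (u 0) := by
    have hE0 : 0 ≤ energy (-1) (2 * k) (u 0) := by
      have := (kinetic_nonneg (u 0)).trans (kinetic_le_two_energy k (u 0))
      linarith
    -- If E = 0, the quotient V/E is 0 by the convention for division by zero, and the upper bound
    -- on T² contradicts T < 0.
    refine hE0.lt_of_ne fun h => ?_
    rw [← h, div_zero, mul_zero] at h2
    linarith
  have hKT : c₀ * energy (-1) (2 * k) (u 0) ≤ kinetic (u T) := by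
    refine hu.energy_le_kinetic hdk hs hds hT hreal hvar hκ₁ hE ?_
    rwa [← mul_div_assoc, div_le_iff₀ hE, mul_comm (T ^ 2)] at h1
  have hUE : ∀ t ∈ Set.Icc T 0,
      c₀ * (1 / (2 * k + 2)) * potential (2 * k) (u t) ≤ kinetic (u T) := by
    intro t ht
    refine le_trans ?_ hKT
    rw [mul_assoc, ← hu.energy_eq_energy hs hM ht, energy_eq]
    gcongr
    linarith [kinetic_nonneg (u t)]
  refine ⟨hUE T hTm, fun hK => ⟨⟨hUE 0 h0, ?_⟩, ?_⟩⟩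
  · have h3 := kinetic_le_two_energy k (u T)
    rw [hu.energy_eq_energy hs hM hTm, energy_eq] at h3
    have h4 := mul_le_mul_of_nonneg_right hk1 (hU (u 0))
    linarith
  · have hle : ∀ f : L2 d, c₀ * (1 / (2 * k + 2)) * potential (2 * k) f ≤ potential (2 * k) f :=
      fun f => mul_le_of_le_one_left (hU f) hc1
    -- Either t = 0 already works, or K - cU is negative at 0 and nonnegative at T. At a zero K =
    -- cU, and c ≤ 1 gives the upper bound.
    by_cases hc : c₀ * (1 / (2 * k + 2)) * potential (2 * k) (u 0) ≤ kinetic (u 0)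
    · exact ⟨0, h0, hc, by linarith [hU (u 0)]⟩
    · have hcont : ContinuousOn (fun t => kinetic (u t) -
          c₀ * (1 / (2 * k + 2)) * potential (2 * k) (u t)) (Set.Icc T 0) := fun t ht =>
        ((hasDerivWithinAt_kinetic hs hu ht).continuousWithinAt).sub
          ((hasDerivWithinAt_potential hu hM ht).continuousWithinAt.const_mul _)
      obtain ⟨t, ht, he⟩ := intermediate_value_Icc' hT.le hcont
        (show (0 : ℝ) ∈ Set.Icc _ _ from ⟨by linarith, by linarith [hUE T hTm]⟩)
      simp only [sub_eq_zero] at he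
      exact ⟨t, ht, he.ge, by linarith [hle (u t), hU (u t)]⟩
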